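/- **Theorem (deterministic recovery guarantee).** *Setting.* Let $d\ge 1$, let $W_i\in\mathbb R^{n_i\times n_{i-1}}$ ($i=1,\dots,d$), put $k=n_0$, $n=n_d$, and let $G:\mathbb R^k\to\mathbb R^n$, $G(x)=\mathrm{relu}(W_d\cdots\mathrm{relu}(W_2\,\mathrm{relu}(W_1x))\cdots)$, where $\mathrm{relu}(a)=\max(a,0)$ entrywise. Let $A\in\mathbb R^{m\times n}$, $x_*\in\mathbb R^k\setminus\{0\}$, $e\in\mathbb R^m$, $y=AG(x_*)+e$ and $f(x)=\tfrac12\|AG(x)-y\|^2$. Norms are Euclidean norms of vectors and spectral norms of matrices. A matrix $W\in\mathbb R^{p\times q}$ with rows $w_1^T,\dots,w_p^T$ satisfies the *Weight Distribution Condition* (WDC) with constant $\epsilon$ if for all nonzero $x,y\in\mathbb R^q$ $$\Big\|\sum_{i=1}^p 1_{w_i\cdot x>0}\,1_{w_i\cdot y>0}\,w_iw_i^T-Q_{x,y}\Big\|\le\epsilon,\qquad Q_{x,y}=\frac{\pi-\theta}{2\pi}I+\frac{\sin\theta}{2\pi}M_{\hat x\leftrightarrow\hat y},$$ where $\theta=\angle(x,y)$,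 $\hat x=x/\|x\|$, $\hat y=y/\|y\|$, and $M_{\hat x\leftrightarrow\hat y}$ is the matrix with $\hat x\mapsto\hat y$, $\hat y\mapsto\hat x$ and $z\mapsto 0$ for all $z\perp\mathrm{span}\{x,y\}$. The matrix $A$ satisfies the *Range Restricted Isometry Condition* (RRIC) with respect to $G$ with constant $\epsilon$ if for all $x_1,x_2,x_3,x_4\in\mathbb R^k$ $$\big|\langle A(G(x_1)-G(x_2)),A(G(x_3)-G(x_4))\rangle-\langle G(x_1)-G(x_2),G(x_3)-G(x_4)\rangle\big|\le\epsilon\,\|G(x_1)-G(x_2)\|\,\|G(x_3)-G(x_4)\|.$$ The *sign-flipping subgradient method* with step size $\nu$ starts at an arbitrary $x_0\neq0$ and, for $i=0,1,\dots$, sets $\tilde x_i=-x_i$ if $f(-x_i)<f(x_i)$ and $\tilde x_i=x_i$ otherwise, takes any $v_i\in\partial f(\tilde x_i)$, and sets $x_{i+1}=\tilde x_i-\nu v_i$. Here $\partial f(x)=\{v:\langle v,u\rangle\le f^o(x;u)\ \forall u\}$ is the Clarke subdifferential, with $f^o(x;u)=\limsup_{z\to x,\,t\downarrow0}(f(z+tu)-f(z))/t$.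 *Statement.* There are universal constants $K_1,\dots,K_7>0$ such that the following holds in every such setting. Suppose that, for some $\epsilon$ with $0<\epsilon\le K_1/d^{90}$, every $W_i$ satisfies the WDC with constant $\epsilon$ and $A$ satisfies the RRIC with respect to $G$ with constant $\epsilon$, and that $\|e\|\le\frac{K_2\|x_*\|}{d^{42}2^{d/2}}$. Let $(x_i)$ be any iterates of the sign-flipping subgradient method with step size $\nu=K_3\frac{2^d}{d^2}$, and let $C=1-\frac{\nu}{2^d}\cdot\frac78$. Then $C\in(0,1)$, and there is an integer $N\ge 0$ with $$N\le\frac{K_4f(x_0)2^d}{d^4\epsilon\|x_*\|^2}\qquad\text{and}\qquad\|x_N-x_*\|\le K_5d^9\|x_*\|\sqrt\epsilon+K_6d^62^{d/2}\|e\|,$$ and such that for all $i\ge N$ $$\|x_{i+1}-x_*\|\le C^{\,i+1-N}\|x_N-x_*\|+K_72^{d/2}\|e\|,$$ $$\|G(x_{i+1})-G(x_*)\|\le\frac{1.2}{2^{d/2}}C^{\,i+1-N}\|x_N-x_*\|+1.2K_7\|e\|.$$ -/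

import Mathlib

open Filter Topology

noncomputable section

/-- The product `W x` of a real matrix with a vector, as a map between Euclidean spaces. -/
def mulE {p q : ℕ} (W : Matrix (Fin p) (Fin q) ℝ) (x : EuclideanSpace ℝ (Fin q)) :
    EuclideanSpace ℝ (Fin p) :=
  Matrix.toLpLin 2 2 W x

/-- The spectral norm of a square matrix: its operator norm on Euclidean space. -/
def specNorm {k : ℕ} (M : Matrix (Fin k) (Fin k) ℝ) : ℝ :=
  ‖Matrix.toEuclideanCLM (𝕜 := ℝ) (n := Fin k) M‖

/-- The entrywise rectifier `max(·, 0)`. -/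
def relu {p : ℕ} (x : EuclideanSpace ℝ (Fin p)) : EuclideanSpace ℝ (Fin p) :=
  WithLp.toLp 2 (fun i => max (x i) 0)

/-- The bias-free ReLU network with `d` layers: `net n W d x = relu (W_d ⋯ relu (W_1 x))`.
The width of layer `i` is `n i` (so `n 0` is the dimension of the latent space) and `W i` is the
weight matrix from layer `i` to layer `i + 1`; only `W 0, …, W (d - 1)` are used. -/
def net (n : ℕ → ℕ) (W : (i : ℕ) → Matrix (Fin (n (i + 1))) (Fin (n i)) ℝ) :
    (d : ℕ) → EuclideanSpace ℝ (Fin (n 0)) → EuclideanSpace ℝ (Fin (n d))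
  | 0, x => x
  | d + 1, x => relu (mulE (W d) (net n W d x))

/-- The normalised vector `x / ‖x‖`. -/
def unitVec {k : ℕ} (x : EuclideanSpace ℝ (Fin k)) : EuclideanSpace ℝ (Fin k) :=
  ‖x‖⁻¹ • x

/-- The rank-one matrix `u uᵀ`. -/
def outer {k : ℕ} (u : EuclideanSpace ℝ (Fin k)) : Matrix (Fin k) (Fin k) ℝ :=
  Matrix.vecMulVec u.ofLp u.ofLp

/-- For unit vectors `a`, `b`: the matrix that sends `a` to `b`, `b` to `a`, and the orthogonal
complement of their span to zero (see `swapMatrix_left`, `swapMatrix_right`, `swapMatrix_orth`).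
It is `u uᵀ / ‖u‖² - v vᵀ / ‖v‖²` with `u = a + b`, `v = a - b`, a term whose vector is zero being
zero. -/
def swapMatrix {k : ℕ} (a b : EuclideanSpace ℝ (Fin k)) : Matrix (Fin k) (Fin k) ℝ :=
  outer (unitVec (a + b)) - outer (unitVec (a - b))

/-- The matrix `Q_{x,y} = (π - θ)/(2π) I + (sin θ)/(2π) M`, where `θ = ∠(x, y)` and `M` swaps the
directions of `x` and `y`. -/
def Qmat {k : ℕ} (x y : EuclideanSpace ℝ (Fin k)) : Matrix (Fin k) (Fin k) ℝ :=
  ((Real.pi - InnerProductGeometry.angle x y) / (2 * Real.pi)) • (1 : Matrix (Fin k) (Fin k) ℝ)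
    + (Real.sin (InnerProductGeometry.angle x y) / (2 * Real.pi)) •
      swapMatrix (unitVec x) (unitVec y)

/-- The Weight Distribution Condition with constant `ε`. -/
def WDC {p k : ℕ} (W : Matrix (Fin p) (Fin k) ℝ) (ε : ℝ) : Prop :=
  ∀ x y : EuclideanSpace ℝ (Fin k), x ≠ 0 → y ≠ 0 →
    specNorm ((∑ i : Fin p, if 0 < mulE W x i ∧ 0 < mulE W y i then
      Matrix.vecMulVec (W i) (W i) else 0) - Qmat x y) ≤ ε

/-- The Range Restricted Isometry Condition of `A` with respect to `G` with constant `ε`. -/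
def RRIC {k p m : ℕ} (A : Matrix (Fin m) (Fin p) ℝ)
    (G : EuclideanSpace ℝ (Fin k) → EuclideanSpace ℝ (Fin p)) (ε : ℝ) : Prop :=
  ∀ x₁ x₂ x₃ x₄ : EuclideanSpace ℝ (Fin k),
    |inner ℝ (mulE A (G x₁ - G x₂)) (mulE A (G x₃ - G x₄)) - inner ℝ (G x₁ - G x₂) (G x₃ - G x₄)|
      ≤ ε * ‖G x₁ - G x₂‖ * ‖G x₃ - G x₄‖

/-- The empirical risk `½ ‖A G(x) - y‖²`. -/
def empRisk {k p m : ℕ} (A : Matrix (Fin m) (Fin p) ℝ)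
    (G : EuclideanSpace ℝ (Fin k) → EuclideanSpace ℝ (Fin p)) (y : EuclideanSpace ℝ (Fin m))
    (x : EuclideanSpace ℝ (Fin k)) : ℝ :=
  (1 / 2) * ‖mulE A (G x) - y‖ ^ 2

/-- Clarke's generalized directional derivative
`limsup_{y → x, t ↓ 0} (f (y + t u) - f y) / t`, as an extended real (it is finite for locally
Lipschitz `f`). -/
def clarkeDeriv {E : Type*} [NormedAddCommGroup E] [InnerProductSpace ℝ E] (f : E → ℝ) (x u : E) :
    EReal :=
  limsup (fun q : E × ℝ => (((f (q.1 + q.2 • u) - f q.1) / q.2 : ℝ) : EReal)) (𝓝 x ×ˢ 𝓝[>] 0)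

/-- Clarke's generalized subdifferential. -/
def clarkeSubdiff {E : Type*} [NormedAddCommGroup E] [InnerProductSpace ℝ E] (f : E → ℝ) (x : E) :
    Set E :=
  {v | ∀ u : E, ((inner ℝ v u : ℝ) : EReal) ≤ clarkeDeriv f x u}

open Classical in
/-- The sign flip: `-x` if `f (-x) < f x`, and `x` otherwise. -/
def signFlip {E : Type*} [NormedAddCommGroup E] (f : E → ℝ) (x : E) : E :=
  if f (-x) < f x then -x else x

/-- `x 0, x 1, …` are iterates of the sign-flipping subgradient method for `f` with step size `ν`:
the initial point is nonzero, and each step goes from the sign-flipped iterate along the negative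
of an arbitrary Clarke subgradient there. -/
def IsSubgradientRun {E : Type*} [NormedAddCommGroup E] [InnerProductSpace ℝ E]
    (f : E → ℝ) (ν : ℝ) (x : ℕ → E) : Prop :=
  x 0 ≠ 0 ∧ ∀ i, ∃ v ∈ clarkeSubdiff f (signFlip f (x i)), x (i + 1) = signFlip f (x i) - ν • v

theorem mulE_outer {k : ℕ} (u z : EuclideanSpace ℝ (Fin k)) :
    mulE (outer u) z = (inner ℝ u z : ℝ) • u := by
  ext i
  simp [mulE, outer, Matrix.toLpLin_apply, Matrix.vecMulVec_mulVec, PiLp.inner_apply, dotProduct,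
    mul_comm]

theorem mulE_sub {p q : ℕ} (M N : Matrix (Fin p) (Fin q) ℝ) (z : EuclideanSpace ℝ (Fin q)) :
    mulE (M - N) z = mulE M z - mulE N z := by
  simp [mulE]

theorem mulE_swapMatrix {k : ℕ} (a b z : EuclideanSpace ℝ (Fin k)) :
    mulE (swapMatrix a b) z = (inner ℝ (a + b) z / ‖a + b‖ ^ 2) • (a + b)
      - (inner ℝ (a - b) z / ‖a - b‖ ^ 2) • (a - b) := by
  rw [swapMatrix, mulE_sub, mulE_outer, mulE_outer]
  simp only [unitVec, inner_smul_left, smul_smul]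
  congr 2 <;> simp <;> ring

theorem swapMatrix_left {k : ℕ} {a b : EuclideanSpace ℝ (Fin k)} (ha : ‖a‖ = 1) (hb : ‖b‖ = 1) :
    mulE (swapMatrix a b) a = b := by
  rw [mulE_swapMatrix]
  have h1 : (inner ℝ (a + b) a / ‖a + b‖ ^ 2) • (a + b) = (1 / 2 : ℝ) • (a + b) := by
    by_cases h : a + b = 0
    · simp [h]
    · have h' : ‖a + b‖ ^ 2 ≠ 0 := by positivity
      congr 1
      rw [div_eq_div_iff h' two_ne_zero, norm_add_sq_real, inner_add_left,
        real_inner_self_eq_norm_sq, ha, hb, real_inner_comm b a]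
      ring
  have h2 : (inner ℝ (a - b) a / ‖a - b‖ ^ 2) • (a - b) = (1 / 2 : ℝ) • (a - b) := by
    by_cases h : a - b = 0
    · simp [h]
    · have h' : ‖a - b‖ ^ 2 ≠ 0 := by positivity
      congr 1
      rw [div_eq_div_iff h' two_ne_zero, norm_sub_sq_real, inner_sub_left,
        real_inner_self_eq_norm_sq, ha, hb, real_inner_comm b a]
      ring
  rw [h1, h2]
  module

theorem swapMatrix_right {k : ℕ} {a b : EuclideanSpace ℝ (Fin k)} (ha : ‖a‖ = 1) (hb : ‖b‖ = 1) :
    mulE (swapMatrix a b) b = a := by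
  have h : swapMatrix a b = swapMatrix b a := by
    have h' : outer (unitVec (a - b)) = outer (unitVec (b - a)) := by
      have hneg : unitVec (a - b) = -unitVec (b - a) := by
        rw [unitVec, unitVec, norm_sub_rev, ← neg_sub b a, smul_neg]
      rw [hneg]
      simp [outer, Matrix.neg_vecMulVec, Matrix.vecMulVec_neg]
    rw [swapMatrix, swapMatrix, h', add_comm a b]
  rw [h, swapMatrix_left hb ha]

theorem swapMatrix_orth {k : ℕ} {a b z : EuclideanSpace ℝ (Fin k)}
    (haz : inner ℝ a z = 0) (hbz : inner ℝ b z = 0) : mulE (swapMatrix a b) z = 0 := by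
  rw [mulE_swapMatrix]
  simp [inner_add_left, inner_sub_left, haz, hbz]

end

/-!
Under the Weight Distribution Condition a ReLU layer `x ↦ relu (W x)` halves squared lengths up to
a factor `1 ± 2ε`, and it changes the angle between two inputs by an explicit function. Multiplying
each layer by `√2` therefore gives a network `P = scaledNet n W d` whose layers nearly preserve
norms. In terms of `P` the risk is `2⁻ᵈ F` with `F = scaledRisk`, and the iteration becomes a
subgradient step for `F` of size `κ = K₃ / d²`, so all powers of `2ᵈ` disappear. Write `z` for the
target, `η = 2ε`, and `e` for the rescaled noise.

*Angles.* If `t` is the angle between two inputs of a layer, the cosine of the angle between the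
outputs is `Φ(t) = ((π - t) cos t + sin t) / π` up to `2η` (`angleKernel`). From
`sin t - t cos t ≥ (8/3) sin³(t/2)` one gets a recursion for `sin(θᵢ/2)`, where `θᵢ` is the angle
between the `i`-th layer outputs at `x` and at `z`; it gives `sin(θᵢ/2) ≤ 5/(i + 5)`
(`sin_half_layerAngle_le`). Hence `Π = ∏ⱼ (1 - θⱼ/π)` is at least `(1 - θ₀/π) / d⁵`
(`le_angleProd`). As a function of the cosine, `Φ` is convex with slope `1 - t/π`, so in the same
way the gap between the last-layer cosines at `-x` and at `x` is at least `1/(4d⁵)` when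
`θ₀ ≥ 2π/3` (`cos_gap`).

*Subgradients.* `P` is piecewise linear, so along every ray it has a one-sided tangent `δ`
(`WellDistributed.exists_tangent`), and the one-sided derivatives of `F` at `w` are within
`R(w)‖u‖` of `⟨H(w), u⟩` for the explicit field
`H(w) = w - Π z + ((Π ⟨w, z⟩ - ⟨P w, P z⟩) / ‖w‖²) w` and a radius `R` of order
`d² η (‖w‖ + ‖z‖) + ‖e‖`. The mean value inequality along short segments turns this into
`‖v - H(x)‖ ≤ R(x)` for every Clarke subgradient `v` at `x ≠ 0`
(`norm_sub_le_of_mem_clarkeSubdiff`). The field `H` is Lipschitz away from `0`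
(`norm_gradModel_sub_le`), so a step along a subgradient that is large compared with `R` decreases
`F` by at least `(κ/2)‖v‖²` (`RRIC.scaledRisk_step_le`).

*Small subgradients.* If `H(x)` is small, its component orthogonal to `x`, which is `-Π` times that
of `z`, forces `x` to be nearly parallel to `z`, either in the direction of `z` or opposite to it.
When `θ₀ ≥ 2π/3` and `‖x‖ ≤ 2‖z‖`, the cosine gap gives `F(-x) < F(x)`
(`RRIC.scaledRisk_sub_neg_ge`), so the sign flip excludes the opposite direction; the radial
component of `H(x)` then fixes `‖x‖`, and `x` lies within `100 d⁵ (σ‖z‖ + ‖e‖)` of `z`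
(`RRIC.norm_sub_le_of_norm_le`).

*Iterates.* After a sign flip `⟨P x, P z⟩ ≥ 0.3‖x‖‖z‖`, so near the origin the norm grows by a fixed
amount per step: the iterates leave the ball of radius `0.1‖z‖` within about `1/κ` steps, stay
outside it, and never vanish. From then on `F` decreases by `(κ/2) σ²‖z‖²` per step until a small
subgradient occurs, which bounds the number of steps by a multiple of `F(x₀) / (κ σ²‖z‖²)`
(`IsScaledRun.exists_entry`). With `σ = d³ √ε` this is the claimed `N`.

*Contraction.* Within `10⁻⁶ ‖z‖ / d²` of `z` the activation patterns at `w` and `z` differ only in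
rows on which both are small, and the estimate improves to `‖v - (x - z)‖ ≤ ‖x - z‖/16 + 1.1‖e‖`
(`RRIC.norm_sub_near_le`). Its error is proportional to `‖x - z‖`, with no term of order `η‖z‖`, so
there is no flip and each step contracts the distance to `z` by the factor `1 - 15κ/16`, up to the
noise (`IsScaledRun.local_convergence`).
-/

noncomputable section

open InnerProductGeometry

/-! ### A single ReLU layer under the Weight Distribution Condition -/

/-- The properties of a rescaled ReLU layer that follow from the Weight Distribution Condition:
`L` is the layer and `D x` is the linear map obtained by freezing the activation pattern at `x`.

* `inner_self_right` is the condition tested on `(u, y)`, where `2 Q_{x,y} y` has a closed form.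
* `inner_near` is the crude consequence for arbitrary `u`, `v`: `2 Q_{x,y}` differs from the
  identity by at most the angle.
* `eventually_eq`: the pattern is constant on an initial open piece of every ray from `p`, and that
  pattern also computes `L p`.
* `mismatch`: a row active at exactly one of `p`, `q` takes values of opposite sign there, so its
  value at `q` is bounded by its value at `p - q`. -/
structure IsReluLayer {E F : Type*} [NormedAddCommGroup E] [InnerProductSpace ℝ E]
    [NormedAddCommGroup F] [InnerProductSpace ℝ F] (L : E → F) (D : E → E →ₗ[ℝ] F) (η : ℝ) :
    Prop where
  continuous : Continuous L
  apply_eq : ∀ x, L x = D x x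
  inner_self_right : ∀ x y u, x ≠ 0 → y ≠ 0 →
    |inner ℝ (D x u) (D y y) - ((1 - angle x y / Real.pi) * inner ℝ u y +
      Real.sin (angle x y) / Real.pi * (‖y‖ / ‖x‖) * inner ℝ u x)| ≤ η * ‖u‖ * ‖y‖
  inner_near : ∀ x y u v, x ≠ 0 → y ≠ 0 →
    |inner ℝ (D x u) (D y v) - inner ℝ u v| ≤ (η + angle x y) * ‖u‖ * ‖v‖
  eventually_eq : ∀ p δ, ∃ T : E →ₗ[ℝ] F, T p = L p ∧ ∀ᶠ s : ℝ in 𝓝[>] 0, D (p + s • δ) = T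
  mismatch : ∀ p q, ‖(D p - D q) q‖ ≤ ‖(D p - D q) (p - q)‖

/-- The linear map `√2 · W` with the rows inactive at `x` replaced by zero. -/
def maskedMap {p q : ℕ} (W : Matrix (Fin p) (Fin q) ℝ) (x : EuclideanSpace ℝ (Fin q)) :
    EuclideanSpace ℝ (Fin q) →ₗ[ℝ] EuclideanSpace ℝ (Fin p) where
  toFun u := WithLp.toLp 2 (fun i => if 0 < mulE W x i then √2 * mulE W u i else 0)
  map_add' u v := by
    ext i
    by_cases h : 0 < mulE W x i <;> simp [h]
    simp [mulE, mul_add]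
  map_smul' c u := by
    ext i
    by_cases h : 0 < mulE W x i <;> simp [h]
    simp [mulE]
    ring

theorem maskedMap_apply {p q : ℕ} (W : Matrix (Fin p) (Fin q) ℝ) (x u : EuclideanSpace ℝ (Fin q))
    (i : Fin p) :
    maskedMap W x u i = if 0 < mulE W x i then √2 * mulE W u i else 0 := rfl

theorem mulE_apply {p q : ℕ} (W : Matrix (Fin p) (Fin q) ℝ) (u : EuclideanSpace ℝ (Fin q))
    (i : Fin p) : mulE W u i = ∑ j, W i j * u j := by
  simp [mulE, Matrix.toLpLin_apply, Matrix.mulVec, dotProduct]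

/-- The ReLU layer of `W`, multiplied by `√2` so that it nearly preserves norms under the Weight
Distribution Condition. -/
def layerMap {p q : ℕ} (W : Matrix (Fin p) (Fin q) ℝ) (x : EuclideanSpace ℝ (Fin q)) :
    EuclideanSpace ℝ (Fin p) :=
  √2 • relu (mulE W x)

theorem continuous_mulE {p q : ℕ} (M : Matrix (Fin p) (Fin q) ℝ) : Continuous (mulE M) :=
  LinearMap.continuous_of_finiteDimensional (Matrix.toLpLin 2 2 M)

theorem continuous_layerMap {p q : ℕ} (W : Matrix (Fin p) (Fin q) ℝ) :
    Continuous (layerMap W) := by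
  have h2 : Continuous (fun x => relu (mulE W x)) := by
    refine (PiLp.continuous_toLp 2 _).comp (continuous_pi fun i => ?_)
    exact ((PiLp.continuous_apply 2 _ i).comp (continuous_mulE W)).max continuous_const
  exact h2.const_smul (√2)

theorem maskedMap_self {p q : ℕ} (W : Matrix (Fin p) (Fin q) ℝ) (x : EuclideanSpace ℝ (Fin q)) :
    layerMap W x = maskedMap W x x := by
  ext i
  rw [maskedMap_apply]
  simp only [layerMap, relu, PiLp.smul_apply, smul_eq_mul]
  split_ifs with h
  · rw [max_eq_left h.le]
  · rw [max_eq_right (not_lt.mp h), mul_zero]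

theorem abs_inner_mulE_le {k : ℕ} (M : Matrix (Fin k) (Fin k) ℝ)
    (u v : EuclideanSpace ℝ (Fin k)) :
    |inner ℝ u (mulE M v)| ≤ specNorm M * ‖u‖ * ‖v‖ := by
  have h : mulE M v = Matrix.toEuclideanCLM (𝕜 := ℝ) (n := Fin k) M v := rfl
  calc |inner ℝ u (mulE M v)| ≤ ‖u‖ * ‖mulE M v‖ := abs_real_inner_le_norm _ _
    _ ≤ ‖u‖ * (specNorm M * ‖v‖) := by
      rw [h]; gcongr; exact ContinuousLinearMap.le_opNorm _ _
    _ = _ := by ring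

/-- The matrix in the Weight Distribution Condition is half the Gram form of the masked maps. -/
theorem inner_maskedMap {p q : ℕ} (W : Matrix (Fin p) (Fin q) ℝ)
    (x y u v : EuclideanSpace ℝ (Fin q)) :
    inner ℝ (maskedMap W x u) (maskedMap W y v) =
      2 * inner ℝ u (mulE (∑ i : Fin p, if 0 < mulE W x i ∧ 0 < mulE W y i then
        Matrix.vecMulVec (W i) (W i) else 0) v) := by
  have h1 : ∀ i, mulE (if 0 < mulE W x i ∧ 0 < mulE W y i then
        Matrix.vecMulVec (W i) (W i) else 0) v =
      if 0 < mulE W x i ∧ 0 < mulE W y i then (mulE W v i) • WithLp.toLp 2 (W i) else 0 := by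
    intro i
    split_ifs
    · rw [mulE_apply]
      have := mulE_outer (WithLp.toLp 2 (W i)) v
      simp only [outer] at this
      rw [this]
      congr 1
      simp [PiLp.inner_apply, mul_comm]
    · simp [mulE]
  have h2 : mulE (∑ i : Fin p, if 0 < mulE W x i ∧ 0 < mulE W y i then
        Matrix.vecMulVec (W i) (W i) else 0) v =
      ∑ i : Fin p, mulE (if 0 < mulE W x i ∧ 0 < mulE W y i then
        Matrix.vecMulVec (W i) (W i) else 0) v := by
    simp only [mulE, map_sum, LinearMap.sum_apply]
  rw [h2, inner_sum, Finset.mul_sum, PiLp.inner_apply]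
  refine Finset.sum_congr rfl fun i _ => ?_
  rw [h1, maskedMap_apply, maskedMap_apply]
  have h3 : inner ℝ u (WithLp.toLp 2 (W i)) = mulE W u i := by
    rw [mulE_apply]; simp [PiLp.inner_apply]
  have h4 : √2 * √2 = 2 := Real.mul_self_sqrt (by norm_num)
  by_cases ha : 0 < mulE W x i <;> by_cases hb : 0 < mulE W y i <;>
    simp [ha, hb, inner_smul_right, h3]
  linear_combination mulE W v i * mulE W u i * h4

theorem norm_unitVec {k : ℕ} {x : EuclideanSpace ℝ (Fin k)} (hx : x ≠ 0) : ‖unitVec x‖ = 1 := by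
  rw [unitVec, norm_smul, norm_inv, norm_norm, inv_mul_cancel₀ (norm_ne_zero_iff.mpr hx)]

theorem mulE_Qmat {k : ℕ} (x y v : EuclideanSpace ℝ (Fin k)) :
    mulE (Qmat x y) v = ((Real.pi - angle x y) / (2 * Real.pi)) • v +
      (Real.sin (angle x y) / (2 * Real.pi)) • mulE (swapMatrix (unitVec x) (unitVec y)) v := by
  simp [mulE, Qmat]

theorem mulE_swapMatrix_unitVec {k : ℕ} {x y : EuclideanSpace ℝ (Fin k)} (hx : x ≠ 0)
    (hy : y ≠ 0) : mulE (swapMatrix (unitVec x) (unitVec y)) y = (‖y‖ / ‖x‖) • x := by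
  have h : y = ‖y‖ • unitVec y := by
    rw [unitVec, smul_smul, mul_inv_cancel₀ (norm_ne_zero_iff.mpr hy), one_smul]
  have h2 := swapMatrix_right (norm_unitVec hx) (norm_unitVec hy)
  have h3 : mulE (swapMatrix (unitVec x) (unitVec y)) (‖y‖ • unitVec y) =
      ‖y‖ • mulE (swapMatrix (unitVec x) (unitVec y)) (unitVec y) := by simp [mulE]
  rw [← h, h2] at h3
  rw [h3, unitVec, smul_smul, div_eq_mul_inv]

theorem abs_inner_rankOne_le {k : ℕ} (s u v : EuclideanSpace ℝ (Fin k)) :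
    |inner ℝ u ((inner ℝ s v / ‖s‖ ^ 2) • s)| ≤ ‖u‖ * ‖v‖ := by
  by_cases hs : s = 0
  · simp only [hs, smul_zero, inner_zero_right, abs_zero]; positivity
  have hs' : 0 < ‖s‖ := norm_pos_iff.mpr hs
  rw [inner_smul_right, abs_mul, abs_div, abs_of_pos (by positivity : 0 < ‖s‖ ^ 2),
    div_mul_eq_mul_div, div_le_iff₀ (by positivity)]
  calc |inner ℝ s v| * |inner ℝ u s| ≤ (‖s‖ * ‖v‖) * (‖u‖ * ‖s‖) := by
        gcongr <;> exact abs_real_inner_le_norm _ _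
    _ = _ := by ring

theorem abs_inner_swapMatrix_le {k : ℕ} (a b u v : EuclideanSpace ℝ (Fin k)) :
    |inner ℝ u (mulE (swapMatrix a b) v)| ≤ 2 * (‖u‖ * ‖v‖) := by
  rw [mulE_swapMatrix, inner_sub_right]
  have h1 := abs_inner_rankOne_le (a + b) u v
  have h2 := abs_inner_rankOne_le (a - b) u v
  exact (abs_sub _ _).trans (by linarith)

theorem WDC.abs_inner_maskedMap_sub_le {p q : ℕ} {W : Matrix (Fin p) (Fin q) ℝ} {ε : ℝ}
    (hW : WDC W ε) {x y : EuclideanSpace ℝ (Fin q)} (hx : x ≠ 0) (hy : y ≠ 0)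
    (u v : EuclideanSpace ℝ (Fin q)) :
    |inner ℝ (maskedMap W x u) (maskedMap W y v) - 2 * inner ℝ u (mulE (Qmat x y) v)| ≤
      2 * ε * ‖u‖ * ‖v‖ := by
  rw [inner_maskedMap, ← mul_sub, ← inner_sub_right, ← mulE_sub, abs_mul, abs_two]
  have h1 := abs_inner_mulE_le ((∑ i : Fin p, if 0 < mulE W x i ∧ 0 < mulE W y i then
        Matrix.vecMulVec (W i) (W i) else 0) - Qmat x y) u v
  have h2 := hW x y hx hy
  have h3 := mul_le_mul_of_nonneg_right h2 (by positivity : 0 ≤ ‖u‖ * ‖v‖)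
  nlinarith

/-- The sign of `a + s * b` is eventually constant as `s ↓ 0`; `P` records whether it is positive,
and it is compatible with the sign of `a`. -/
theorem eventually_sign (a b : ℝ) :
    ∃ P : Prop, (∀ᶠ s : ℝ in 𝓝[>] 0, (0 < a + s * b ↔ P)) ∧ (P → 0 ≤ a) ∧ (¬ P → a ≤ 0) := by
  have hc : Tendsto (fun s : ℝ => a + s * b) (𝓝[>] 0) (𝓝 a) := by
    have : Tendsto (fun s : ℝ => a + s * b) (𝓝 0) (𝓝 (a + 0 * b)) :=
      (continuous_const.add (continuous_id.mul continuous_const)).tendsto 0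
    simp only [zero_mul, add_zero] at this
    exact this.mono_left nhdsWithin_le_nhds
  rcases lt_trichotomy a 0 with h | h | h
  · refine ⟨False, ?_, by simp, fun _ => h.le⟩
    filter_upwards [hc.eventually_lt_const h] with s hs
    simp [hs.le]
  · refine ⟨0 < b, ?_, by simp [h], by simp [h]⟩
    filter_upwards [self_mem_nhdsWithin] with s hs
    rw [h, zero_add]
    exact mul_pos_iff_of_pos_left hs
  · refine ⟨True, ?_, fun _ => h.le, by simp⟩
    filter_upwards [hc.eventually_const_lt h] with s hs
    simp [hs]

theorem maskedMap_eventually_eq {p q : ℕ} (W : Matrix (Fin p) (Fin q) ℝ)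
    (x δ : EuclideanSpace ℝ (Fin q)) :
    ∃ T : EuclideanSpace ℝ (Fin q) →ₗ[ℝ] EuclideanSpace ℝ (Fin p),
      T x = layerMap W x ∧ ∀ᶠ s : ℝ in 𝓝[>] 0, maskedMap W (x + s • δ) = T := by
  choose P h1 h2 h3 using fun i => eventually_sign (mulE W x i) (mulE W δ i)
  have hev : ∀ᶠ s : ℝ in 𝓝[>] 0, ∀ i, (0 < mulE W (x + s • δ) i ↔ P i) := by
    rw [eventually_all]
    intro i
    filter_upwards [h1 i] with s hs
    simpa [mulE] using hs
  obtain ⟨s₀, hs₀⟩ := hev.exists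
  refine ⟨maskedMap W (x + s₀ • δ), ?_, ?_⟩
  · ext i
    rw [maskedMap_apply]
    simp only [layerMap, relu, PiLp.smul_apply, smul_eq_mul]
    split_ifs with h
    · rw [max_eq_left (h2 i ((hs₀ i).mp h))]
    · rw [max_eq_right (h3 i (fun hp => h ((hs₀ i).mpr hp))), mul_zero]
  · filter_upwards [hev] with s hs
    ext u i
    rw [maskedMap_apply, maskedMap_apply]
    exact if_congr ((hs i).trans (hs₀ i).symm) rfl rfl

theorem maskedMap_mismatch {p q : ℕ} (W : Matrix (Fin p) (Fin q) ℝ)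
    (x y : EuclideanSpace ℝ (Fin q)) :
    ‖(maskedMap W x - maskedMap W y) y‖ ≤ ‖(maskedMap W x - maskedMap W y) (x - y)‖ := by
  rw [EuclideanSpace.norm_eq, EuclideanSpace.norm_eq]
  refine Real.sqrt_le_sqrt (Finset.sum_le_sum fun i _ => ?_)
  simp only [LinearMap.sub_apply, PiLp.sub_apply, maskedMap_apply, Real.norm_eq_abs, sq_abs]
  have hsub : mulE W (x - y) i = mulE W x i - mulE W y i := by simp [mulE]
  rw [hsub]
  have h4 : √2 * √2 = 2 := Real.mul_self_sqrt (by norm_num)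
  set a := mulE W x i
  set b := mulE W y i
  split_ifs with h1 h2 h2
  · simp
  · have := mul_nonneg h1.le (sub_nonneg.mpr (not_lt.mp h2))
    nlinarith [sq_nonneg a, mul_nonneg h1.le (sub_nonneg.mpr (not_lt.mp h2))]
  · nlinarith [sq_nonneg a, mul_nonneg h2.le (sub_nonneg.mpr (not_lt.mp h1))]
  · simp

theorem WDC.isReluLayer {p q : ℕ} {W : Matrix (Fin p) (Fin q) ℝ} {ε : ℝ} (hW : WDC W ε) :
    IsReluLayer (layerMap W) (maskedMap W) (2 * ε) where
  continuous := continuous_layerMap W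
  apply_eq x := maskedMap_self W x
  inner_self_right x y u hx hy := by
    have h := hW.abs_inner_maskedMap_sub_le hx hy u y
    rw [mulE_Qmat, mulE_swapMatrix_unitVec hx hy, inner_add_right, inner_smul_right,
      inner_smul_right, inner_smul_right] at h
    convert h using 3
    field_simp
  inner_near x y u v hx hy := by
    have h := hW.abs_inner_maskedMap_sub_le hx hy u v
    rw [mulE_Qmat, inner_add_right, inner_smul_right, inner_smul_right] at h
    have h2 := abs_inner_swapMatrix_le (unitVec x) (unitVec y) u v
    have h3 := abs_real_inner_le_norm u v
    set X := inner ℝ (maskedMap W x u) (maskedMap W y v)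
    set I := inner ℝ u v
    set S := inner ℝ u (mulE (swapMatrix (unitVec x) (unitVec y)) v)
    have hθ := angle_nonneg x y
    set θ := angle x y
    have hs0 : 0 ≤ Real.sin θ := Real.sin_nonneg_of_nonneg_of_le_pi hθ (angle_le_pi x y)
    have hs1 : Real.sin θ ≤ θ := Real.sin_le hθ
    have hpi := Real.pi_gt_three
    have e : X - I = (X - 2 * ((Real.pi - θ) / (2 * Real.pi) * I + Real.sin θ / (2 * Real.pi) * S))
        + (-(θ / Real.pi) * I + Real.sin θ / Real.pi * S) := by
      field_simp; ring
    have h5 : |-(θ / Real.pi) * I| ≤ θ / Real.pi * (‖u‖ * ‖v‖) := by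
      rw [abs_mul, abs_neg, abs_of_nonneg (by positivity)]; gcongr
    have h6 : |Real.sin θ / Real.pi * S| ≤ θ / Real.pi * (2 * (‖u‖ * ‖v‖)) := by
      rw [abs_mul, abs_of_nonneg (by positivity)]; gcongr
    have h7 : θ / Real.pi * 3 ≤ θ := by
      rw [div_mul_eq_mul_div, div_le_iff₀ (by positivity)]; nlinarith
    have h8 := mul_le_mul_of_nonneg_right h7 (by positivity : 0 ≤ ‖u‖ * ‖v‖)
    rw [e]
    refine (abs_add_le _ _).trans ?_
    have := abs_add_le (-(θ / Real.pi) * I) (Real.sin θ / Real.pi * S)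
    nlinarith
  eventually_eq p δ := maskedMap_eventually_eq W p δ
  mismatch p q := maskedMap_mismatch W p q

/-! ### The angle kernel and first-order estimates for one layer -/

/-- The function `Φ` that sends the angle between two inputs of a layer to the cosine of the angle
between its outputs, in the limit of a perfect weight distribution. -/
def angleKernel (t : ℝ) : ℝ := ((Real.pi - t) * Real.cos t + Real.sin t) / Real.pi

/-- The derivative of the difference is `2 sin (s/2) · 2 cos (s/2) · (s/2 - sin (s/2)) ≥ 0`. -/
theorem sin_sub_mul_cos_ge {t : ℝ} (h0 : 0 ≤ t) (hpi : t ≤ Real.pi) :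
    8 / 3 * Real.sin (t / 2) ^ 3 ≤ Real.sin t - t * Real.cos t := by
  have hd : ∀ s : ℝ, HasDerivAt
      (fun s => Real.sin s - s * Real.cos s - 8 / 3 * Real.sin (s / 2) ^ 3)
      (s * Real.sin s - 4 * Real.sin (s / 2) ^ 2 * Real.cos (s / 2)) s := by
    intro s
    have h1 := (Real.hasDerivAt_sin s).sub ((hasDerivAt_id s).mul (Real.hasDerivAt_cos s))
    have h2 := ((((Real.hasDerivAt_sin (s / 2)).comp s
      ((hasDerivAt_id s).div_const 2)).pow 3).const_mul (8 / 3 : ℝ))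
    refine (h1.sub h2).congr_deriv ?_
    simp
    ring
  have hmono : MonotoneOn (fun s => Real.sin s - s * Real.cos s - 8 / 3 * Real.sin (s / 2) ^ 3)
      (Set.Icc 0 Real.pi) := by
    refine monotoneOn_of_deriv_nonneg (convex_Icc _ _)
      (fun s _ => (hd s).continuousAt.continuousWithinAt)
      (fun s _ => (hd s).differentiableAt.differentiableWithinAt) fun s hs => ?_
    rw [interior_Icc] at hs
    rw [(hd s).deriv]
    have h1 : Real.sin s = 2 * Real.sin (s / 2) * Real.cos (s / 2) := by
      rw [← Real.sin_two_mul]; congr 1; ring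
    have h2 : Real.sin (s / 2) ≤ s / 2 := Real.sin_le (by linarith [hs.1])
    have h3 : 0 ≤ Real.sin (s / 2) :=
      Real.sin_nonneg_of_nonneg_of_le_pi (by linarith [hs.1]) (by linarith [hs.2, Real.pi_pos])
    have h4 : 0 ≤ Real.cos (s / 2) :=
      Real.cos_nonneg_of_neg_pi_div_two_le_of_le (by linarith [hs.1, Real.pi_pos])
        (by linarith [hs.2])
    rw [h1]
    have := mul_nonneg (mul_nonneg h3 h4) (sub_nonneg.mpr h2)
    nlinarith
  have := hmono (Set.left_mem_Icc.mpr Real.pi_pos.le) ⟨h0, hpi⟩ h0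
  simp at this
  linarith

theorem cos_le_angleKernel {t : ℝ} (h0 : 0 ≤ t) (hpi : t ≤ Real.pi) :
    Real.cos t ≤ angleKernel t := by
  have h := sin_sub_mul_cos_ge h0 hpi
  have h3 : 0 ≤ Real.sin (t / 2) :=
      Real.sin_nonneg_of_nonneg_of_le_pi (by linarith) (by linarith [Real.pi_pos])
  rw [angleKernel, le_div_iff₀ Real.pi_pos]
  have : 0 ≤ Real.sin (t / 2) ^ 3 := by positivity
  nlinarith

theorem cos_eq_one_sub_sin_half (t : ℝ) : Real.cos t = 1 - 2 * Real.sin (t / 2) ^ 2 := by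
  have := Real.cos_two_mul (t / 2)
  rw [show 2 * (t / 2) = t by ring] at this
  linarith [Real.sin_sq_add_cos_sq (t / 2)]

/-- The effect of a layer on `sin (t / 2)`: the left side is `sin (t' / 2) ^ 2` for the angle `t'`
with `cos t' = angleKernel t`. -/
theorem one_sub_angleKernel_le {t : ℝ} (h0 : 0 ≤ t) (hpi : t ≤ Real.pi) :
    (1 - angleKernel t) / 2 ≤ Real.sin (t / 2) ^ 2 - 4 / (3 * Real.pi) * Real.sin (t / 2) ^ 3 := by
  have h := sin_sub_mul_cos_ge h0 hpi
  have hp := Real.pi_pos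
  have e : (1 - angleKernel t) / 2 =
      (1 - Real.cos t) / 2 - (Real.sin t - t * Real.cos t) / (2 * Real.pi) := by
    rw [angleKernel]; field_simp; ring
  rw [e, cos_eq_one_sub_sin_half t, ← cos_eq_one_sub_sin_half t]
  have h2 : 4 / (3 * Real.pi) * Real.sin (t / 2) ^ 3 ≤
      (Real.sin t - t * Real.cos t) / (2 * Real.pi) := by
    rw [le_div_iff₀ (by positivity)]
    have : 4 / (3 * Real.pi) * Real.sin (t / 2) ^ 3 * (2 * Real.pi) =
        8 / 3 * Real.sin (t / 2) ^ 3 := by field_simp; ring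
    linarith
  have := cos_eq_one_sub_sin_half t
  linarith

/-- As a function of `cos t` the kernel is convex with derivative `1 - t / π`; this is the tangent
bound at `a`. -/
theorem angleKernel_sub_ge {a b : ℝ} (hb : 0 ≤ b) (hab : b ≤ a) (ha : a ≤ Real.pi) :
    (1 - a / Real.pi) * (Real.cos b - Real.cos a) ≤ angleKernel b - angleKernel a := by
  have hanti : AntitoneOn (fun s => Real.sin s - s * Real.cos b) (Set.Icc b Real.pi) := by
    have hd : ∀ s : ℝ, HasDerivAt (fun s => Real.sin s - s * Real.cos b)
        (Real.cos s - Real.cos b) s := by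
      intro s
      have h := (Real.hasDerivAt_sin s).sub ((hasDerivAt_id s).mul_const (Real.cos b))
      exact h.congr_deriv (by simp)
    refine antitoneOn_of_deriv_nonpos (convex_Icc _ _)
      (fun s _ => (hd s).continuousAt.continuousWithinAt)
      (fun s _ => (hd s).differentiableAt.differentiableWithinAt) fun s hs => ?_
    rw [interior_Icc] at hs
    rw [(hd s).deriv, sub_nonpos]
    exact Real.cos_le_cos_of_nonneg_of_le_pi hb hs.2.le hs.1.le
  have h := hanti ⟨le_rfl, hab.trans ha⟩ ⟨hab, ha⟩ hab
  simp only at h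
  have hp := Real.pi_pos
  have e : angleKernel b - angleKernel a - (1 - a / Real.pi) * (Real.cos b - Real.cos a) =
      ((Real.sin b - b * Real.cos b) - (Real.sin a - a * Real.cos b)) / Real.pi := by
    rw [angleKernel, angleKernel]; field_simp; ring
  have : 0 ≤ ((Real.sin b - b * Real.cos b) - (Real.sin a - a * Real.cos b)) / Real.pi :=
    div_nonneg (by linarith) hp.le
  linarith

theorem angleKernel_sub_pi_sub (t : ℝ) :
    angleKernel t - angleKernel (Real.pi - t) = Real.cos t := by
  have hp := Real.pi_ne_zero
  rw [angleKernel, angleKernel, Real.cos_pi_sub, Real.sin_pi_sub]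
  field_simp
  ring

theorem inv_pi_le_angleKernel {t : ℝ} (h0 : 0 ≤ t) (h1 : t ≤ Real.pi / 2) :
    1 / Real.pi ≤ angleKernel t := by
  rw [angleKernel]
  gcongr
  have hc : 0 ≤ Real.cos t := Real.cos_nonneg_of_neg_pi_div_two_le_of_le (by linarith) h1
  have hs : 0 ≤ Real.sin t := Real.sin_nonneg_of_nonneg_of_le_pi h0 (by linarith [Real.pi_pos])
  have h3 := Real.pi_gt_three
  have : 1 ≤ Real.cos t + Real.sin t := by nlinarith [Real.sin_sq_add_cos_sq t]
  nlinarith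

theorem angle_le_pi_mul_norm_sub_div {E : Type*} [NormedAddCommGroup E] [InnerProductSpace ℝ E]
    {x y : E} (hx : x ≠ 0) (hy : y ≠ 0) : angle x y ≤ Real.pi * (‖x - y‖ / ‖y‖) := by
  have hθ := angle_nonneg x y
  have hθ' := angle_le_pi x y
  have hp := Real.pi_pos
  have hy' : 0 < ‖y‖ := norm_pos_iff.mpr hy
  have hx' : 0 < ‖x‖ := norm_pos_iff.mpr hx
  have h1 : angle x y / Real.pi ≤ Real.sin (angle x y / 2) := by
    have := Real.mul_le_sin (x := angle x y / 2) (by linarith) (by linarith)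
    calc angle x y / Real.pi = 2 / Real.pi * (angle x y / 2) := by field_simp
      _ ≤ _ := this
  have h2 : Real.sin (angle x y / 2) ≤ ‖x - y‖ / ‖y‖ := by
    have hs : 0 ≤ Real.sin (angle x y / 2) :=
      Real.sin_nonneg_of_nonneg_of_le_pi (by linarith) (by linarith)
    rw [le_div_iff₀ hy']
    have hi := (cos_angle_mul_norm_mul_norm x y).symm
    rw [cos_eq_one_sub_sin_half] at hi
    set τ := Real.sin (angle x y / 2)
    have hτ : τ ≤ 1 := Real.sin_le_one _
    have hn := norm_sub_sq_real x y
    rw [hi] at hn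
    refine (abs_le_of_sq_le_sq' ?_ (norm_nonneg _)).2
    have hτ2 : τ ^ 2 ≤ 1 := pow_le_one₀ hs hτ
    rcases le_total (τ ^ 2) (1 / 2) with hc | hc
    · have e : ‖x - y‖ ^ 2 - (τ * ‖y‖) ^ 2 = (‖x‖ - ‖y‖ * (1 - 2 * τ ^ 2)) ^ 2 +
          ‖y‖ ^ 2 * τ ^ 2 * (3 - 4 * τ ^ 2) := by
        rw [hn]; ring
      have : 0 ≤ ‖y‖ ^ 2 * τ ^ 2 * (3 - 4 * τ ^ 2) :=
        mul_nonneg (by positivity) (by linarith)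
      nlinarith [sq_nonneg (‖x‖ - ‖y‖ * (1 - 2 * τ ^ 2))]
    · have h5 : 0 ≤ ‖x‖ * ‖y‖ * (2 * τ ^ 2 - 1) := mul_nonneg (by positivity) (by linarith)
      have h6 : 0 ≤ ‖y‖ ^ 2 * (1 - τ ^ 2) := mul_nonneg (by positivity) (by linarith)
      nlinarith [sq_nonneg ‖x‖]
  have := h1.trans h2
  rw [div_le_iff₀ hp] at this
  linarith

namespace IsReluLayer

variable {E F : Type*} [NormedAddCommGroup E] [InnerProductSpace ℝ E]
    [NormedAddCommGroup F] [InnerProductSpace ℝ F] {L : E → F} {D : E → E →ₗ[ℝ] F} {η : ℝ}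

theorem abs_norm_sq_sub_le (h : IsReluLayer L D η) {x : E} (hx : x ≠ 0) (u : E) :
    |‖D x u‖ ^ 2 - ‖u‖ ^ 2| ≤ η * ‖u‖ ^ 2 := by
  have := h.inner_near x x u u hx hx
  rw [angle_self hx, real_inner_self_eq_norm_sq, real_inner_self_eq_norm_sq] at this
  linarith

theorem apply_zero (h : IsReluLayer L D η) : L 0 = 0 := by rw [h.apply_eq, map_zero]

theorem abs_norm_sq_apply_sub_le (h : IsReluLayer L D η) (x : E) :
    |‖L x‖ ^ 2 - ‖x‖ ^ 2| ≤ η * ‖x‖ ^ 2 := by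
  by_cases hx : x = 0
  · simp [hx, h.apply_zero]
  · rw [h.apply_eq]; exact h.abs_norm_sq_sub_le hx x

theorem eventually_apply_add (h : IsReluLayer L D η) (p δ : E) :
    ∃ T : E →ₗ[ℝ] F, T p = L p ∧ (∀ᶠ s : ℝ in 𝓝[>] 0, D (p + s • δ) = T) ∧
      ∀ᶠ s : ℝ in 𝓝[>] 0, L (p + s • δ) = L p + s • T δ := by
  obtain ⟨T, hT, hev⟩ := h.eventually_eq p δ
  refine ⟨T, hT, hev, ?_⟩
  filter_upwards [hev] with s hs
  rw [h.apply_eq, hs, map_add, map_smul, hT]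

/-- A layer is Lipschitz, by the mean value inequality: every one-sided derivative along the
segment is given by a masked map, whose norm is at most `√(1 + η)`. -/
theorem norm_apply_sub_le (h : IsReluLayer L D η) (hη : 0 ≤ η) (x y : E) :
    ‖L x - L y‖ ≤ √(1 + η) * ‖x - y‖ := by
  by_cases hxy : x = y
  · simp [hxy]
  have hδ : x - y ≠ 0 := sub_ne_zero.mpr hxy
  have hcont : Continuous (fun s : ℝ => L (y + s • (x - y))) :=
    h.continuous.comp (by fun_prop)
  choose T hT hev haff using fun s : ℝ => h.eventually_apply_add (y + s • (x - y)) (x - y)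
  have hderiv : ∀ s : ℝ, HasDerivWithinAt (fun s : ℝ => L (y + s • (x - y))) (T s (x - y))
      (Set.Ici s) s := by
    intro s
    rw [← hasDerivWithinAt_Ioi_iff_Ici]
    have h1 : HasDerivWithinAt (fun r : ℝ => L (y + s • (x - y)) + (r - s) • T s (x - y))
        (T s (x - y)) (Set.Ioi s) s := by
      have := (((hasDerivAt_id s).sub_const s).smul_const (T s (x - y))).const_add
        (L (y + s • (x - y)))
      simpa using this.hasDerivWithinAt
    refine h1.congr_of_eventuallyEq ?_ (by simp)
    have hm : Tendsto (fun r : ℝ => r - s) (𝓝[>] s) (𝓝[>] 0) := by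
      refine tendsto_nhdsWithin_iff.mpr ⟨?_, ?_⟩
      · have : Tendsto (fun r : ℝ => r - s) (𝓝 s) (𝓝 (s - s)) :=
          (continuous_id.sub continuous_const).tendsto s
        rw [sub_self] at this
        exact this.mono_left nhdsWithin_le_nhds
      · filter_upwards [self_mem_nhdsWithin] with r hr
        exact sub_pos.mpr (Set.mem_Ioi.mp hr)
    filter_upwards [hm.eventually (haff s)] with r hr
    rw [← hr]
    congr 1
    module
  have hbound : ∀ s : ℝ, ‖T s (x - y)‖ ≤ √(1 + η) * ‖x - y‖ := by
    intro s
    have hne : ∀ᶠ r : ℝ in 𝓝[>] 0, y + s • (x - y) + r • (x - y) ≠ 0 := by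
      by_cases h0 : y + s • (x - y) = 0
      · filter_upwards [self_mem_nhdsWithin] with r hr
        rw [h0, zero_add]
        exact smul_ne_zero (ne_of_gt hr) hδ
      · have hc : ContinuousAt (fun r : ℝ => y + s • (x - y) + r • (x - y)) 0 := by fun_prop
        have := hc.eventually_ne (y := 0) (by simpa using h0)
        exact this.filter_mono nhdsWithin_le_nhds
    obtain ⟨r, hr, hr'⟩ := (hne.and (hev s)).exists
    have := (abs_le.mp (h.abs_norm_sq_sub_le hr (x - y))).2
    rw [hr'] at this
    rw [← Real.sqrt_sq (norm_nonneg (x - y)), ← Real.sqrt_mul (by linarith)]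
    refine Real.le_sqrt_of_sq_le ?_
    linarith
  have := norm_image_sub_le_of_norm_deriv_right_le_segment (a := 0) (b := 1)
    (C := √(1 + η) * ‖x - y‖) hcont.continuousOn (fun s _ => hderiv s) (fun s _ => hbound s) 1
    (Set.right_mem_Icc.mpr zero_le_one)
  simpa using this

theorem abs_inner_apply_sub_le (h : IsReluLayer L D η) {x y : E} (hx : x ≠ 0) (hy : y ≠ 0) :
    |inner ℝ (L x) (L y) - ‖x‖ * ‖y‖ * angleKernel (angle x y)| ≤ η * ‖x‖ * ‖y‖ := by
  have h1 := h.inner_self_right x y x hx hy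
  rw [← h.apply_eq, ← h.apply_eq] at h1
  convert h1 using 3
  have hx' : ‖x‖ ≠ 0 := norm_ne_zero_iff.mpr hx
  rw [real_inner_self_eq_norm_sq, ← cos_angle_mul_norm_mul_norm, angleKernel]
  field_simp

theorem abs_norm_mul_norm_sub_le (h : IsReluLayer L D η) (hη : 0 ≤ η) (hη1 : η ≤ 1) (x y : E) :
    |‖L x‖ * ‖L y‖ - ‖x‖ * ‖y‖| ≤ η * (‖x‖ * ‖y‖) := by
  have hx := abs_le.mp (h.abs_norm_sq_apply_sub_le x)
  have hy := abs_le.mp (h.abs_norm_sq_apply_sub_le y)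
  have e : (‖L x‖ * ‖L y‖) ^ 2 = ‖L x‖ ^ 2 * ‖L y‖ ^ 2 := by ring
  have hup : (‖L x‖ * ‖L y‖) ^ 2 ≤ ((1 + η) * (‖x‖ * ‖y‖)) ^ 2 := by
    calc (‖L x‖ * ‖L y‖) ^ 2 = ‖L x‖ ^ 2 * ‖L y‖ ^ 2 := e
      _ ≤ ((1 + η) * ‖x‖ ^ 2) * ((1 + η) * ‖y‖ ^ 2) := by
        gcongr <;> linarith
      _ = _ := by ring
  have hlo : ((1 - η) * (‖x‖ * ‖y‖)) ^ 2 ≤ (‖L x‖ * ‖L y‖) ^ 2 := by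
    have h1 : 0 ≤ 1 - η := by linarith
    calc ((1 - η) * (‖x‖ * ‖y‖)) ^ 2 = ((1 - η) * ‖x‖ ^ 2) * ((1 - η) * ‖y‖ ^ 2) := by ring
      _ ≤ ‖L x‖ ^ 2 * ‖L y‖ ^ 2 := by gcongr <;> linarith
      _ = _ := e.symm
  have h1 := (abs_le_of_sq_le_sq' hup (by positivity)).2
  have h2 := (abs_le_of_sq_le_sq' hlo (by positivity)).2
  rw [abs_le]
  constructor <;> linarith

/-- One layer transforms cosines of angles by `angleKernel`, up to `2 * η`. -/
theorem abs_cos_angle_apply_sub_le (h : IsReluLayer L D η) (hη : 0 ≤ η) (hη1 : η ≤ 1) {x y : E}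
    (hx : x ≠ 0) (hy : y ≠ 0) :
    |Real.cos (angle (L x) (L y)) - angleKernel (angle x y)| ≤ 2 * η := by
  have h1 := abs_le.mp (h.abs_inner_apply_sub_le hx hy)
  have h2 := abs_le.mp (h.abs_norm_mul_norm_sub_le hη hη1 x y)
  rw [← cos_angle_mul_norm_mul_norm] at h1
  have hc1 := Real.cos_le_one (angle (L x) (L y))
  have hc2 := Real.neg_one_le_cos (angle (L x) (L y))
  set c := Real.cos (angle (L x) (L y))
  set k := angleKernel (angle x y)
  have hN : 0 < ‖x‖ * ‖y‖ := mul_pos (norm_pos_iff.mpr hx) (norm_pos_iff.mpr hy)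
  set N := ‖x‖ * ‖y‖
  set M := ‖L x‖ * ‖L y‖
  have h3 : |(M - N) * c| ≤ η * N := by
    rw [abs_mul]
    calc |M - N| * |c| ≤ (η * N) * 1 := by
          gcongr
          · exact abs_le.mpr h2
          · exact abs_le.mpr ⟨hc2, hc1⟩
      _ = _ := mul_one _
  have h3' := abs_le.mp h3
  rw [abs_le]
  constructor
  · by_contra hcon
    push Not at hcon
    nlinarith
  · by_contra hcon
    push Not at hcon
    nlinarith

/-- The one-sided tangent map of a layer at `p` in direction `δ`. All estimates are limits of the
ones at `p + s • δ` as `s ↓ 0`. The last one compares the tangent with the layer itself at `q`,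
with an error proportional to `‖p - q‖` rather than `‖q‖`. -/
theorem exists_tangent (h : IsReluLayer L D η) (hη : 0 ≤ η) {p q : E} (hp : p ≠ 0) (hq : q ≠ 0)
    (δ : E) :
    ∃ T : E →ₗ[ℝ] F, T p = L p ∧ (∀ᶠ s : ℝ in 𝓝[>] 0, L (p + s • δ) = L p + s • T δ) ∧
      (∀ u v, |inner ℝ (T u) (T v) - inner ℝ u v| ≤ η * ‖u‖ * ‖v‖) ∧
      (∀ u, |inner ℝ (T u) (L q) - ((1 - angle p q / Real.pi) * inner ℝ u q +
        Real.sin (angle p q) / Real.pi * (‖q‖ / ‖p‖) * inner ℝ u p)| ≤ η * ‖u‖ * ‖q‖) ∧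
      ‖T q - L q‖ ≤ √(4 * η + 2 * angle p q) * ‖p - q‖ := by
  obtain ⟨T, hT, hev, haff⟩ := h.eventually_apply_add p δ
  have hc : ContinuousAt (fun s : ℝ => p + s • δ) 0 := by fun_prop
  have htend : Tendsto (fun s : ℝ => p + s • δ) (𝓝[>] 0) (𝓝 p) := by
    have : Tendsto (fun s : ℝ => p + s • δ) (𝓝 0) (𝓝 (p + (0 : ℝ) • δ)) := hc
    rw [zero_smul, add_zero] at this
    exact this.mono_left nhdsWithin_le_nhds
  have hne : ∀ᶠ s : ℝ in 𝓝[>] 0, p + s • δ ≠ 0 := htend.eventually_ne hp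
  have hang : Tendsto (fun s : ℝ => angle (p + s • δ) q) (𝓝[>] 0) (𝓝 (angle p q)) := by
    have h1 : ContinuousAt (fun s : ℝ => angle (p + s • δ) q) 0 := by
      unfold angle
      fun_prop (disch := simp [hp, hq])
    have h2 : Tendsto (fun s : ℝ => angle (p + s • δ) q) (𝓝 0) _ := h1
    simp only [zero_smul, add_zero] at h2
    exact h2.mono_left nhdsWithin_le_nhds
  have hnorm : Tendsto (fun s : ℝ => ‖p + s • δ‖) (𝓝[>] 0) (𝓝 ‖p‖) := htend.norm
  have hp' : ‖p‖ ≠ 0 := norm_ne_zero_iff.mpr hp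
  have hself : ∀ u v, |inner ℝ (T u) (T v) - inner ℝ u v| ≤ η * ‖u‖ * ‖v‖ := by
    intro u v
    obtain ⟨s, hs, hs'⟩ := (hev.and hne).exists
    have := h.inner_near _ _ u v hs' hs'
    rwa [hs, angle_self hs', add_zero] at this
  refine ⟨T, hT, haff, hself, ?_, ?_⟩
  · intro u
    have hlim : Tendsto (fun s : ℝ => |inner ℝ (T u) (L q) -
        ((1 - angle (p + s • δ) q / Real.pi) * inner ℝ u q +
        Real.sin (angle (p + s • δ) q) / Real.pi * (‖q‖ / ‖p + s • δ‖) * inner ℝ u (p + s • δ))|)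
        (𝓝[>] 0) (𝓝 |inner ℝ (T u) (L q) - ((1 - angle p q / Real.pi) * inner ℝ u q +
        Real.sin (angle p q) / Real.pi * (‖q‖ / ‖p‖) * inner ℝ u p)|) := by
      refine (tendsto_const_nhds.sub (Tendsto.add ?_ ?_)).abs
      · exact (tendsto_const_nhds.sub (hang.div_const _)).mul tendsto_const_nhds
      · refine Tendsto.mul (Tendsto.mul ?_ ?_) (tendsto_const_nhds.inner htend)
        · exact (((Real.continuous_sin.tendsto _).comp hang).div_const _)
        · exact tendsto_const_nhds.div hnorm hp'
    refine le_of_tendsto hlim ?_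
    filter_upwards [hev, hne] with s hs hs'
    have := h.inner_self_right _ _ u hs' hq
    rwa [hs, ← h.apply_eq] at this
  · have hnear : ∀ u v, |inner ℝ (T u) (D q v) - inner ℝ u v| ≤ (η + angle p q) * ‖u‖ * ‖v‖ := by
      intro u v
      have hlim : Tendsto (fun s : ℝ => (η + angle (p + s • δ) q) * ‖u‖ * ‖v‖)
          (𝓝[>] 0) (𝓝 ((η + angle p q) * ‖u‖ * ‖v‖)) :=
        ((tendsto_const_nhds.add hang).mul_const _).mul_const _
      refine ge_of_tendsto hlim ?_
      filter_upwards [hev, hne] with s hs hs'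
      have := h.inner_near _ _ u v hs' hq
      rwa [hs] at this
    -- the displacement `s • δ` changes the mismatch only by `s • (T - D q) δ`
    have hmis : ‖(T - D q) q‖ ≤ ‖(T - D q) (p - q)‖ := by
      have hlim : Tendsto (fun s : ℝ => ‖(T - D q) (p - q) + s • (T - D q) δ‖) (𝓝[>] 0)
          (𝓝 ‖(T - D q) (p - q)‖) := by
        have hc : ContinuousAt (fun s : ℝ => ‖(T - D q) (p - q) + s • (T - D q) δ‖) 0 := by
          fun_prop
        have : Tendsto (fun s : ℝ => ‖(T - D q) (p - q) + s • (T - D q) δ‖) (𝓝 0) _ := hc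
        simp only [zero_smul, add_zero] at this
        exact this.mono_left nhdsWithin_le_nhds
      refine ge_of_tendsto hlim ?_
      filter_upwards [hev] with s hs
      have := h.mismatch (p + s • δ) q
      rw [hs] at this
      refine this.trans (le_of_eq ?_)
      rw [← map_smul, ← map_add]
      congr 2
      module
    have hsq : ‖(T - D q) (p - q)‖ ^ 2 ≤ (4 * η + 2 * angle p q) * ‖p - q‖ ^ 2 := by
      have h1 := (abs_le.mp (hself (p - q) (p - q))).2
      have h2 := (abs_le.mp (hnear (p - q) (p - q))).1
      have h3 := (abs_le.mp (h.abs_norm_sq_sub_le hq (p - q))).2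
      rw [LinearMap.sub_apply, norm_sub_sq_real]
      rw [real_inner_self_eq_norm_sq] at h1 h2
      rw [real_inner_self_eq_norm_sq] at h1
      nlinarith
    have e : T q - L q = (T - D q) q := by rw [LinearMap.sub_apply, ← h.apply_eq]
    rw [e]
    refine hmis.trans ?_
    have hang0 := angle_nonneg p q
    rw [← Real.sqrt_sq (norm_nonneg (p - q)), ← Real.sqrt_mul (by positivity)]
    exact Real.le_sqrt_of_sq_le hsq

end IsReluLayer

/-! ### Propagation of norms, distances and tangents through the network -/

/-- The first `i` layers of the network, multiplied by `√2 ^ i`: the composition of the maps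
`layerMap (W j)`, `j < i` (see `scaledNet_succ`). -/
def scaledNet (n : ℕ → ℕ) (W : (i : ℕ) → Matrix (Fin (n (i + 1))) (Fin (n i)) ℝ) (i : ℕ)
    (x : EuclideanSpace ℝ (Fin (n 0))) : EuclideanSpace ℝ (Fin (n i)) :=
  √2 ^ i • net n W i x

theorem relu_smul {p : ℕ} {c : ℝ} (hc : 0 ≤ c) (x : EuclideanSpace ℝ (Fin p)) :
    relu (c • x) = c • relu x := by
  ext i
  simp only [relu, PiLp.smul_apply, smul_eq_mul]
  rw [mul_max_of_nonneg _ _ hc, mul_zero]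

theorem mulE_smul {p q : ℕ} (W : Matrix (Fin p) (Fin q) ℝ) (c : ℝ)
    (x : EuclideanSpace ℝ (Fin q)) : mulE W (c • x) = c • mulE W x := by
  simp [mulE]

theorem layerMap_smul {p q : ℕ} (W : Matrix (Fin p) (Fin q) ℝ) {c : ℝ} (hc : 0 ≤ c)
    (x : EuclideanSpace ℝ (Fin q)) : layerMap W (c • x) = c • layerMap W x := by
  rw [layerMap, layerMap, mulE_smul, relu_smul hc, smul_comm]

section Net

variable {n : ℕ → ℕ} {W : (i : ℕ) → Matrix (Fin (n (i + 1))) (Fin (n i)) ℝ}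

theorem scaledNet_zero (x : EuclideanSpace ℝ (Fin (n 0))) : scaledNet n W 0 x = x := by
  simp [scaledNet, net]

theorem scaledNet_succ (i : ℕ) (x : EuclideanSpace ℝ (Fin (n 0))) :
    scaledNet n W (i + 1) x = layerMap (W i) (scaledNet n W i x) := by
  rw [scaledNet, scaledNet, layerMap_smul _ (by positivity), layerMap, net, pow_succ, smul_smul]

theorem scaledNet_smul (i : ℕ) {c : ℝ} (hc : 0 ≤ c) (x : EuclideanSpace ℝ (Fin (n 0))) :
    scaledNet n W i (c • x) = c • scaledNet n W i x := by
  induction i with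
  | zero => simp only [scaledNet_zero]
  | succ i ih => rw [scaledNet_succ, scaledNet_succ, ih, layerMap_smul _ hc]

theorem continuous_scaledNet (i : ℕ) : Continuous (scaledNet n W i) := by
  induction i with
  | zero => exact continuous_id.congr fun x => (scaledNet_zero x).symm
  | succ i ih =>
    exact ((continuous_layerMap (W i)).comp ih).congr fun x => (scaledNet_succ i x).symm

/-- The angle between the `i`-th layer outputs at `w` and at `z`. -/
def layerAngle (n : ℕ → ℕ) (W : (i : ℕ) → Matrix (Fin (n (i + 1))) (Fin (n i)) ℝ)
    (z w : EuclideanSpace ℝ (Fin (n 0))) (i : ℕ) : ℝ :=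
  angle (scaledNet n W i w) (scaledNet n W i z)

/-- The product of `1 - θⱼ / π` over the first `i` layers: the coefficient of `⟨u, z⟩` in the
pairing of the tangent in direction `u` with the image of `z`. -/
def angleProd (n : ℕ → ℕ) (W : (i : ℕ) → Matrix (Fin (n (i + 1))) (Fin (n i)) ℝ)
    (z w : EuclideanSpace ℝ (Fin (n 0))) (i : ℕ) : ℝ :=
  ∏ j ∈ Finset.range i, (1 - layerAngle n W z w j / Real.pi)

/-- The coefficient of `⟨u, w⟩` in the pairing of the tangent at `w` in direction `u` with the
image of `z`, after `i` layers. -/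
def radialCoeff (n : ℕ → ℕ) (W : (i : ℕ) → Matrix (Fin (n (i + 1))) (Fin (n i)) ℝ)
    (z w : EuclideanSpace ℝ (Fin (n 0))) : ℕ → ℝ
  | 0 => 0
  | i + 1 => (1 - layerAngle n W z w i / Real.pi) * radialCoeff n W z w i +
      Real.sin (layerAngle n W z w i) / Real.pi * (‖scaledNet n W i z‖ / ‖scaledNet n W i w‖)

theorem layerAngle_nonneg (z w : EuclideanSpace ℝ (Fin (n 0))) (i : ℕ) :
    0 ≤ layerAngle n W z w i := angle_nonneg _ _

theorem layerAngle_le_pi (z w : EuclideanSpace ℝ (Fin (n 0))) (i : ℕ) :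
    layerAngle n W z w i ≤ Real.pi := angle_le_pi _ _

theorem one_sub_div_pi_mem {t : ℝ} (h0 : 0 ≤ t) (h1 : t ≤ Real.pi) :
    0 ≤ 1 - t / Real.pi ∧ 1 - t / Real.pi ≤ 1 := by
  have := div_le_one_of_le₀ h1 Real.pi_pos.le
  have := div_nonneg h0 Real.pi_pos.le
  constructor <;> linarith

/-- The standing hypothesis on the weights: `d ≥ 1`, every layer is a ReLU layer with error `η`,
and `η d⁶` is small. -/
structure WellDistributed (n : ℕ → ℕ) (W : (i : ℕ) → Matrix (Fin (n (i + 1))) (Fin (n i)) ℝ)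
    (d : ℕ) (η : ℝ) : Prop where
  one_le : 1 ≤ d
  nonneg : 0 ≤ η
  small : η * (d : ℝ) ^ 6 ≤ 1 / 10 ^ 6
  layer : ∀ i < d, IsReluLayer (layerMap (W i)) (maskedMap (W i)) η

namespace WellDistributed

variable {d : ℕ} {η : ℝ}

theorem one_le_cast (h : WellDistributed n W d η) : (1 : ℝ) ≤ d := by exact_mod_cast h.one_le

theorem mul_pow_le (h : WellDistributed n W d η) {k : ℕ} (hk : k ≤ 6) :
    η * (d : ℝ) ^ k ≤ 1 / 10 ^ 6 :=
  (mul_le_mul_of_nonneg_left (pow_le_pow_right₀ h.one_le_cast hk) h.nonneg).trans h.small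

theorem mul_le (h : WellDistributed n W d η) {i : ℕ} (hi : i ≤ d) : (i : ℝ) * η ≤ 1 / 10 ^ 6 := by
  have h1 := h.mul_pow_le (k := 1) (by norm_num)
  have : (i : ℝ) ≤ d := by exact_mod_cast hi
  have := mul_le_mul_of_nonneg_right this h.nonneg
  linarith

theorem eta_le (h : WellDistributed n W d η) : η ≤ 1 / 10 ^ 6 := by
  simpa using h.mul_pow_le (k := 0) (by norm_num)

theorem norm_sq_bounds (h : WellDistributed n W d η) {i : ℕ} (hi : i ≤ d)
    (x : EuclideanSpace ℝ (Fin (n 0))) :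
    (1 - i * η) * ‖x‖ ^ 2 ≤ ‖scaledNet n W i x‖ ^ 2 ∧
      ‖scaledNet n W i x‖ ^ 2 ≤ (1 + 2 * i * η) * ‖x‖ ^ 2 := by
  induction i with
  | zero => simp [scaledNet_zero]
  | succ i ih =>
    obtain ⟨h1, h2⟩ := ih (by omega)
    have h3 := abs_le.mp ((h.layer i (by omega)).abs_norm_sq_apply_sub_le (scaledNet n W i x))
    rw [scaledNet_succ]
    have hη := h.nonneg
    have hη1 := h.eta_le
    have hi' := h.mul_le (i := i) (by omega)
    have hi0 : 0 ≤ (i : ℝ) * η := by positivity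
    push_cast
    have hx : 0 ≤ ‖x‖ ^ 2 := by positivity
    constructor
    · have : (1 - η) * ((1 - i * η) * ‖x‖ ^ 2) ≤ (1 - η) * ‖scaledNet n W i x‖ ^ 2 :=
        mul_le_mul_of_nonneg_left h1 (by linarith)
      have e : 0 ≤ η * (i * η) * ‖x‖ ^ 2 := by positivity
      nlinarith
    · have : (1 + η) * ‖scaledNet n W i x‖ ^ 2 ≤ (1 + η) * ((1 + 2 * i * η) * ‖x‖ ^ 2) :=
        mul_le_mul_of_nonneg_left h2 (by linarith)
      have e : η * (2 * (i * η)) * ‖x‖ ^ 2 ≤ η * 1 * ‖x‖ ^ 2 := by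
        gcongr; linarith
      nlinarith

theorem norm_bounds (h : WellDistributed n W d η) {i : ℕ} (hi : i ≤ d)
    (x : EuclideanSpace ℝ (Fin (n 0))) :
    (1 - i * η) * ‖x‖ ≤ ‖scaledNet n W i x‖ ∧ ‖scaledNet n W i x‖ ≤ (1 + i * η) * ‖x‖ := by
  obtain ⟨h1, h2⟩ := h.norm_sq_bounds hi x
  have hi0 : 0 ≤ (i : ℝ) * η := mul_nonneg (by positivity) h.nonneg
  have hi1 := h.mul_le hi
  have hx : 0 ≤ ‖x‖ ^ 2 := by positivity
  constructor
  · refine (abs_le_of_sq_le_sq' ?_ (norm_nonneg _)).2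
    refine le_trans ?_ h1
    rw [mul_pow]
    gcongr
    nlinarith
  · refine (abs_le_of_sq_le_sq' ?_ (by positivity)).2
    refine h2.trans ?_
    rw [mul_pow]
    gcongr
    nlinarith

theorem norm_le (h : WellDistributed n W d η) {i : ℕ} (hi : i ≤ d)
    (x : EuclideanSpace ℝ (Fin (n 0))) : ‖scaledNet n W i x‖ ≤ 1.01 * ‖x‖ :=
  (h.norm_bounds hi x).2.trans (by have := h.mul_le hi; gcongr; norm_num at *; linarith)

theorem norm_ge (h : WellDistributed n W d η) {i : ℕ} (hi : i ≤ d)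
    (x : EuclideanSpace ℝ (Fin (n 0))) : 0.99 * ‖x‖ ≤ ‖scaledNet n W i x‖ :=
  le_trans (by have := h.mul_le hi; gcongr; norm_num at *; linarith) (h.norm_bounds hi x).1

theorem scaledNet_ne_zero (h : WellDistributed n W d η) {i : ℕ} (hi : i ≤ d)
    {x : EuclideanSpace ℝ (Fin (n 0))} (hx : x ≠ 0) : scaledNet n W i x ≠ 0 := by
  have h1 := h.norm_ge hi x
  have h2 := norm_pos_iff.mpr hx
  exact norm_pos_iff.mp (by linarith)

theorem norm_sub_le (h : WellDistributed n W d η) {i : ℕ} (hi : i ≤ d)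
    (x z : EuclideanSpace ℝ (Fin (n 0))) :
    ‖scaledNet n W i x - scaledNet n W i z‖ ≤ (1 + i * η) * ‖x - z‖ := by
  induction i with
  | zero => simp [scaledNet_zero]
  | succ i ih =>
    have h1 := ih (by omega)
    have h3 := (h.layer i (by omega)).norm_apply_sub_le h.nonneg (scaledNet n W i x)
      (scaledNet n W i z)
    rw [scaledNet_succ, scaledNet_succ]
    have hη := h.nonneg
    have hi' := h.mul_le (i := i) (by omega)
    have hi0 : 0 ≤ (i : ℝ) * η := by positivity
    have hs : √(1 + η) ≤ 1 + η / 2 := by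
      rw [Real.sqrt_le_left (by positivity)]; nlinarith
    push_cast
    calc _ ≤ √(1 + η) * ‖scaledNet n W i x - scaledNet n W i z‖ := h3
      _ ≤ (1 + η / 2) * ((1 + i * η) * ‖x - z‖) := by gcongr
      _ = ((1 + η / 2) * (1 + i * η)) * ‖x - z‖ := by ring
      _ ≤ _ := by
        gcongr
        have : η / 2 * (i * η) ≤ η / 2 * 1 := by gcongr; linarith
        nlinarith

theorem norm_sub_le' (h : WellDistributed n W d η) {i : ℕ} (hi : i ≤ d)
    (x z : EuclideanSpace ℝ (Fin (n 0))) :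
    ‖scaledNet n W i x - scaledNet n W i z‖ ≤ 1.01 * ‖x - z‖ :=
  (h.norm_sub_le hi x z).trans (by have := h.mul_le hi; gcongr; norm_num at *; linarith)

/-- Angles after `i` layers are controlled by the relative distance of the inputs, because the
network is Lipschitz and nearly preserves norms. -/
theorem angle_scaledNet_le (h : WellDistributed n W d η) {i : ℕ} (hi : i ≤ d)
    {x z : EuclideanSpace ℝ (Fin (n 0))} (hx : x ≠ 0) (hz : z ≠ 0) :
    angle (scaledNet n W i x) (scaledNet n W i z) ≤ 4 * (‖x - z‖ / ‖z‖) := by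
  refine (angle_le_pi_mul_norm_sub_div (h.scaledNet_ne_zero hi hx)
    (h.scaledNet_ne_zero hi hz)).trans ?_
  have hz' := norm_pos_iff.mpr hz
  calc Real.pi * (‖scaledNet n W i x - scaledNet n W i z‖ / ‖scaledNet n W i z‖)
      ≤ 3.15 * ((1.01 * ‖x - z‖) / (0.99 * ‖z‖)) := by
        gcongr
        · exact Real.pi_lt_d2.le
        · exact h.norm_sub_le' hi x z
        · exact h.norm_ge hi z
    _ = (3.15 * 1.01 / 0.99) * (‖x - z‖ / ‖z‖) := by field_simp
    _ ≤ _ := by gcongr; norm_num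

/-- The one-sided tangent `δ` of `scaledNet n W i` at `w` in direction `u`. It pairs with the image
of `w` like `u` with `w`, and with the image of `z` through `angleProd` and `radialCoeff`. The last
estimate, useful when all angles are at most a small `Θ`, has an error proportional to `‖w - z‖`,
so it does not degrade near `z`. -/
theorem exists_tangent (h : WellDistributed n W d η) {z w : EuclideanSpace ℝ (Fin (n 0))}
    (hz : z ≠ 0) (hw : w ≠ 0) (u : EuclideanSpace ℝ (Fin (n 0))) {Θ : ℝ}
    (hΘ : ∀ i < d, layerAngle n W z w i ≤ Θ) {i : ℕ} (hi : i ≤ d) :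
    ∃ δ : EuclideanSpace ℝ (Fin (n i)),
      (∀ᶠ s : ℝ in 𝓝[>] 0, scaledNet n W i (w + s • u) = scaledNet n W i w + s • δ) ∧
      |inner ℝ δ (scaledNet n W i w) - inner ℝ u w| ≤ 2 * i * η * ‖u‖ * ‖w‖ ∧
      |inner ℝ δ (scaledNet n W i z) - (angleProd n W z w i * inner ℝ u z +
        radialCoeff n W z w i * inner ℝ u w)| ≤ 2 * i ^ 2 * η * ‖u‖ * ‖z‖ ∧
      |inner ℝ δ (scaledNet n W i w - scaledNet n W i z) - inner ℝ u (w - z)| ≤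
        2 * i * (η + √(4 * η + 2 * Θ)) * ‖u‖ * ‖w - z‖ := by
  -- a tangent is a difference quotient of a Lipschitz map
  have htan : ∀ {i : ℕ}, i ≤ d → ∀ δ : EuclideanSpace ℝ (Fin (n i)),
      (∀ᶠ s : ℝ in 𝓝[>] 0, scaledNet n W i (w + s • u) = scaledNet n W i w + s • δ) →
      ‖δ‖ ≤ 1.01 * ‖u‖ := by
    intro i hi δ hδ
    obtain ⟨s, hs, hs0⟩ := (hδ.and self_mem_nhdsWithin).exists
    have hs0 : 0 < s := hs0
    have := h.norm_sub_le' hi (w + s • u) w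
    rw [hs, add_sub_cancel_left, add_sub_cancel_left, norm_smul, norm_smul,
      Real.norm_of_nonneg hs0.le] at this
    have : s * ‖δ‖ ≤ s * (1.01 * ‖u‖) := by linarith
    exact le_of_mul_le_mul_left this hs0
  have hη := h.nonneg
  induction i with
  | zero =>
    refine ⟨u, ?_, ?_, ?_, ?_⟩
    · exact Eventually.of_forall fun s => by simp only [scaledNet_zero]
    · simp [scaledNet_zero]
    · simp [scaledNet_zero, angleProd, radialCoeff]
    · simp [scaledNet_zero]
  | succ i ih =>
    obtain ⟨δ, h1, h2, h3, h4⟩ := ih (by omega)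
    have hid : i ≤ d := by omega
    set p := scaledNet n W i w with hp
    set q := scaledNet n W i z with hq
    have hp0 : p ≠ 0 := h.scaledNet_ne_zero hid hw
    have hq0 : q ≠ 0 := h.scaledNet_ne_zero hid hz
    obtain ⟨T, hTp, haff, hself, hright, hmis⟩ :=
      (h.layer i (by omega)).exists_tangent hη hp0 hq0 δ
    have hev : ∀ᶠ s : ℝ in 𝓝[>] 0, scaledNet n W (i + 1) (w + s • u) =
        scaledNet n W (i + 1) w + s • T δ := by
      filter_upwards [h1, haff] with s hs hs'
      rw [scaledNet_succ, scaledNet_succ, hs, hs']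
    have hδ := htan hid δ h1
    have hTδ := htan hi _ hev
    have hpn := h.norm_le hid w
    have hqn := h.norm_le hid z
    have hpn' := h.norm_ge hid w
    have hpq := h.norm_sub_le' hid w z
    rw [← hp, ← hq] at hpq
    rw [← hp] at hpn hpn'
    rw [← hq] at hqn
    have hw' := norm_pos_iff.mpr hw
    have hz' := norm_pos_iff.mpr hz
    refine ⟨T δ, hev, ?_, ?_, ?_⟩
    · rw [scaledNet_succ, ← hp, ← hTp]
      have h5 := hself δ p
      have h6 : η * ‖δ‖ * ‖p‖ ≤ η * (1.01 * ‖u‖) * (1.01 * ‖w‖) := by gcongr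
      have h7 : 0 ≤ η * ‖u‖ * ‖w‖ := by positivity
      have e : inner ℝ (T δ) (T p) - inner ℝ u w =
        (inner ℝ (T δ) (T p) - inner ℝ δ p) + (inner ℝ δ p - inner ℝ u w) := by ring
      rw [e]
      refine (abs_add_le _ _).trans ?_
      push_cast
      nlinarith
    · rw [scaledNet_succ, ← hq]
      have h5 := hright δ
      have h6 : η * ‖δ‖ * ‖q‖ ≤ η * (1.01 * ‖u‖) * (1.01 * ‖z‖) := by gcongr
      have h7 : 0 ≤ η * ‖u‖ * ‖z‖ := by positivity
      have hθ : layerAngle n W z w i = angle p q := rfl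
      have hc := one_sub_div_pi_mem (angle_nonneg p q) (angle_le_pi p q)
      rw [angleProd, Finset.prod_range_succ, ← angleProd, radialCoeff, hθ, ← hp, ← hq]
      set c := 1 - angle p q / Real.pi
      set r := Real.sin (angle p q) / Real.pi * (‖q‖ / ‖p‖)
      have hr0 : 0 ≤ r := by
        have := Real.sin_nonneg_of_nonneg_of_le_pi (angle_nonneg p q) (angle_le_pi p q)
        have := Real.pi_pos
        positivity
      -- the weight `r` of the radial term contains `‖q‖ / ‖p‖`, which turns `‖w‖` into `‖z‖`
      have hr : r * ‖w‖ ≤ ‖z‖ / 2 := by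
        have hr1 : r ≤ 1 / 3 * ((1.01 * ‖z‖) / (0.99 * ‖w‖)) := by
          refine mul_le_mul ?_ (by gcongr) (by positivity) (by norm_num)
          exact div_le_div₀ zero_le_one (Real.sin_le_one _) (by norm_num) Real.pi_gt_three.le
        calc r * ‖w‖ ≤ (1 / 3 * ((1.01 * ‖z‖) / (0.99 * ‖w‖))) * ‖w‖ := by gcongr
          _ = (1 / 3 * 1.01 / 0.99) * ‖z‖ := by field_simp
          _ ≤ (1 / 2) * ‖z‖ := mul_le_mul_of_nonneg_right (by norm_num) hz'.le
          _ = _ := by ring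
      have e : inner ℝ (T δ) (layerMap (W i) q) - (angleProd n W z w i * c * inner ℝ u z +
          (c * radialCoeff n W z w i + r) * inner ℝ u w) =
          (inner ℝ (T δ) (layerMap (W i) q) - (c * inner ℝ δ q + r * inner ℝ δ p)) +
          c * (inner ℝ δ q - (angleProd n W z w i * inner ℝ u z +
            radialCoeff n W z w i * inner ℝ u w)) + r * (inner ℝ δ p - inner ℝ u w) := by ring
      rw [e]
      refine (abs_add_le _ _).trans ?_
      have h8 : |r * (inner ℝ δ p - inner ℝ u w)| ≤ i * (η * ‖u‖ * ‖z‖) := by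
        rw [abs_mul, abs_of_nonneg hr0]
        calc _ ≤ r * (2 * i * η * ‖u‖ * ‖w‖) := by gcongr
          _ = (2 * i * η * ‖u‖) * (r * ‖w‖) := by ring
          _ ≤ (2 * i * η * ‖u‖) * (‖z‖ / 2) := by gcongr
          _ = _ := by ring
      have h9 : |c * (inner ℝ δ q - (angleProd n W z w i * inner ℝ u z +
            radialCoeff n W z w i * inner ℝ u w))| ≤ 1 * (2 * i ^ 2 * η * ‖u‖ * ‖z‖) := by
        rw [abs_mul, abs_of_nonneg hc.1]
        gcongr
        exact hc.2
      have h10 := abs_add_le (inner ℝ (T δ) (layerMap (W i) q) -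
        (c * inner ℝ δ q + r * inner ℝ δ p))
        (c * (inner ℝ δ q - (angleProd n W z w i * inner ℝ u z +
            radialCoeff n W z w i * inner ℝ u w)))
      have hi0 : 0 ≤ (i : ℝ) * (η * ‖u‖ * ‖z‖) := by positivity
      push_cast
      nlinarith
    · rw [scaledNet_succ, scaledNet_succ, ← hp, ← hq]
      have h5 := hself δ (p - q)
      set ρ := √(4 * η + 2 * Θ) with hρ
      have h6 : η * ‖δ‖ * ‖p - q‖ ≤ η * (1.01 * ‖u‖) * (1.01 * ‖w - z‖) := by gcongr
      have hmis' : ‖T q - layerMap (W i) q‖ ≤ ρ * (1.01 * ‖w - z‖) := by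
        refine hmis.trans ?_
        have : angle p q ≤ Θ := hΘ i (by omega)
        rw [hρ]
        gcongr
      have h7 : |inner ℝ (T δ) (T q - layerMap (W i) q)| ≤ (1.01 * ‖u‖) * (ρ * (1.01 * ‖w - z‖)) :=
        (abs_real_inner_le_norm _ _).trans (by gcongr)
      have e : inner ℝ (T δ) (layerMap (W i) p - layerMap (W i) q) - inner ℝ u (w - z) =
          (inner ℝ (T δ) (T (p - q)) - inner ℝ δ (p - q)) +
          inner ℝ (T δ) (T q - layerMap (W i) q) + (inner ℝ δ (p - q) - inner ℝ u (w - z)) := by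
        simp only [map_sub, hTp, inner_sub_right]; ring
      rw [e]
      refine (abs_add_le _ _).trans ?_
      have h8 := abs_add_le (inner ℝ (T δ) (T (p - q)) - inner ℝ δ (p - q))
        (inner ℝ (T δ) (T q - layerMap (W i) q))
      have hη' : 0 ≤ η * (‖u‖ * ‖w - z‖) := by positivity
      have hρ' : 0 ≤ ρ * (‖u‖ * ‖w - z‖) := by positivity
      push_cast
      nlinarith

end WellDistributed

end Net

/-! ### Decay of the layer angles -/

section Net

variable {n : ℕ → ℕ} {W : (i : ℕ) → Matrix (Fin (n (i + 1))) (Fin (n i)) ℝ}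

namespace WellDistributed

variable {d : ℕ} {η : ℝ} {z x : EuclideanSpace ℝ (Fin (n 0))}

/-- The recursion for the layer angles. -/
theorem abs_cos_layerAngle_succ_sub_le (h : WellDistributed n W d η) (hz : z ≠ 0) (hx : x ≠ 0)
    {i : ℕ} (hi : i < d) :
    |Real.cos (layerAngle n W z x (i + 1)) - angleKernel (layerAngle n W z x i)| ≤ 2 * η := by
  have := (h.layer i hi).abs_cos_angle_apply_sub_le h.nonneg (by linarith [h.eta_le])
    (h.scaledNet_ne_zero hi.le hx) (h.scaledNet_ne_zero hi.le hz)
  rwa [← scaledNet_succ, ← scaledNet_succ] at this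

theorem cos_layerAngle_sub_le_succ (h : WellDistributed n W d η) (hz : z ≠ 0) (hx : x ≠ 0)
    {i : ℕ} (hi : i < d) :
    Real.cos (layerAngle n W z x i) - 2 * η ≤ Real.cos (layerAngle n W z x (i + 1)) := by
  have h1 := (abs_le.mp (h.abs_cos_layerAngle_succ_sub_le hz hx hi)).1
  have h2 := cos_le_angleKernel (layerAngle_nonneg (n := n) (W := W) z x i)
    (layerAngle_le_pi z x i)
  linarith

theorem cos_layerAngle_ge (h : WellDistributed n W d η) (hz : z ≠ 0) (hx : x ≠ 0)
    {i j : ℕ} (hij : i + j ≤ d) :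
    Real.cos (layerAngle n W z x i) - 2 * j * η ≤ Real.cos (layerAngle n W z x (i + j)) := by
  induction j with
  | zero => simp
  | succ j ih =>
    have h1 := ih (by omega)
    have h2 := h.cos_layerAngle_sub_le_succ hz hx (i := i + j) (by omega)
    rw [← add_assoc]
    push_cast
    linarith

/-- Whatever the initial angle, the layer angles decay like `1 / i`. -/
theorem sin_half_layerAngle_le (h : WellDistributed n W d η) (hz : z ≠ 0) (hx : x ≠ 0)
    {i : ℕ} (hi : i ≤ d) : Real.sin (layerAngle n W z x i / 2) ≤ 5 / ((i : ℝ) + 5) := by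
  induction i with
  | zero => simpa using Real.sin_le_one _
  | succ i ih =>
    have h1 := ih (by omega)
    have h2 := (abs_le.mp (h.abs_cos_layerAngle_succ_sub_le hz hx (i := i) (by omega))).1
    have h3 := one_sub_angleKernel_le (layerAngle_nonneg (n := n) (W := W) z x i)
      (layerAngle_le_pi z x i)
    rw [cos_eq_one_sub_sin_half] at h2
    have hτ0 : 0 ≤ Real.sin (layerAngle n W z x i / 2) :=
      Real.sin_nonneg_of_nonneg_of_le_pi
        (by linarith [layerAngle_nonneg (n := n) (W := W) z x i])
        (by linarith [layerAngle_le_pi (n := n) (W := W) z x i, Real.pi_pos])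
    set τ := Real.sin (layerAngle n W z x i / 2)
    set τ' := Real.sin (layerAngle n W z x (i + 1) / 2)
    set m : ℝ := (i : ℝ) + 5 with hm
    have hm5 : 5 ≤ m := by rw [hm]; linarith [(Nat.cast_nonneg i : (0 : ℝ) ≤ i)]
    have hη := h.nonneg
    set k := 4 / (3 * Real.pi) with hk
    have hk1 : k ≤ 1 / 2 := by
      rw [hk, div_le_iff₀ (by positivity)]; linarith [Real.pi_gt_three]
    have hk2 : 0.423 ≤ k := by
      rw [hk, le_div_iff₀ (by positivity)]; linarith [Real.pi_lt_d2]
    -- the layer error is negligible against the gain `125 * k / m ^ 3`, as `m` is at most `6 * d`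
    have hηm : η * m ^ 3 ≤ 0.5 := by
      have hd1 := h.one_le_cast
      have hid : (i : ℝ) + 1 ≤ d := by exact_mod_cast hi
      have : m ≤ 6 * d := by rw [hm]; linarith
      calc η * m ^ 3 ≤ η * (6 * d) ^ 3 := by gcongr
        _ = 216 * (η * (d : ℝ) ^ 3) := by ring
        _ ≤ 216 * (1 / 10 ^ 6) := by gcongr; exact h.mul_pow_le (by norm_num)
        _ ≤ 0.5 := by norm_num
    have ha1 : 5 / m ≤ 1 := by rw [div_le_one (by linarith)]; exact hm5
    set a := 5 / m with ha
    -- the map `t ↦ t² - k t³` is monotone on `[0, 1]`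
    have hmono : τ ^ 2 - k * τ ^ 3 ≤ a ^ 2 - k * a ^ 3 := by
      have e : a ^ 2 - k * a ^ 3 - (τ ^ 2 - k * τ ^ 3) =
        (a - τ) * ((a + τ) - k * (a ^ 2 + a * τ + τ ^ 2)) := by ring
      have ha0 : 0 ≤ a := hτ0.trans h1
      have h5 : a ^ 2 + a * τ + τ ^ 2 ≤ 2 * (a + τ) := by nlinarith
      have h6 : k * (a ^ 2 + a * τ + τ ^ 2) ≤ 1 / 2 * (2 * (a + τ)) := by gcongr
      have := mul_nonneg (sub_nonneg.mpr h1) (by linarith :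
        0 ≤ (a + τ) - k * (a ^ 2 + a * τ + τ ^ 2))
      linarith
    -- `5 / m` is a supersolution of the recursion: `125 * k - 0.5` exceeds the `50` that
    -- passing from `m` to `m + 1` requires
    have hstep : a ^ 2 - k * a ^ 3 + η ≤ (5 / (m + 1)) ^ 2 := by
      have e1 : a ^ 2 - k * a ^ 3 + η = (25 * m - 125 * k + η * m ^ 3) / m ^ 3 := by
        rw [ha]; field_simp; ring
      rw [e1, div_pow, div_le_div_iff₀ (by positivity) (by positivity)]
      have : 25 * m - 125 * k + η * m ^ 3 ≤ 25 * m - 52 := by linarith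
      calc (25 * m - 125 * k + η * m ^ 3) * (m + 1) ^ 2 ≤ (25 * m - 52) * (m + 1) ^ 2 := by gcongr
        _ ≤ 5 ^ 2 * m ^ 3 := by nlinarith
    have hfin : τ' ^ 2 ≤ (5 / (m + 1)) ^ 2 := by linarith
    have := (abs_le_of_sq_le_sq' hfin (by positivity)).2
    push_cast
    rwa [hm, show (i : ℝ) + 5 + 1 = i + 1 + 5 by ring] at this

theorem le_one_sub_layerAngle (h : WellDistributed n W d η) (hz : z ≠ 0) (hx : x ≠ 0)
    {i : ℕ} (hi : i ≤ d) :
    (i : ℝ) / (i + 5) ≤ 1 - layerAngle n W z x i / Real.pi := by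
  have h1 := h.sin_half_layerAngle_le hz hx hi
  have h2 := Real.mul_le_sin (x := layerAngle n W z x i / 2)
    (by linarith [layerAngle_nonneg (n := n) (W := W) z x i])
    (by linarith [layerAngle_le_pi (n := n) (W := W) z x i])
  have e : 2 / Real.pi * (layerAngle n W z x i / 2) = layerAngle n W z x i / Real.pi := by
    field_simp
  rw [e] at h2
  have e2 : (i : ℝ) / (i + 5) = 1 - 5 / (i + 5) := by field_simp; ring
  rw [e2]
  linarith

/-- The products of `j / (j + 5)` decay no faster than `i ^ (-5)`. -/
theorem inv_pow_succ_le {i : ℕ} (hi : 1 ≤ i) :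
    1 / ((i : ℝ) + 1) ^ 5 ≤ (i : ℝ) / (i + 5) * (1 / (i : ℝ) ^ 5) := by
  have : (0 : ℝ) < i := by exact_mod_cast hi
  have e : (i : ℝ) / (i + 5) * (1 / (i : ℝ) ^ 5) = 1 / ((i : ℝ) ^ 4 * (i + 5)) := by
    field_simp
  rw [e]
  gcongr
  have : 0 ≤ 10 * (i : ℝ) ^ 3 + 10 * (i : ℝ) ^ 2 + 5 * i + 1 := by positivity
  nlinarith

theorem le_angleProd (h : WellDistributed n W d η) (hz : z ≠ 0) (hx : x ≠ 0)
    {i : ℕ} (hi1 : 1 ≤ i) (hi : i ≤ d) :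
    (1 - angle x z / Real.pi) * (1 / (i : ℝ) ^ 5) ≤ angleProd n W z x i := by
  induction i, hi1 using Nat.le_induction with
  | base => simp [angleProd, layerAngle, scaledNet_zero]
  | succ i hi1 ih =>
    have h1 := ih (by omega)
    have h2 := h.le_one_sub_layerAngle hz hx (i := i) (by omega)
    have h3 := (one_sub_div_pi_mem (angle_nonneg x z) (angle_le_pi x z)).1
    rw [angleProd, Finset.prod_range_succ, ← angleProd]
    push_cast
    calc (1 - angle x z / Real.pi) * (1 / ((i : ℝ) + 1) ^ 5)
        ≤ (1 - angle x z / Real.pi) * ((i : ℝ) / (i + 5) * (1 / (i : ℝ) ^ 5)) := by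
          gcongr; exact inv_pow_succ_le hi1
      _ = ((1 - angle x z / Real.pi) * (1 / (i : ℝ) ^ 5)) * ((i : ℝ) / (i + 5)) := by ring
      _ ≤ _ := by
        refine mul_le_mul h1 h2 (by positivity) (le_trans (by positivity) h1)

theorem angleProd_mem (z x : EuclideanSpace ℝ (Fin (n 0))) (i : ℕ) :
    0 ≤ angleProd n W z x i ∧ angleProd n W z x i ≤ 1 := by
  have hj := fun j : ℕ =>
    one_sub_div_pi_mem (layerAngle_nonneg (n := n) (W := W) z x j) (layerAngle_le_pi z x j)
  exact ⟨Finset.prod_nonneg fun j _ => (hj j).1,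
    Finset.prod_le_one (fun j _ => (hj j).1) fun j _ => (hj j).2⟩

/-- If `x` makes an angle of at least `2π/3` with `z`, the gap between the cosines at `-x` and at
`x` is almost `1 / 2` after one layer, and by `angleKernel_sub_ge` each further layer multiplies it
by at least `i / (i + 5)`. -/
theorem cos_layerAngle_neg_sub_ge (h : WellDistributed n W d η) (hz : z ≠ 0) (hx : x ≠ 0)
    (hang : 2 * Real.pi / 3 ≤ angle x z) {i : ℕ} (hi1 : 1 ≤ i) (hi : i ≤ d) :
    1 / (2 * (i : ℝ) ^ 5) - 4 * i * η ≤
      Real.cos (layerAngle n W z (-x) i) - Real.cos (layerAngle n W z x i) := by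
  have hx' : -x ≠ 0 := neg_ne_zero.mpr hx
  have hη := h.nonneg
  induction i, hi1 using Nat.le_induction with
  | base =>
    have h1 := (abs_le.mp (h.abs_cos_layerAngle_succ_sub_le hz hx (i := 0) (by omega))).2
    have h2 := (abs_le.mp (h.abs_cos_layerAngle_succ_sub_le hz hx' (i := 0) (by omega))).1
    have e0 : layerAngle n W z x 0 = angle x z := by simp [layerAngle, scaledNet_zero]
    have e1 : layerAngle n W z (-x) 0 = Real.pi - angle x z := by
      simp [layerAngle, scaledNet_zero, angle_neg_left]
    rw [e0] at h1
    rw [e1] at h2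
    have h3 := angleKernel_sub_pi_sub (angle x z)
    have h4 : Real.cos (angle x z) ≤ -(1 / 2) := by
      have h5 := Real.cos_le_cos_of_nonneg_of_le_pi (by linarith [Real.pi_pos])
        (angle_le_pi x z) hang
      have h6 : Real.cos (2 * Real.pi / 3) = -(1 / 2) := by
        rw [show 2 * Real.pi / 3 = Real.pi - Real.pi / 3 by ring, Real.cos_pi_sub,
          Real.cos_pi_div_three]
      linarith
    simp only [zero_add] at h1 h2
    norm_num
    linarith
  | succ i hi1 ih =>
    have h0 := ih (by omega)
    have h1 := (abs_le.mp (h.abs_cos_layerAngle_succ_sub_le hz hx (i := i) (by omega))).2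
    have h2 := (abs_le.mp (h.abs_cos_layerAngle_succ_sub_le hz hx' (i := i) (by omega))).1
    have hα := layerAngle_le_pi (n := n) (W := W) z x i
    have hα0 := layerAngle_nonneg (n := n) (W := W) z x i
    have hβ0 := layerAngle_nonneg (n := n) (W := W) z (-x) i
    have hβ := layerAngle_le_pi (n := n) (W := W) z (-x) i
    have h3 := h.le_one_sub_layerAngle hz hx (i := i) (by omega)
    have h3' := (one_sub_div_pi_mem hα0 hα).2
    set α := layerAngle n W z x i
    set β := layerAngle n W z (-x) i
    have hi0 : (1 : ℝ) ≤ i := by exact_mod_cast hi1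
    have hpos : 0 ≤ 1 / (2 * (i : ℝ) ^ 5) - 4 * i * η := by
      rw [sub_nonneg, le_div_iff₀ (by positivity)]
      have hid : (i : ℝ) ≤ d := by exact_mod_cast (by omega : i ≤ d)
      calc 4 * i * η * (2 * (i : ℝ) ^ 5) = 8 * (η * (i : ℝ) ^ 6) := by ring
        _ ≤ 8 * (η * (d : ℝ) ^ 6) := by gcongr
        _ ≤ 8 * (1 / 10 ^ 6) := by gcongr; exact h.small
        _ ≤ 1 := by norm_num
    -- the gap is still positive, so `β ≤ α` and `angleKernel_sub_ge` applies
    have hle : β ≤ α := by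
      by_contra hcon
      push Not at hcon
      have := Real.cos_lt_cos_of_nonneg_of_le_pi hα0 hβ hcon
      linarith
    have h4 := angleKernel_sub_ge hβ0 hle hα
    have h5 : (i : ℝ) / (i + 5) * (1 / (2 * (i : ℝ) ^ 5) - 4 * i * η) ≤
        (1 - α / Real.pi) * (Real.cos β - Real.cos α) :=
      mul_le_mul h3 h0 hpos (le_trans (by positivity) h3)
    have h6 := inv_pow_succ_le hi1
    have h7 : (i : ℝ) / (i + 5) * (4 * i * η) ≤ 4 * i * η := by
      have : (i : ℝ) / (i + 5) ≤ 1 := h3.trans h3'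
      exact mul_le_of_le_one_left (by positivity) this
    have e1 : 1 / (2 * (i : ℝ) ^ 5) = 1 / (i : ℝ) ^ 5 / 2 := by field_simp
    have e2 : 1 / (2 * ((i : ℝ) + 1) ^ 5) = 1 / ((i : ℝ) + 1) ^ 5 / 2 := by field_simp
    push_cast
    rw [e2]
    rw [e1] at h5
    nlinarith

theorem cos_gap (h : WellDistributed n W d η) (hz : z ≠ 0) (hx : x ≠ 0)
    (hang : 2 * Real.pi / 3 ≤ angle x z) :
    1 / (4 * (d : ℝ) ^ 5) ≤
      Real.cos (layerAngle n W z (-x) d) - Real.cos (layerAngle n W z x d) := by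
  have h1 := h.cos_layerAngle_neg_sub_ge hz hx hang h.one_le le_rfl
  have hd := h.one_le_cast
  have : 4 * d * η ≤ 1 / (4 * (d : ℝ) ^ 5) := by
    rw [le_div_iff₀ (by positivity)]
    have := h.small
    calc 4 * d * η * (4 * (d : ℝ) ^ 5) = 16 * (η * (d : ℝ) ^ 6) := by ring
      _ ≤ 16 * (1 / 10 ^ 6) := by gcongr
      _ ≤ 1 := by norm_num
  have e : 1 / (2 * (d : ℝ) ^ 5) = 2 * (1 / (4 * (d : ℝ) ^ 5)) := by field_simp; norm_num
  linarith

/-- Images of vectors at an acute angle keep an angle bounded away from `π / 2`: the first layer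
brings the cosine to `1 / π` or more up to a small error, and later layers hardly decrease it. -/
theorem cos_layerAngle_last_ge (h : WellDistributed n W d η) (hz : z ≠ 0) (hx : x ≠ 0)
    (hang : angle x z ≤ Real.pi / 2) : 0.316 ≤ Real.cos (layerAngle n W z x d) := by
  have h1 := (abs_le.mp (h.abs_cos_layerAngle_succ_sub_le hz hx (i := 0) h.one_le)).1
  have e0 : layerAngle n W z x 0 = angle x z := by simp [layerAngle, scaledNet_zero]
  rw [e0] at h1
  have h2 := inv_pi_le_angleKernel (angle_nonneg x z) hang
  have h3 := h.cos_layerAngle_ge hz hx (i := 1) (j := d - 1) (by have := h.one_le; omega)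
  rw [show 1 + (d - 1) = d by have := h.one_le; omega, Nat.cast_sub h.one_le] at h3
  have h4 : 0.317 ≤ 1 / Real.pi := by
    rw [le_div_iff₀ Real.pi_pos]; linarith [Real.pi_lt_d2]
  have h5 := h.mul_le le_rfl
  have h6 := h.eta_le
  simp only [zero_add] at h1
  push_cast at h3
  norm_num at *
  nlinarith

theorem inner_scaledNet (z x : EuclideanSpace ℝ (Fin (n 0))) (i : ℕ) :
    inner ℝ (scaledNet n W i x) (scaledNet n W i z) =
      Real.cos (layerAngle n W z x i) * (‖scaledNet n W i x‖ * ‖scaledNet n W i z‖) :=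
  (cos_angle_mul_norm_mul_norm _ _).symm

end WellDistributed

end Net

/-! ### Clarke subgradients, and the risk at `x` and `-x` -/

/-- The one-sided directional derivative of `f` at `w` in direction `u` exists and is at
most `M`. -/
def RightDerivLE {E : Type*} [NormedAddCommGroup E] [InnerProductSpace ℝ E] (f : E → ℝ) (w u : E)
    (M : ℝ) : Prop :=
  ∃ D, HasDerivWithinAt (fun s : ℝ => f (w + s • u)) D (Set.Ici 0) 0 ∧ D ≤ M

section Clarke

variable {E : Type*} [NormedAddCommGroup E] [InnerProductSpace ℝ E] {f : E → ℝ}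

theorem RightDerivLE.mono {w u : E} {M N : ℝ} (h : RightDerivLE f w u M) (hMN : M ≤ N) :
    RightDerivLE f w u N :=
  let ⟨D, h1, h2⟩ := h
  ⟨D, h1, h2.trans hMN⟩

theorem sub_le_mul_of_rightDerivLE (hf : Continuous f) {z u : E} {t M : ℝ} (ht : 0 ≤ t)
    (h : ∀ s ∈ Set.Ico 0 t, RightDerivLE f (z + s • u) u M) : f (z + t • u) - f z ≤ M * t := by
  have hcont : Continuous (fun s : ℝ => f (z + s • u)) := hf.comp (by fun_prop)
  have hder : ∀ s ∈ Set.Ico 0 t, ∃ D,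
      HasDerivWithinAt (fun s : ℝ => f (z + s • u)) D (Set.Ici s) s ∧
      D ≤ M := by
    intro s hs
    obtain ⟨D, hD, hDM⟩ := h s hs
    refine ⟨D, ?_, hDM⟩
    have h1 : HasDerivWithinAt (fun r : ℝ => r - s) 1 (Set.Ici s) s :=
      ((hasDerivAt_id s).sub_const s).hasDerivWithinAt
    have h2 : HasDerivWithinAt (fun r : ℝ => f (z + s • u + r • u)) D (Set.Ici 0) (s - s) := by
      rwa [sub_self]
    have h3 := HasDerivWithinAt.scomp (h := fun r : ℝ => r - s) s h2 h1
      (fun r hr => Set.mem_Ici.mpr (sub_nonneg.mpr (Set.mem_Ici.mp hr)))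
    rw [one_smul] at h3
    refine h3.congr_of_mem (fun r _ => ?_) Set.self_mem_Ici
    simp only [Function.comp]
    congr 1
    module
  choose! D hD hDM using hder
  have := image_le_of_deriv_right_le_deriv_boundary (f := fun s : ℝ => f (z + s • u)) (f' := D)
    (a := 0) (b := t) (B := fun s => f z + M * s) (B' := fun _ => M) hcont.continuousOn hD
    (by simp) (by fun_prop)
    (fun s _ => by
      have := ((hasDerivAt_id s).const_mul M).const_add (f z)
      simpa using this.hasDerivWithinAt) hDM (Set.right_mem_Icc.mpr ht)
  linarith

/-- If near `x` the one-sided derivatives of `f` at `w` are at most `⟨H w, u⟩ + R w * ‖u‖`, with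
`H` and `R` continuous at `x`, then every Clarke subgradient at `x` is within `R x` of `H x`. -/
theorem norm_sub_le_of_mem_clarkeSubdiff (hf : Continuous f) {H : E → E} {R : E → ℝ} {x v : E}
    (hH : ContinuousAt H x) (hR : ContinuousAt R x) (hR0 : 0 ≤ R x)
    (hder : ∀ᶠ w in 𝓝 x, ∀ u, RightDerivLE f w u (inner ℝ (H w) u + R w * ‖u‖))
    (hv : v ∈ clarkeSubdiff f x) : ‖v - H x‖ ≤ R x := by
  have key : ∀ u, inner ℝ v u ≤ inner ℝ (H x) u + R x * ‖u‖ := by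
    intro u
    refine le_of_forall_pos_lt_add fun r hr => ?_
    have hcont : ContinuousAt (fun w => inner ℝ (H w) u + R w * ‖u‖) x :=
      (hH.inner continuousAt_const).add (hR.mul continuousAt_const)
    have hev : ∀ᶠ w in 𝓝 x, RightDerivLE f w u (inner ℝ (H x) u + R x * ‖u‖ + r / 2) := by
      filter_upwards [hder, hcont.eventually_lt_const (by linarith :
        inner ℝ (H x) u + R x * ‖u‖ < inner ℝ (H x) u + R x * ‖u‖ + r / 2)] with w h1 h2
      exact (h1 u).mono h2.le
    set M := inner ℝ (H x) u + R x * ‖u‖ + r / 2 with hM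
    obtain ⟨ρ, hρ, hball⟩ := Metric.eventually_nhds_iff.mp hev
    have hq : ∀ᶠ q : E × ℝ in 𝓝 x ×ˢ 𝓝[>] 0,
        (((f (q.1 + q.2 • u) - f q.1) / q.2 : ℝ) : EReal) ≤ (M : EReal) := by
      have h1 : ∀ᶠ z in 𝓝 x, dist z x < ρ / 2 := Metric.ball_mem_nhds x (by linarith)
      have h2 : ∀ᶠ t : ℝ in 𝓝[>] 0, 0 < t ∧ t * ‖u‖ < ρ / 2 := by
        have hc : Tendsto (fun t : ℝ => t * ‖u‖) (𝓝 0) (𝓝 (0 * ‖u‖)) :=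
          (continuous_id.mul continuous_const).tendsto 0
        rw [zero_mul] at hc
        filter_upwards [self_mem_nhdsWithin, (hc.mono_left nhdsWithin_le_nhds).eventually_lt_const
          (by linarith : 0 < ρ / 2)] with t ht ht'
        exact ⟨ht, ht'⟩
      filter_upwards [h1.prod_mk h2] with q ⟨hq1, hq2, hq3⟩
      rw [EReal.coe_le_coe_iff, div_le_iff₀ hq2]
      refine sub_le_mul_of_rightDerivLE hf hq2.le fun s hs => hball ?_
      rw [dist_eq_norm] at hq1 ⊢
      calc ‖q.1 + s • u - x‖ = ‖(q.1 - x) + s • u‖ := by congr 1; module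
        _ ≤ ‖q.1 - x‖ + ‖s • u‖ := norm_add_le _ _
        _ ≤ ‖q.1 - x‖ + q.2 * ‖u‖ := by
          rw [norm_smul, Real.norm_of_nonneg hs.1]; gcongr; exact hs.2.le
        _ < ρ := by linarith
    have h1 : ((inner ℝ v u : ℝ) : EReal) ≤ (M : EReal) :=
      (hv u).trans (limsup_le_of_le (by isBoundedDefault) hq)
    have h2 := EReal.coe_le_coe_iff.mp h1
    linarith
  -- the direction `v - H x` is the worst one
  have h1 := key (v - H x)
  have h2 : inner ℝ v (v - H x) - inner ℝ (H x) (v - H x) = ‖v - H x‖ ^ 2 := by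
    rw [← inner_sub_left, real_inner_self_eq_norm_sq]
  by_contra hcon
  push Not at hcon
  have : 0 < ‖v - H x‖ := hR0.trans_lt hcon
  nlinarith

end Clarke

section Risk

variable {n : ℕ → ℕ} {W : (i : ℕ) → Matrix (Fin (n (i + 1))) (Fin (n i)) ℝ} {d m : ℕ} {η : ℝ}
  {A : Matrix (Fin m) (Fin (n d)) ℝ} {e : EuclideanSpace ℝ (Fin m)}
  {z x : EuclideanSpace ℝ (Fin (n 0))}

/-- The risk of the rescaled network with target `z` and noise `e`. For the noise `√2 ^ d • e` it
is `2 ^ d` times the risk of the network itself (`empRisk_net_eq`). -/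
def scaledRisk (n : ℕ → ℕ) (W : (i : ℕ) → Matrix (Fin (n (i + 1))) (Fin (n i)) ℝ) (d : ℕ) {m : ℕ}
    (A : Matrix (Fin m) (Fin (n d)) ℝ) (z : EuclideanSpace ℝ (Fin (n 0)))
    (e : EuclideanSpace ℝ (Fin m)) : EuclideanSpace ℝ (Fin (n 0)) → ℝ :=
  empRisk A (scaledNet n W d) (mulE A (scaledNet n W d z) + e)

theorem scaledRisk_eq (x : EuclideanSpace ℝ (Fin (n 0))) :
    scaledRisk n W d A z e x =
      1 / 2 * ‖mulE A (scaledNet n W d x - scaledNet n W d z) - e‖ ^ 2 := by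
  have e1 : mulE A (scaledNet n W d x - scaledNet n W d z) =
    mulE A (scaledNet n W d x) - mulE A (scaledNet n W d z) := by simp [mulE]
  rw [scaledRisk, empRisk, e1, sub_sub]

theorem continuous_scaledRisk : Continuous (scaledRisk n W d A z e) := by
  have h1 : Continuous (fun x => mulE A (scaledNet n W d x)) :=
    (continuous_mulE A).comp (continuous_scaledNet d)
  unfold scaledRisk empRisk
  fun_prop

theorem RRIC.norm_mulE_le (hA : RRIC A (scaledNet n W d) η) (hη1 : η ≤ 1 / 100)
    (x y : EuclideanSpace ℝ (Fin (n 0))) :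
    ‖mulE A (scaledNet n W d x - scaledNet n W d y)‖ ≤
      1.01 * ‖scaledNet n W d x - scaledNet n W d y‖ := by
  have h1 := (abs_le.mp (hA x y x y)).2
  rw [real_inner_self_eq_norm_sq, real_inner_self_eq_norm_sq] at h1
  refine (abs_le_of_sq_le_sq' ?_ (by positivity)).2
  have := mul_le_mul_of_nonneg_right hη1 (sq_nonneg ‖scaledNet n W d x - scaledNet n W d y‖)
  rw [mul_pow]
  nlinarith

/-- The quadratic terms of the risks at `x` and at `-x` nearly cancel, which leaves the difference
of the inner products with the image of `z`. -/
theorem RRIC.abs_scaledRisk_sub_le (h : WellDistributed n W d η) (hA : RRIC A (scaledNet n W d) η)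
    (x : EuclideanSpace ℝ (Fin (n 0))) :
    |scaledRisk n W d A z e x - scaledRisk n W d A z e (-x) -
      (inner ℝ (scaledNet n W d (-x)) (scaledNet n W d z) -
        inner ℝ (scaledNet n W d x) (scaledNet n W d z))| ≤
      ‖x‖ * (4 * (d * η) * (‖x‖ + ‖z‖) + 2.1 * ‖e‖) := by
  have hn := h.norm_sq_bounds le_rfl x
  have hn' := h.norm_sq_bounds le_rfl (-x)
  rw [norm_neg] at hn'
  have h1 := hA x (-x) x z
  have h2 := hA x (-x) (-x) z
  have hA' := hA.norm_mulE_le (by linarith [h.eta_le]) x (-x)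
  have hl1 := h.norm_sub_le' le_rfl x (-x)
  have hl2 := h.norm_sub_le' le_rfl x z
  have hl3 := h.norm_sub_le' le_rfl (-x) z
  have hxx : ‖x - -x‖ = 2 * ‖x‖ := by
    rw [sub_neg_eq_add, ← two_smul ℝ x, norm_smul]; simp
  have hxz : ‖x - z‖ ≤ ‖x‖ + ‖z‖ := norm_sub_le _ _
  have hxz' : ‖-x - z‖ ≤ ‖x‖ + ‖z‖ := by simpa using norm_sub_le (-x) z
  have hη := h.nonneg
  have hdη : η ≤ d * η := by nlinarith [h.one_le_cast]
  rw [hxx] at hl1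
  rw [scaledRisk_eq, scaledRisk_eq]
  set p := scaledNet n W d x
  set p' := scaledNet n W d (-x)
  set q := scaledNet n W d z
  have e1 : mulE A (p - p') = mulE A (p - q) - mulE A (p' - q) := by
    simp only [mulE, map_sub]; abel
  have e2 : 1 / 2 * ‖mulE A (p - q) - e‖ ^ 2 - 1 / 2 * ‖mulE A (p' - q) - e‖ ^ 2 =
      1 / 2 * (inner ℝ (mulE A (p - p')) (mulE A (p - q)) +
        inner ℝ (mulE A (p - p')) (mulE A (p' - q))) - inner ℝ (mulE A (p - p')) e := by
    rw [e1, norm_sub_sq_real, norm_sub_sq_real, inner_sub_left, inner_sub_left, inner_sub_left,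
      real_inner_self_eq_norm_sq, real_inner_self_eq_norm_sq,
      real_inner_comm (mulE A (p' - q)) (mulE A (p - q))]
    ring
  have e3 : inner ℝ (p - p') (p - q) + inner ℝ (p - p') (p' - q) =
      ‖p‖ ^ 2 - ‖p'‖ ^ 2 - 2 * (inner ℝ p q - inner ℝ p' q) := by
    simp only [inner_sub_left, inner_sub_right, real_inner_self_eq_norm_sq]
    rw [real_inner_comm p p']
    ring
  have h4 : |inner ℝ (mulE A (p - p')) e| ≤ (1.01 * (1.01 * (2 * ‖x‖))) * ‖e‖ :=
    (abs_real_inner_le_norm _ _).trans (by gcongr; exact hA'.trans (by gcongr))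
  have h5 : η * ‖p - p'‖ * ‖p - q‖ ≤ (d * η) * (1.01 * (2 * ‖x‖)) * (1.01 * (‖x‖ + ‖z‖)) := by
    gcongr; exact hl2.trans (by gcongr)
  have h6 : η * ‖p - p'‖ * ‖p' - q‖ ≤ (d * η) * (1.01 * (2 * ‖x‖)) * (1.01 * (‖x‖ + ‖z‖)) := by
    gcongr; exact hl3.trans (by gcongr)
  have h1 := abs_le.mp (h1.trans h5)
  have h2 := abs_le.mp (h2.trans h6)
  have h4 := abs_le.mp h4
  rw [e2]
  have hpos1 : 0 ≤ (d * η) * ‖x‖ * ‖z‖ := by positivity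
  have hpos2 : 0 ≤ (d * η) * ‖x‖ * ‖x‖ := by positivity
  have hpos3 : 0 ≤ ‖x‖ * ‖e‖ := by positivity
  rw [abs_le]
  constructor <;> nlinarith

/-- If `x` points away from `z`, flipping its sign decreases the risk by a definite amount. This is
what keeps the flipped iterates away from the spurious stationary point opposite to `z`. -/
theorem RRIC.scaledRisk_sub_neg_ge (h : WellDistributed n W d η)
    (hA : RRIC A (scaledNet n W d) η) (he : ‖e‖ * (d : ℝ) ^ 6 ≤ 1 / 10 ^ 4 * ‖z‖)
    (hz : z ≠ 0) (hx : x ≠ 0) (hxz : ‖x‖ ≤ 2 * ‖z‖) (hang : 2 * Real.pi / 3 ≤ angle x z) :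
    ‖x‖ * ‖z‖ * (1 / (16 * (d : ℝ) ^ 5)) ≤
      scaledRisk n W d A z e x - scaledRisk n W d A z e (-x) := by
  have h1 := (abs_le.mp (hA.abs_scaledRisk_sub_le (z := z) (e := e) h x)).1
  have h2 := h.cos_gap hz hx hang
  rw [WellDistributed.inner_scaledNet, WellDistributed.inner_scaledNet] at h1
  have hn := h.norm_bounds le_rfl x
  have hn' := h.norm_bounds le_rfl (-x)
  rw [norm_neg] at hn'
  have hq := h.norm_ge le_rfl z
  have hq' := h.norm_le le_rfl z
  have hd := h.one_le_cast
  have hη := h.nonneg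
  set a := Real.cos (layerAngle n W z x d) with ha
  set b := Real.cos (layerAngle n W z (-x) d) with hb
  have ha1 : |a| ≤ 1 := Real.abs_cos_le_one _
  have hb1 : |b| ≤ 1 := Real.abs_cos_le_one _
  set p := ‖scaledNet n W d x‖
  set p' := ‖scaledNet n W d (-x)‖
  set q := ‖scaledNet n W d z‖
  set g := 1 / (4 * (d : ℝ) ^ 5) with hg
  have hg' : 1 / (16 * (d : ℝ) ^ 5) = g / 4 := by rw [hg]; field_simp; norm_num
  have hdη : d * η ≤ 4 / 10 ^ 6 * g := by
    rw [hg, mul_one_div, le_div_iff₀ (by positivity)]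
    have := h.small
    linarith
  have heg : ‖e‖ ≤ 4 / 10 ^ 4 * g * ‖z‖ := by
    rw [hg]
    have : ‖e‖ * (d : ℝ) ^ 5 ≤ 1 / 10 ^ 4 * ‖z‖ :=
      (mul_le_mul_of_nonneg_left (pow_le_pow_right₀ hd (by norm_num)) (norm_nonneg e)).trans he
    calc ‖e‖ = (‖e‖ * (d : ℝ) ^ 5) * (1 / (d : ℝ) ^ 5) := by field_simp
      _ ≤ (1 / 10 ^ 4 * ‖z‖) * (1 / (d : ℝ) ^ 5) := by gcongr
      _ = _ := by ring
  have hx' := norm_pos_iff.mpr hx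
  have hz' := norm_pos_iff.mpr hz
  have hdη0 : 0 ≤ d * η := by positivity
  have hg0 : 0 < g := by positivity
  have h3 : |b * (p' - ‖x‖)| ≤ d * η * ‖x‖ := by
    rw [abs_mul]
    calc |b| * |p' - ‖x‖| ≤ 1 * (d * η * ‖x‖) := by
          gcongr; rw [abs_le]; constructor <;> linarith
      _ = _ := one_mul _
  have h4 : |a * (p - ‖x‖)| ≤ d * η * ‖x‖ := by
    rw [abs_mul]
    calc |a| * |p - ‖x‖| ≤ 1 * (d * η * ‖x‖) := by
          gcongr; rw [abs_le]; constructor <;> linarith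
      _ = _ := one_mul _
  have h3 := (abs_le.mp h3).1
  have h4 := (abs_le.mp h4).2
  have h5 : ‖x‖ * (0.99 * g) ≤ b * p' - a * p := by
    have := mul_le_mul_of_nonneg_left h2 hx'.le
    have := mul_le_mul_of_nonneg_left hdη hx'.le
    have : 0 ≤ ‖x‖ * g := by positivity
    nlinarith
  have h6 : ‖x‖ * (0.99 * g) * (0.99 * ‖z‖) ≤ (b * p' - a * p) * q :=
    mul_le_mul h5 hq (by positivity) (le_trans (by positivity) h5)
  have h7 : ‖x‖ * (4 * (d * η) * (‖x‖ + ‖z‖) + 2.1 * ‖e‖) ≤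
      ‖x‖ * (4 * (4 / 10 ^ 6 * g) * (2 * ‖z‖ + ‖z‖) + 2.1 * (4 / 10 ^ 4 * g * ‖z‖)) := by
    gcongr
  have h8 : 0 ≤ ‖x‖ * ‖z‖ * g := by positivity
  rw [hg']
  nlinarith

/-- If the risk at `x` does not exceed that at `-x`, the images of `x` and `z` are well correlated.
For acute `x` this is automatic. Otherwise `-x` is acute, so its image is well correlated with that
of `z`, and the comparison of the risks transfers this to `x`. -/
theorem RRIC.inner_ge_of_le_neg (h : WellDistributed n W d η)
    (hA : RRIC A (scaledNet n W d) η) (he : ‖e‖ * (d : ℝ) ^ 6 ≤ 1 / 10 ^ 4 * ‖z‖)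
    (hz : z ≠ 0) (hx : x ≠ 0) (hxz : ‖x‖ ≤ 2 * ‖z‖)
    (hflip : scaledRisk n W d A z e x ≤ scaledRisk n W d A z e (-x)) :
    0.3 * ‖x‖ * ‖z‖ ≤ inner ℝ (scaledNet n W d x) (scaledNet n W d z) := by
  have hx' := norm_pos_iff.mpr hx
  have hz' := norm_pos_iff.mpr hz
  have hq := h.norm_ge le_rfl z
  have hacute : ∀ y : EuclideanSpace ℝ (Fin (n 0)), y ≠ 0 → angle y z ≤ Real.pi / 2 →
      0.309 * ‖y‖ * ‖z‖ ≤ inner ℝ (scaledNet n W d y) (scaledNet n W d z) := by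
    intro y hy hang
    rw [WellDistributed.inner_scaledNet]
    have h1 := h.cos_layerAngle_last_ge hz hy hang
    have h2 := h.norm_ge le_rfl y
    calc 0.309 * ‖y‖ * ‖z‖ ≤ 0.316 * ((0.99 * ‖y‖) * (0.99 * ‖z‖)) := by
          have : 0 ≤ ‖y‖ * ‖z‖ := by positivity
          nlinarith
      _ ≤ _ := by gcongr
  have hpos : 0 ≤ ‖x‖ * ‖z‖ := by positivity
  rcases le_total (angle x z) (Real.pi / 2) with hang | hang
  · have := hacute x hx hang
    nlinarith
  · have h1 := hacute (-x) (neg_ne_zero.mpr hx) (by rw [angle_neg_left]; linarith)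
    have h2 := (abs_le.mp (hA.abs_scaledRisk_sub_le (z := z) (e := e) h x)).1
    rw [norm_neg] at h1
    have hdη := h.mul_le le_rfl
    have he' : ‖e‖ ≤ 1 / 10 ^ 4 * ‖z‖ :=
      le_trans (le_mul_of_one_le_right (norm_nonneg _) (one_le_pow₀ h.one_le_cast)) he
    have h3 : ‖x‖ * (4 * (d * η) * (‖x‖ + ‖z‖) + 2.1 * ‖e‖) ≤
        ‖x‖ * (4 * (1 / 10 ^ 6) * (2 * ‖z‖ + ‖z‖) + 2.1 * (1 / 10 ^ 4 * ‖z‖)) := by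
      gcongr
    nlinarith

/-- The tangent of the network together with the resulting one-sided derivative of the risk. The
range restricted isometry applies to `δ` because `s • δ` is a difference of two network outputs. -/
theorem RRIC.exists_hasDerivWithinAt (h : WellDistributed n W d η)
    (hA : RRIC A (scaledNet n W d) η) {w : EuclideanSpace ℝ (Fin (n 0))} (hz : z ≠ 0) (hw : w ≠ 0)
    (u : EuclideanSpace ℝ (Fin (n 0))) {Θ : ℝ} (hΘ : ∀ i < d, layerAngle n W z w i ≤ Θ) :
    ∃ (δ : EuclideanSpace ℝ (Fin (n d))) (D : ℝ),
      (∀ᶠ s : ℝ in 𝓝[>] 0, scaledNet n W d (w + s • u) = scaledNet n W d w + s • δ) ∧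
      |inner ℝ δ (scaledNet n W d w) - inner ℝ u w| ≤ 2 * d * η * ‖u‖ * ‖w‖ ∧
      |inner ℝ δ (scaledNet n W d z) - (angleProd n W z w d * inner ℝ u z +
        radialCoeff n W z w d * inner ℝ u w)| ≤ 2 * d ^ 2 * η * ‖u‖ * ‖z‖ ∧
      |inner ℝ δ (scaledNet n W d w - scaledNet n W d z) - inner ℝ u (w - z)| ≤
        2 * d * (η + √(4 * η + 2 * Θ)) * ‖u‖ * ‖w - z‖ ∧
      HasDerivWithinAt (fun s : ℝ => scaledRisk n W d A z e (w + s • u)) D (Set.Ici 0) 0 ∧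
      |D - inner ℝ δ (scaledNet n W d w - scaledNet n W d z)| ≤
        (1.1 * η * ‖w - z‖ + 1.1 * ‖e‖) * ‖u‖ := by
  obtain ⟨δ, h1, h2, h3, h4⟩ := h.exists_tangent hz hw u hΘ le_rfl
  refine ⟨δ, inner ℝ (mulE A δ) (mulE A (scaledNet n W d w - scaledNet n W d z) - e), h1, h2, h3,
    h4, ?_, ?_⟩
  · set a := mulE A (scaledNet n W d w - scaledNet n W d z) - e with ha
    have hd : HasDerivWithinAt (fun s : ℝ => 1 / 2 * ‖a + s • mulE A δ‖ ^ 2)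
        (inner ℝ (mulE A δ) a) (Set.Ici 0) 0 := by
      have e1 : (fun s : ℝ => 1 / 2 * ‖a + s • mulE A δ‖ ^ 2) =
          fun s : ℝ => 1 / 2 * ‖a‖ ^ 2 + s * inner ℝ (mulE A δ) a +
            s ^ 2 * (1 / 2 * ‖mulE A δ‖ ^ 2) := by
        funext s
        rw [norm_add_sq_real, norm_smul, mul_pow, inner_smul_right, Real.norm_eq_abs, sq_abs,
          real_inner_comm]
        ring
      rw [e1]
      have h5 := (((hasDerivAt_id (0 : ℝ)).mul_const (inner ℝ (mulE A δ) a)).const_add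
        (1 / 2 * ‖a‖ ^ 2)).add
        (((hasDerivAt_id (0 : ℝ)).pow 2).mul_const (1 / 2 * ‖mulE A δ‖ ^ 2))
      refine (h5.congr_deriv ?_).hasDerivWithinAt
      simp
    rw [← hasDerivWithinAt_Ioi_iff_Ici] at hd ⊢
    refine hd.congr_of_eventuallyEq ?_ ?_
    · filter_upwards [h1] with s hs
      rw [scaledRisk_eq, hs]
      congr 3
      rw [ha]
      simp only [mulE, map_sub, map_add, map_smul]
      abel
    · simp only [zero_smul, add_zero, scaledRisk_eq, ha]
  · obtain ⟨s, hs, hs0⟩ := (h1.and self_mem_nhdsWithin).exists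
    have hs0 : 0 < s := hs0
    have hη := h.nonneg
    have e1 : scaledNet n W d (w + s • u) - scaledNet n W d w = s • δ := by
      rw [hs, add_sub_cancel_left]
    have h5 := hA (w + s • u) w w z
    have h6 := hA.norm_mulE_le (by linarith [h.eta_le]) (w + s • u) w
    have h7 := h.norm_sub_le' le_rfl (w + s • u) w
    have h8 := h.norm_sub_le' le_rfl w z
    rw [e1] at h5 h6 h7
    rw [mulE_smul] at h5 h6
    rw [norm_smul, Real.norm_of_nonneg hs0.le] at h5 h6 h7
    rw [add_sub_cancel_left, norm_smul, Real.norm_of_nonneg hs0.le] at h7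
    rw [norm_smul, Real.norm_of_nonneg hs0.le] at h6
    rw [real_inner_smul_left, real_inner_smul_left, ← mul_sub, abs_mul, abs_of_pos hs0] at h5
    have h5 : |inner ℝ (mulE A δ) (mulE A (scaledNet n W d w - scaledNet n W d z)) -
        inner ℝ δ (scaledNet n W d w - scaledNet n W d z)| ≤
        η * ‖δ‖ * ‖scaledNet n W d w - scaledNet n W d z‖ :=
      le_of_mul_le_mul_left (by linarith) hs0
    have h6 : ‖mulE A δ‖ ≤ 1.01 * ‖δ‖ := le_of_mul_le_mul_left (by linarith) hs0
    have h7 : ‖δ‖ ≤ 1.01 * ‖u‖ := le_of_mul_le_mul_left (by linarith) hs0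
    have h9 : |inner ℝ (mulE A δ) e| ≤ (1.01 * (1.01 * ‖u‖)) * ‖e‖ :=
      (abs_real_inner_le_norm _ _).trans (by gcongr; exact h6.trans (by gcongr))
    have h10 : η * ‖δ‖ * ‖scaledNet n W d w - scaledNet n W d z‖ ≤
        η * (1.01 * ‖u‖) * (1.01 * ‖w - z‖) := by gcongr
    rw [inner_sub_right]
    have h11 := abs_sub (inner ℝ (mulE A δ) (mulE A (scaledNet n W d w - scaledNet n W d z)) -
        inner ℝ δ (scaledNet n W d w - scaledNet n W d z)) (inner ℝ (mulE A δ) e)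
    have e2 : inner ℝ (mulE A δ) (mulE A (scaledNet n W d w - scaledNet n W d z)) -
        inner ℝ (mulE A δ) e - inner ℝ δ (scaledNet n W d w - scaledNet n W d z) =
        inner ℝ (mulE A δ) (mulE A (scaledNet n W d w - scaledNet n W d z)) -
        inner ℝ δ (scaledNet n W d w - scaledNet n W d z) - inner ℝ (mulE A δ) e := by ring
    rw [e2]
    have p1 : 0 ≤ η * ‖u‖ * ‖w - z‖ := by positivity
    have p2 : 0 ≤ ‖u‖ * ‖e‖ := by positivity
    nlinarith

end Risk

/-! ### The model gradient -/

section Gradient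

variable {n : ℕ → ℕ} {W : (i : ℕ) → Matrix (Fin (n (i + 1))) (Fin (n i)) ℝ} {d m : ℕ} {η : ℝ}
  {A : Matrix (Fin m) (Fin (n d)) ℝ} {e : EuclideanSpace ℝ (Fin m)}
  {z x : EuclideanSpace ℝ (Fin (n 0))}

/-- The negative of the coefficient of `w / ‖w‖²` in the gradient of `w ↦ ⟨P w, P z⟩`, up to an
error of order `η`. By homogeneity it is determined by the value of `⟨P w, P z⟩`, so `radialCoeff`
is not needed and continuity in `w` is clear. -/
def radialPart (n : ℕ → ℕ) (W : (i : ℕ) → Matrix (Fin (n (i + 1))) (Fin (n i)) ℝ) (d : ℕ)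
    (z w : EuclideanSpace ℝ (Fin (n 0))) : ℝ :=
  angleProd n W z w d * inner ℝ w z - inner ℝ (scaledNet n W d w) (scaledNet n W d z)

/-- The model gradient of the scaled risk: a continuous field on the nonzero vectors within
`gradError` of every rescaled subgradient. The factor `(1 / ‖w‖) ^ 2 • w` is the inversion of `w`
in the unit sphere. -/
def gradModel (n : ℕ → ℕ) (W : (i : ℕ) → Matrix (Fin (n (i + 1))) (Fin (n i)) ℝ) (d : ℕ)
    (z w : EuclideanSpace ℝ (Fin (n 0))) : EuclideanSpace ℝ (Fin (n 0)) :=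
  w - angleProd n W z w d • z + radialPart n W d z w • ((1 / ‖w‖) ^ 2 • w)

/-- The radius of the ball around `gradModel` that contains the rescaled subgradients. -/
def gradError (d : ℕ) (η : ℝ) (z : EuclideanSpace ℝ (Fin (n 0))) (e : EuclideanSpace ℝ (Fin m))
    (w : EuclideanSpace ℝ (Fin (n 0))) : ℝ :=
  6 * (d ^ 2 * η) * (‖w‖ + ‖z‖) + 1.1 * ‖e‖

theorem inner_gradModel_self (hx : x ≠ 0) :
    inner ℝ (gradModel n W d z x) x =
      ‖x‖ ^ 2 - inner ℝ (scaledNet n W d x) (scaledNet n W d z) := by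
  have hx' : ‖x‖ ≠ 0 := norm_ne_zero_iff.mpr hx
  simp only [gradModel, radialPart, inner_add_left, inner_sub_left, real_inner_smul_left,
    real_inner_self_eq_norm_sq]
  rw [real_inner_comm x z]
  field_simp
  ring

theorem inner_gradModel_orth {y : EuclideanSpace ℝ (Fin (n 0))} (hxy : inner ℝ x y = 0) :
    inner ℝ (gradModel n W d z x) y = -(angleProd n W z x d * inner ℝ z y) := by
  simp only [gradModel, inner_add_left, inner_sub_left, real_inner_smul_left, hxy]
  ring

theorem continuousAt_layerAngle (h : WellDistributed n W d η) (hz : z ≠ 0) (hx : x ≠ 0) {i : ℕ}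
    (hi : i ≤ d) : ContinuousAt (fun w => layerAngle n W z w i) x := by
  have h1 := h.scaledNet_ne_zero hi hx
  have h2 := h.scaledNet_ne_zero hi hz
  have hc : Continuous (scaledNet n W i) := continuous_scaledNet i
  unfold layerAngle angle
  fun_prop (disch := simp [h1, h2])

theorem continuousAt_gradModel (h : WellDistributed n W d η) (hz : z ≠ 0) (hx : x ≠ 0) :
    ContinuousAt (gradModel n W d z) x := by
  have hc : Continuous (scaledNet n W d) := continuous_scaledNet d
  have hx' : ‖x‖ ≠ 0 := norm_ne_zero_iff.mpr hx
  have h1 : ContinuousAt (fun w => angleProd n W z w d) x := by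
    unfold angleProd
    refine tendsto_finsetProd _ fun j hj => ?_
    have := continuousAt_layerAngle h hz hx (Finset.mem_range.mp hj).le
    exact (continuousAt_const.sub (this.div_const _))
  unfold gradModel radialPart
  fun_prop (disch := assumption)

namespace WellDistributed

/-- By positive homogeneity the tangent at `x` in direction `x` is the network output at `x`; this
is the tangent estimate for that direction. -/
theorem abs_inner_sub_radialCoeff_le (h : WellDistributed n W d η) (hz : z ≠ 0) (hx : x ≠ 0) :
    |inner ℝ (scaledNet n W d x) (scaledNet n W d z) - (angleProd n W z x d * inner ℝ x z +
      radialCoeff n W z x d * ‖x‖ ^ 2)| ≤ 2 * d ^ 2 * η * ‖x‖ * ‖z‖ := by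
  obtain ⟨δ, h1, -, h3, -⟩ := h.exists_tangent hz hx x
    (fun i _ => layerAngle_le_pi (n := n) (W := W) z x i) le_rfl
  obtain ⟨s, hs, hs0⟩ := (h1.and self_mem_nhdsWithin).exists
  have hs0 : 0 < s := hs0
  have e1 : x + s • x = (1 + s) • x := by module
  rw [e1, scaledNet_smul _ (by linarith), add_smul, one_smul] at hs
  have hδ : δ = scaledNet n W d x :=
    (smul_right_injective _ hs0.ne' (add_left_cancel hs)).symm
  rwa [hδ, real_inner_self_eq_norm_sq] at h3

end WellDistributed

theorem RRIC.rightDerivLE (h : WellDistributed n W d η) (hA : RRIC A (scaledNet n W d) η)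
    (hz : z ≠ 0) {w : EuclideanSpace ℝ (Fin (n 0))} (hw : w ≠ 0)
    (u : EuclideanSpace ℝ (Fin (n 0))) :
    RightDerivLE (scaledRisk n W d A z e) w u
      (inner ℝ (gradModel n W d z w) u + gradError d η z e w * ‖u‖) := by
  obtain ⟨δ, D, -, h2, h3, -, h5, h6⟩ := hA.exists_hasDerivWithinAt (e := e) h hz hw u
    (fun i _ => layerAngle_le_pi (n := n) (W := W) z w i)
  refine ⟨D, h5, ?_⟩
  have hE := h.abs_inner_sub_radialCoeff_le hz hw
  have hw' : 0 < ‖w‖ := norm_pos_iff.mpr hw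
  have hη := h.nonneg
  have hd := h.one_le_cast
  set c := angleProd n W z w d
  set Z := radialCoeff n W z w d
  have e1 : inner ℝ (gradModel n W d z w) u = inner ℝ u w - c * inner ℝ u z +
      radialPart n W d z w * ((1 / ‖w‖) ^ 2 * inner ℝ u w) := by
    simp only [gradModel, inner_add_left, inner_sub_left, real_inner_smul_left]
    rw [real_inner_comm u w, real_inner_comm u z]
  have e2 : Z * inner ℝ u w + radialPart n W d z w * ((1 / ‖w‖) ^ 2 * inner ℝ u w) =
      -((inner ℝ (scaledNet n W d w) (scaledNet n W d z) - (c * inner ℝ w z + Z * ‖w‖ ^ 2)) *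
        ((1 / ‖w‖) ^ 2 * inner ℝ u w)) := by
    rw [radialPart]
    field_simp
    ring
  have h7 : |Z * inner ℝ u w + radialPart n W d z w * ((1 / ‖w‖) ^ 2 * inner ℝ u w)| ≤
      2 * d ^ 2 * η * ‖u‖ * ‖z‖ := by
    rw [e2, abs_neg, abs_mul, abs_mul, abs_of_pos (by positivity : 0 < (1 / ‖w‖) ^ 2)]
    calc _ ≤ (2 * d ^ 2 * η * ‖w‖ * ‖z‖) * ((1 / ‖w‖) ^ 2 * (‖u‖ * ‖w‖)) := by
          gcongr; exact abs_real_inner_le_norm _ _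
      _ = _ := by field_simp
  have hwz : ‖w - z‖ ≤ ‖w‖ + ‖z‖ := norm_sub_le _ _
  have h8 : (1.1 * η * ‖w - z‖ + 1.1 * ‖e‖) * ‖u‖ ≤
      (1.1 * η * (‖w‖ + ‖z‖) + 1.1 * ‖e‖) * ‖u‖ := by gcongr
  have h2 := (abs_le.mp h2).2
  have h3 := (abs_le.mp h3).1
  have h6 := (abs_le.mp h6).2
  have h7 := (abs_le.mp h7).1
  rw [inner_sub_right] at h6
  have hd2 : (d : ℝ) ≤ d ^ 2 := by nlinarith
  have hd3 : (1 : ℝ) ≤ d ^ 2 := by nlinarith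
  have p1 : 2 * d * η * ‖u‖ * ‖w‖ ≤ 2 * d ^ 2 * η * ‖u‖ * ‖w‖ := by gcongr
  have p2 : 1 * (η * (‖w‖ + ‖z‖) * ‖u‖) ≤ d ^ 2 * (η * (‖w‖ + ‖z‖) * ‖u‖) := by gcongr
  have p3 : 0 ≤ d ^ 2 * η * ‖u‖ * ‖w‖ := by positivity
  have p4 : 0 ≤ d ^ 2 * η * ‖u‖ * ‖z‖ := by positivity
  rw [e1, gradError]
  nlinarith

/-- Near `z` the model gradient may be replaced by `w - z`, with an error that has no term of order
`η * ‖z‖`. -/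
theorem RRIC.rightDerivLE_near (h : WellDistributed n W d η) (hA : RRIC A (scaledNet n W d) η)
    (hz : z ≠ 0) {w : EuclideanSpace ℝ (Fin (n 0))} (hw : ‖w - z‖ ≤ 1 / (10 ^ 6 * d ^ 2) * ‖z‖)
    (u : EuclideanSpace ℝ (Fin (n 0))) :
    RightDerivLE (scaledRisk n W d A z e) w u
      (inner ℝ (w - z) u + (1 / 16 * ‖w - z‖ + 1.1 * ‖e‖) * ‖u‖) := by
  have hz' := norm_pos_iff.mpr hz
  have hd := h.one_le_cast
  have hη := h.nonneg
  have hw0 : w ≠ 0 := by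
    rintro rfl
    rw [zero_sub, norm_neg] at hw
    have : 1 / (10 ^ 6 * (d : ℝ) ^ 2) ≤ 1 / 2 := by
      gcongr; nlinarith
    nlinarith
  have hΘ : ∀ i < d, layerAngle n W z w i ≤ 4 / (10 ^ 6 * d ^ 2) := fun i hi => by
    calc layerAngle n W z w i ≤ 4 * (‖w - z‖ / ‖z‖) := h.angle_scaledNet_le hi.le hw0 hz
      _ ≤ 4 * (1 / (10 ^ 6 * d ^ 2)) :=
        mul_le_mul_of_nonneg_left ((div_le_iff₀ hz').mpr hw) (by norm_num)
      _ = _ := by ring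
  obtain ⟨δ, D, -, -, -, h4, h5, h6⟩ := hA.exists_hasDerivWithinAt (e := e) h hz hw0 u hΘ
  refine ⟨D, h5, ?_⟩
  have hdη := h.mul_le le_rfl
  have hη1 := h.eta_le
  have hs : √(4 * η + 2 * (4 / (10 ^ 6 * d ^ 2))) ≤ 4 / (10 ^ 3 * d) := by
    rw [Real.sqrt_le_left (by positivity)]
    have h7 := h.mul_pow_le (k := 2) (by norm_num)
    have : η ≤ 1 / (10 ^ 6 * d ^ 2) := by rw [le_div_iff₀ (by positivity)]; linarith
    have e1 : (4 / (10 ^ 3 * (d : ℝ))) ^ 2 = 16 * (1 / (10 ^ 6 * d ^ 2)) := by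
      field_simp; norm_num
    have e2 : 2 * (4 / (10 ^ 6 * (d : ℝ) ^ 2)) = 8 * (1 / (10 ^ 6 * d ^ 2)) := by ring
    rw [e1, e2]
    have : 0 < 1 / (10 ^ 6 * (d : ℝ) ^ 2) := by positivity
    linarith
  have h9 : 2 * d * (η + √(4 * η + 2 * (4 / (10 ^ 6 * d ^ 2)))) ≤ 1 / 100 := by
    calc _ ≤ 2 * d * (η + 4 / (10 ^ 3 * d)) := by gcongr
      _ = 2 * (d * η) + 8 / 10 ^ 3 := by field_simp; ring
      _ ≤ _ := by linarith
  have h10 : 2 * d * (η + √(4 * η + 2 * (4 / (10 ^ 6 * d ^ 2)))) * ‖u‖ * ‖w - z‖ ≤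
      1 / 100 * ‖u‖ * ‖w - z‖ := by gcongr
  have h11 : (1.1 * η * ‖w - z‖ + 1.1 * ‖e‖) * ‖u‖ ≤
      (1.1 * (1 / 10 ^ 6) * ‖w - z‖ + 1.1 * ‖e‖) * ‖u‖ := by gcongr
  have h4 := (abs_le.mp h4).2
  have h6 := (abs_le.mp h6).2
  have p1 : 0 ≤ ‖u‖ * ‖w - z‖ := by positivity
  rw [real_inner_comm]
  nlinarith

theorem RightDerivLE.const_mul {E : Type*} [NormedAddCommGroup E] [InnerProductSpace ℝ E]
    {f : E → ℝ} {w u : E} {M c : ℝ} (hc : 0 ≤ c) (hf : RightDerivLE f w u M) :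
    RightDerivLE (fun x => c * f x) w u (c * M) :=
  let ⟨D, h1, h2⟩ := hf
  ⟨c * D, h1.const_mul c, mul_le_mul_of_nonneg_left h2 hc⟩

/-- The criterion `norm_sub_le_of_mem_clarkeSubdiff` for a positive multiple `c * f`, with the
subgradient scaled back by `c⁻¹`. -/
theorem norm_inv_smul_sub_le_of_mem_clarkeSubdiff {E : Type*} [NormedAddCommGroup E]
    [InnerProductSpace ℝ E] {f : E → ℝ} (hf : Continuous f) {c : ℝ} (hc : 0 < c) {H : E → E}
    {R : E → ℝ} {x v : E} (hH : ContinuousAt H x) (hR : ContinuousAt R x) (hR0 : 0 ≤ R x)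
    (hder : ∀ᶠ w in 𝓝 x, ∀ u, RightDerivLE f w u (inner ℝ (H w) u + R w * ‖u‖))
    (hv : v ∈ clarkeSubdiff (fun x => c * f x) x) : ‖c⁻¹ • v - H x‖ ≤ R x := by
  have h1 := norm_sub_le_of_mem_clarkeSubdiff (H := fun w => c • H w) (R := fun w => c * R w)
    (hf.const_mul c) (hH.const_smul c) (hR.const_mul c) (by positivity) (by
      filter_upwards [hder] with w hw u
      refine ((hw u).const_mul hc.le).mono (le_of_eq ?_)
      rw [real_inner_smul_left]; ring) hv
  have e1 : c⁻¹ • v - H x = c⁻¹ • (v - c • H x) := by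
    rw [smul_sub, smul_smul, inv_mul_cancel₀ hc.ne', one_smul]
  rw [e1, norm_smul, norm_inv, Real.norm_of_nonneg hc.le, inv_mul_le_iff₀ hc]
  exact h1

theorem RRIC.norm_sub_gradModel_le (h : WellDistributed n W d η)
    (hA : RRIC A (scaledNet n W d) η) (hz : z ≠ 0) (hx : x ≠ 0) {c : ℝ} (hc : 0 < c)
    {v : EuclideanSpace ℝ (Fin (n 0))}
    (hv : v ∈ clarkeSubdiff (fun x => c * scaledRisk n W d A z e x) x) :
    ‖c⁻¹ • v - gradModel n W d z x‖ ≤ gradError d η z e x := by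
  have hη := h.nonneg
  refine norm_inv_smul_sub_le_of_mem_clarkeSubdiff continuous_scaledRisk hc
    (continuousAt_gradModel h hz hx) ?_ ?_ ?_ hv
  · unfold gradError; fun_prop
  · unfold gradError; positivity
  · filter_upwards [isOpen_ne.mem_nhds hx] with w hw u
    exact hA.rightDerivLE h hz hw u

theorem RRIC.norm_sub_near_le (h : WellDistributed n W d η)
    (hA : RRIC A (scaledNet n W d) η) (hz : z ≠ 0)
    (hx : ‖x - z‖ < 1 / (10 ^ 6 * d ^ 2) * ‖z‖) {c : ℝ} (hc : 0 < c)
    {v : EuclideanSpace ℝ (Fin (n 0))}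
    (hv : v ∈ clarkeSubdiff (fun x => c * scaledRisk n W d A z e x) x) :
    ‖c⁻¹ • v - (x - z)‖ ≤ 1 / 16 * ‖x - z‖ + 1.1 * ‖e‖ := by
  refine norm_inv_smul_sub_le_of_mem_clarkeSubdiff (H := fun x => x - z)
    (R := fun x => 1 / 16 * ‖x - z‖ + 1.1 * ‖e‖) continuous_scaledRisk hc
    (by fun_prop) (by fun_prop) (by positivity) ?_ hv
  have hc : ContinuousAt (fun x => ‖x - z‖) x := by fun_prop
  filter_upwards [hc.eventually_lt_const hx] with w hw u
  exact hA.rightDerivLE_near h hz hw.le u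

namespace WellDistributed

theorem abs_angleProd_sub_le (h : WellDistributed n W d η) (hx : x ≠ 0)
    {w : EuclideanSpace ℝ (Fin (n 0))} (hw : w ≠ 0) {i : ℕ} (hi : i ≤ d) :
    |angleProd n W z w i - angleProd n W z x i| ≤ 2 * i * (‖w - x‖ / ‖x‖) := by
  induction i with
  | zero => simp [angleProd]
  | succ i ih =>
    have h1 := ih (by omega)
    rw [angleProd, angleProd, Finset.prod_range_succ, Finset.prod_range_succ, ← angleProd,
      ← angleProd]
    have h2 := angleProd_mem (n := n) (W := W) z x i
    have h3 := one_sub_div_pi_mem (layerAngle_nonneg (n := n) (W := W) z w i)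
      (layerAngle_le_pi (n := n) (W := W) z w i)
    have h4 : |layerAngle n W z w i - layerAngle n W z x i| ≤ 4 * (‖w - x‖ / ‖x‖) := by
      have h5 := h.angle_scaledNet_le (i := i) (by omega) hw hx
      have h6 := angle_le_angle_add_angle (scaledNet n W i w) (scaledNet n W i x)
        (scaledNet n W i z)
      have h7 := angle_le_angle_add_angle (scaledNet n W i x) (scaledNet n W i w)
        (scaledNet n W i z)
      rw [angle_comm (scaledNet n W i x) (scaledNet n W i w)] at h7
      unfold layerAngle
      rw [abs_le]
      constructor <;> linarith
    set a := angleProd n W z w i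
    set b := angleProd n W z x i
    set s := layerAngle n W z w i
    set t := layerAngle n W z x i
    have e1 : a * (1 - s / Real.pi) - b * (1 - t / Real.pi) =
        (a - b) * (1 - s / Real.pi) + b * (-((s - t) / Real.pi)) := by ring
    have h8 : |(a - b) * (1 - s / Real.pi)| ≤ |a - b| * 1 := by
      rw [abs_mul, abs_of_nonneg h3.1]
      gcongr
      exact h3.2
    have h9 : |b * (-((s - t) / Real.pi))| ≤ 1 * ((4 * (‖w - x‖ / ‖x‖)) / 2) := by
      rw [abs_mul, abs_neg, abs_div, abs_of_nonneg h2.1, abs_of_pos Real.pi_pos]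
      gcongr
      · exact h2.2
      · linarith [Real.pi_gt_three]
    rw [e1]
    refine (abs_add_le _ _).trans ?_
    push_cast
    linarith

theorem abs_radialPart_le (h : WellDistributed n W d η) (z w : EuclideanSpace ℝ (Fin (n 0))) :
    |radialPart n W d z w| ≤ 2.1 * (‖w‖ * ‖z‖) := by
  have h1 := abs_real_inner_le_norm w z
  have h2 := abs_real_inner_le_norm (scaledNet n W d w) (scaledNet n W d z)
  have h3 : ‖scaledNet n W d w‖ * ‖scaledNet n W d z‖ ≤ (1.01 * ‖w‖) * (1.01 * ‖z‖) := by
    gcongr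
    · exact h.norm_le le_rfl w
    · exact h.norm_le le_rfl z
  have h4 := angleProd_mem (n := n) (W := W) z w d
  rw [radialPart]
  refine (abs_sub _ _).trans ?_
  rw [abs_mul, abs_of_nonneg h4.1]
  have h5 : angleProd n W z w d * |inner ℝ w z| ≤ 1 * (‖w‖ * ‖z‖) := by
    gcongr; exact h4.2
  have : 0 ≤ ‖w‖ * ‖z‖ := by positivity
  nlinarith

/-- The model gradient is Lipschitz at `x` on the nonzero vectors, with a constant of order `d *
‖z‖ / ‖x‖`. -/
theorem norm_gradModel_sub_le (h : WellDistributed n W d η) (hx : x ≠ 0)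
    {w : EuclideanSpace ℝ (Fin (n 0))} (hw : w ≠ 0) :
    ‖gradModel n W d z w - gradModel n W d z x‖ ≤ (1 + 9 * d * (‖z‖ / ‖x‖)) * ‖w - x‖ := by
  have hx' := norm_pos_iff.mpr hx
  have hw' := norm_pos_iff.mpr hw
  have hd := h.one_le_cast
  have hp := h.abs_angleProd_sub_le (z := z) hx hw le_rfl
  have hp1 := angleProd_mem (n := n) (W := W) z w d
  have hS := h.abs_radialPart_le z w
  -- the inversion in the unit sphere changes distances by the factor `1 / (‖w‖ * ‖x‖)`
  have hN : ‖(1 / ‖w‖) ^ 2 • w - (1 / ‖x‖) ^ 2 • x‖ = ‖w - x‖ / (‖w‖ * ‖x‖) := by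
    have := dist_div_norm_sq_smul hw hx 1
    rw [dist_eq_norm, dist_eq_norm] at this
    rw [this]
    ring
  have hNx : ‖(1 / ‖x‖) ^ 2 • x‖ = 1 / ‖x‖ := by
    rw [norm_smul, Real.norm_of_nonneg (by positivity)]
    field_simp
  have hSd : |radialPart n W d z w - radialPart n W d z x| ≤
      (2 * d + 2.1) * (‖w - x‖ * ‖z‖) := by
    have e1 : radialPart n W d z w - radialPart n W d z x =
        (angleProd n W z w d - angleProd n W z x d) * inner ℝ x z +
        angleProd n W z w d * inner ℝ (w - x) z -
        inner ℝ (scaledNet n W d w - scaledNet n W d x) (scaledNet n W d z) := by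
      simp only [radialPart, inner_sub_left]; ring
    have h1 : |(angleProd n W z w d - angleProd n W z x d) * inner ℝ x z| ≤
        (2 * d * (‖w - x‖ / ‖x‖)) * (‖x‖ * ‖z‖) := by
      rw [abs_mul]; gcongr; exact abs_real_inner_le_norm _ _
    have e2 : (2 * d * (‖w - x‖ / ‖x‖)) * (‖x‖ * ‖z‖) = 2 * d * (‖w - x‖ * ‖z‖) := by field_simp
    have h2 : |angleProd n W z w d * inner ℝ (w - x) z| ≤ 1 * (‖w - x‖ * ‖z‖) := by
      rw [abs_mul, abs_of_nonneg hp1.1]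
      gcongr
      · exact hp1.2
      · exact abs_real_inner_le_norm _ _
    have h3 : |inner ℝ (scaledNet n W d w - scaledNet n W d x) (scaledNet n W d z)| ≤
        (1.01 * ‖w - x‖) * (1.01 * ‖z‖) :=
      (abs_real_inner_le_norm _ _).trans
        (mul_le_mul (h.norm_sub_le' le_rfl w x) (h.norm_le le_rfl z) (norm_nonneg _)
          (by positivity))
    rw [e1]
    have h4 := abs_sub ((angleProd n W z w d - angleProd n W z x d) * inner ℝ x z +
        angleProd n W z w d * inner ℝ (w - x) z)
        (inner ℝ (scaledNet n W d w - scaledNet n W d x) (scaledNet n W d z))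
    have h5 := abs_add_le ((angleProd n W z w d - angleProd n W z x d) * inner ℝ x z)
        (angleProd n W z w d * inner ℝ (w - x) z)
    have : 0 ≤ ‖w - x‖ * ‖z‖ := by positivity
    nlinarith
  have e3 : gradModel n W d z w - gradModel n W d z x =
      (w - x) - (angleProd n W z w d - angleProd n W z x d) • z +
      (radialPart n W d z w • ((1 / ‖w‖) ^ 2 • w - (1 / ‖x‖) ^ 2 • x) +
      (radialPart n W d z w - radialPart n W d z x) • ((1 / ‖x‖) ^ 2 • x)) := by
    simp only [gradModel]
    module
  have h6 : ‖(angleProd n W z w d - angleProd n W z x d) • z‖ ≤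
      (2 * d * (‖w - x‖ / ‖x‖)) * ‖z‖ := by
    rw [norm_smul, Real.norm_eq_abs]; gcongr
  have h7 : ‖radialPart n W d z w • ((1 / ‖w‖) ^ 2 • w - (1 / ‖x‖) ^ 2 • x)‖ ≤
      (2.1 * (‖w‖ * ‖z‖)) * (‖w - x‖ / (‖w‖ * ‖x‖)) := by
    rw [norm_smul, Real.norm_eq_abs, hN]; gcongr
  have h8 : ‖(radialPart n W d z w - radialPart n W d z x) • ((1 / ‖x‖) ^ 2 • x)‖ ≤
      ((2 * d + 2.1) * (‖w - x‖ * ‖z‖)) * (1 / ‖x‖) := by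
    rw [norm_smul, Real.norm_eq_abs, hNx]; gcongr
  rw [e3]
  refine (norm_add_le _ _).trans ?_
  have h9 := _root_.norm_sub_le (w - x) ((angleProd n W z w d - angleProd n W z x d) • z)
  have h10 := norm_add_le (radialPart n W d z w • ((1 / ‖w‖) ^ 2 • w - (1 / ‖x‖) ^ 2 • x))
    ((radialPart n W d z w - radialPart n W d z x) • ((1 / ‖x‖) ^ 2 • x))
  have e4 : (2 * d * (‖w - x‖ / ‖x‖)) * ‖z‖ = 2 * d * (‖z‖ / ‖x‖ * ‖w - x‖) := by ring
  have e5 : (2.1 * (‖w‖ * ‖z‖)) * (‖w - x‖ / (‖w‖ * ‖x‖)) = 2.1 * (‖z‖ / ‖x‖ * ‖w - x‖) := by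
    field_simp
  have e6 : ((2 * d + 2.1) * (‖w - x‖ * ‖z‖)) * (1 / ‖x‖) =
      (2 * d + 2.1) * (‖z‖ / ‖x‖ * ‖w - x‖) := by ring
  have h11 : 0 ≤ ‖z‖ / ‖x‖ * ‖w - x‖ := by positivity
  rw [e4] at h6
  rw [e5] at h7
  rw [e6] at h8
  nlinarith

theorem norm_gradModel_le (h : WellDistributed n W d η) (hx : x ≠ 0) :
    ‖gradModel n W d z x‖ ≤ ‖x‖ + 4 * ‖z‖ := by
  have hx' := norm_pos_iff.mpr hx
  have hp := angleProd_mem (n := n) (W := W) z x d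
  have hS := h.abs_radialPart_le z x
  have hNx : ‖(1 / ‖x‖) ^ 2 • x‖ = 1 / ‖x‖ := by
    rw [norm_smul, Real.norm_of_nonneg (by positivity)]
    field_simp
  have h1 : ‖angleProd n W z x d • z‖ ≤ 1 * ‖z‖ := by
    rw [norm_smul, Real.norm_of_nonneg hp.1]; gcongr; exact hp.2
  have h2 : ‖radialPart n W d z x • ((1 / ‖x‖) ^ 2 • x)‖ ≤ (2.1 * (‖x‖ * ‖z‖)) * (1 / ‖x‖) := by
    rw [norm_smul, Real.norm_eq_abs, hNx]; gcongr
  have e1 : (2.1 * (‖x‖ * ‖z‖)) * (1 / ‖x‖) = 2.1 * ‖z‖ := by field_simp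
  rw [gradModel]
  refine (norm_add_le _ _).trans ?_
  have h3 := _root_.norm_sub_le x (angleProd n W z x d • z)
  have := norm_nonneg z
  linarith

end WellDistributed

end Gradient

/-! ### One step of the subgradient method -/

section Step

variable {n : ℕ → ℕ} {W : (i : ℕ) → Matrix (Fin (n (i + 1))) (Fin (n i)) ℝ} {d m : ℕ} {η : ℝ}
  {A : Matrix (Fin m) (Fin (n d)) ℝ} {e : EuclideanSpace ℝ (Fin m)}
  {z x v : EuclideanSpace ℝ (Fin (n 0))}

theorem WellDistributed.noise_le (h : WellDistributed n W d η)
    (he : ‖e‖ * (d : ℝ) ^ 6 ≤ 1 / 10 ^ 4 * ‖z‖) : ‖e‖ ≤ 1 / 10 ^ 4 * ‖z‖ :=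
  le_trans (le_mul_of_one_le_right (norm_nonneg _) (one_le_pow₀ h.one_le_cast)) he

theorem WellDistributed.gradError_le (h : WellDistributed n W d η)
    (he : ‖e‖ * (d : ℝ) ^ 6 ≤ 1 / 10 ^ 4 * ‖z‖) (x : EuclideanSpace ℝ (Fin (n 0))) :
    gradError d η z e x ≤ 1 / 10 ^ 5 * ‖x‖ + 1 / 10 ^ 3 * ‖z‖ := by
  have h1 := h.noise_le he
  have h2 := h.mul_pow_le (k := 2) (by norm_num)
  have h3 : 6 * (d ^ 2 * η) * (‖x‖ + ‖z‖) ≤ 6 * (1 / 10 ^ 6) * (‖x‖ + ‖z‖) := by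
    gcongr; linarith
  have := norm_nonneg z
  have := norm_nonneg x
  rw [gradError]
  linarith

theorem WellDistributed.norm_step_le (h : WellDistributed n W d η)
    (he : ‖e‖ * (d : ℝ) ^ 6 ≤ 1 / 10 ^ 4 * ‖z‖) (hx : x ≠ 0)
    (hv : ‖v - gradModel n W d z x‖ ≤ gradError d η z e x) : ‖v‖ ≤ 2 * ‖x‖ + 5 * ‖z‖ := by
  have h1 := h.norm_gradModel_le (z := z) hx
  have h2 := h.gradError_le he x
  have h3 := norm_le_norm_add_norm_sub' v (gradModel n W d z x)
  have := norm_nonneg z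
  have := norm_nonneg x
  linarith

/-- Sufficient decrease: outside the ball of radius `0.1 * ‖z‖`, a step along a subgradient that is
large compared with `gradError` decreases the risk by at least `κ / 2 * ‖v‖ ^ 2`, because every
point of the step has a model gradient close to `v`. -/
theorem RRIC.scaledRisk_step_le (h : WellDistributed n W d η) (hA : RRIC A (scaledNet n W d) η)
    (he : ‖e‖ * (d : ℝ) ^ 6 ≤ 1 / 10 ^ 4 * ‖z‖) (hz : z ≠ 0) (hxz : 0.1 * ‖z‖ ≤ ‖x‖)
    {κ : ℝ} (hκ : 0 ≤ κ) (hκd : κ * d ≤ 1 / 10 ^ 4)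
    (hv : ‖v - gradModel n W d z x‖ ≤ gradError d η z e x)
    (hbig : 8 * gradError d η z e x ≤ ‖v‖) :
    scaledRisk n W d A z e (x - κ • v) ≤ scaledRisk n W d A z e x - κ / 2 * ‖v‖ ^ 2 := by
  have hz' := norm_pos_iff.mpr hz
  have hx' : 0 < ‖x‖ := by linarith
  have hx : x ≠ 0 := norm_pos_iff.mp hx'
  have hd := h.one_le_cast
  have hη := h.nonneg
  have hvn := h.norm_step_le he hx hv
  have hvx : ‖v‖ ≤ 52 * ‖x‖ := by linarith
  have hκ1 : κ ≤ 1 / 10 ^ 4 := le_trans (le_mul_of_one_le_right hκ hd) hκd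
  have key := sub_le_mul_of_rightDerivLE (f := scaledRisk n W d A z e) continuous_scaledRisk
    (z := x) (u := -v) (t := κ) (M := -(1 / 2) * ‖v‖ ^ 2) hκ ?_
  · rw [smul_neg, ← sub_eq_add_neg] at key
    linarith
  intro s hs
  have hs1 : 0 ≤ s := hs.1
  have hsv : s * ‖v‖ ≤ 1 / 2 * ‖x‖ := by
    calc s * ‖v‖ ≤ (1 / 10 ^ 4) * (52 * ‖x‖) := by
          gcongr
          exact hs.2.le.trans hκ1
      _ ≤ _ := by linarith
  set w := x + s • -v with hw
  have hwx : w - x = -(s • v) := by rw [hw]; module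
  have hwx' : ‖w - x‖ = s * ‖v‖ := by rw [hwx, norm_neg, norm_smul, Real.norm_of_nonneg hs.1]
  have hwn : ‖w‖ ≤ 3 / 2 * ‖x‖ := by
    have := norm_le_norm_add_norm_sub' w x
    linarith
  have hw0 : w ≠ 0 := by
    rintro h0
    rw [h0, zero_sub, norm_neg] at hwx'
    linarith
  refine (hA.rightDerivLE h hz hw0 (-v)).mono ?_
  have hL := h.norm_gradModel_sub_le (z := z) hx hw0
  have hr : ‖z‖ / ‖x‖ ≤ 10 := by rw [div_le_iff₀ hx']; linarith
  have hL' : ‖gradModel n W d z w - gradModel n W d z x‖ ≤ 1 / 100 * ‖v‖ := by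
    calc _ ≤ (1 + 9 * d * (‖z‖ / ‖x‖)) * ‖w - x‖ := hL
      _ ≤ (d + 9 * d * 10) * (κ * ‖v‖) := by
        rw [hwx']
        gcongr
        exact hs.2.le
      _ = 91 * (κ * d) * ‖v‖ := by ring
      _ ≤ 91 * (1 / 10 ^ 4) * ‖v‖ := by gcongr
      _ ≤ _ := by have := norm_nonneg v; linarith
  have hE : gradError d η z e w ≤ 3 / 2 * gradError d η z e x := by
    have : 6 * (d ^ 2 * η) * (‖w‖ + ‖z‖) ≤ 6 * (d ^ 2 * η) * (3 / 2 * (‖x‖ + ‖z‖)) := by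
      gcongr; linarith
    rw [gradError, gradError]
    linarith [norm_nonneg e]
  have hin : ‖v‖ ^ 2 - inner ℝ (gradModel n W d z w) v ≤
      ‖v‖ * (gradError d η z e x + 1 / 100 * ‖v‖) := by
    have e1 : ‖v‖ ^ 2 - inner ℝ (gradModel n W d z w) v =
        inner ℝ (v - gradModel n W d z w) v := by
      rw [inner_sub_left, real_inner_self_eq_norm_sq]
    rw [e1]
    refine (real_inner_le_norm _ _).trans ?_
    rw [mul_comm]
    gcongr
    have := norm_sub_le_norm_sub_add_norm_sub v (gradModel n W d z x) (gradModel n W d z w)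
    rw [norm_sub_rev (gradModel n W d z x)] at this
    linarith
  rw [norm_neg, inner_neg_right]
  have h1 := mul_le_mul_of_nonneg_right hE (norm_nonneg v)
  have h2 := mul_le_mul_of_nonneg_right hbig (norm_nonneg v)
  nlinarith [sq_nonneg ‖v‖]

set_option maxHeartbeats 1000000 in
/-- A small subgradient at a sign-flipped point forces the point to be close to `z`. The component
of the model gradient orthogonal to `x` bounds the component of `z` orthogonal to `x`, at the price
of `1 / angleProd ≤ 3 d⁵`; the radial component determines `‖x‖`. -/
theorem RRIC.norm_sub_le_of_norm_le (h : WellDistributed n W d η)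
    (hA : RRIC A (scaledNet n W d) η)
    (he : ‖e‖ * (d : ℝ) ^ 6 ≤ 1 / 10 ^ 4 * ‖z‖) (hz : z ≠ 0) (hx : x ≠ 0)
    (hflip : scaledRisk n W d A z e x ≤ scaledRisk n W d A z e (-x))
    {σ : ℝ} (hσ0 : 0 ≤ σ) (hησ : 48 * (d ^ 2 * η) ≤ σ) (hσ : σ * (d : ℝ) ^ 5 ≤ 1 / 10 ^ 4)
    (hv : ‖v - gradModel n W d z x‖ ≤ gradError d η z e x)
    (hvs : ‖v‖ ≤ σ * (‖x‖ + ‖z‖) + 10 * ‖e‖) :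
    ‖x - z‖ ≤ 100 * (d : ℝ) ^ 5 * (σ * ‖z‖ + ‖e‖) := by
  have hz' := norm_pos_iff.mpr hz
  have hx' := norm_pos_iff.mpr hx
  have hd := h.one_le_cast
  have hη := h.nonneg
  have hd5 : 1 ≤ (d : ℝ) ^ 5 := one_le_pow₀ hd
  have hμ := h.noise_le he
  have hμ5 : ‖e‖ * (d : ℝ) ^ 5 ≤ 1 / 10 ^ 4 * ‖z‖ :=
    (mul_le_mul_of_nonneg_left (pow_le_pow_right₀ hd (by norm_num)) (norm_nonneg e)).trans he
  have hσ1 : σ ≤ 1 / 10 ^ 4 := le_trans (le_mul_of_one_le_right hσ0 hd5) hσ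
  set g := ‖gradModel n W d z x‖ with hg
  have hg0 : 0 ≤ g := norm_nonneg _
  have hg1 : g ≤ 1.2 * σ * (‖x‖ + ‖z‖) + 12 * ‖e‖ := by
    have h1 := norm_le_norm_add_norm_sub' (gradModel n W d z x) v
    rw [norm_sub_rev] at h1
    have h2 : 6 * (d ^ 2 * η) * (‖x‖ + ‖z‖) ≤ σ / 8 * (‖x‖ + ‖z‖) := by
      gcongr; linarith
    rw [gradError] at hv
    have : 0 ≤ σ * (‖x‖ + ‖z‖) := by positivity
    linarith [norm_nonneg e]
  -- the radial component of the model gradient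
  have hrad := abs_le.mp (abs_real_inner_le_norm (gradModel n W d z x) x)
  rw [inner_gradModel_self hx, ← hg] at hrad
  set I := inner ℝ (scaledNet n W d x) (scaledNet n W d z) with hI
  have hpx := h.norm_bounds le_rfl x
  have hpz := h.norm_bounds le_rfl z
  have ht := h.mul_le le_rfl
  set t := (d : ℝ) * η with ht_def
  have ht0 : 0 ≤ t := by positivity
  have htσ : 48 * t ≤ σ := by
    refine le_trans ?_ hησ
    rw [ht_def]
    gcongr
    nlinarith
  have hprod : ‖scaledNet n W d x‖ * ‖scaledNet n W d z‖ ≤ (1 + 3 * t) * ‖z‖ * ‖x‖ := by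
    calc _ ≤ ((1 + t) * ‖x‖) * ((1 + t) * ‖z‖) := by
          gcongr
          · exact hpx.2
          · exact hpz.2
      _ = ((1 + t) ^ 2) * (‖z‖ * ‖x‖) := by ring
      _ ≤ (1 + 3 * t) * (‖z‖ * ‖x‖) := by gcongr; nlinarith
      _ = _ := by ring
  have hup : ‖x‖ ≤ (1 + 3 * t) * ‖z‖ + g := by
    have h1 : I ≤ (1 + 3 * t) * ‖z‖ * ‖x‖ := (real_inner_le_norm _ _).trans hprod
    refine le_of_mul_le_mul_right ?_ hx'
    linarith
  have hx2 : ‖x‖ ≤ 1.1 * ‖z‖ := by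
    have h1 : σ * (‖x‖ + ‖z‖) ≤ 1 / 10 ^ 4 * (‖x‖ + ‖z‖) := by gcongr
    have h2 : t * ‖z‖ ≤ 1 / 10 ^ 6 * ‖z‖ := by gcongr
    linarith
  have hg2 : g ≤ 4 * σ * ‖z‖ + 12 * ‖e‖ := by
    have : σ * ‖x‖ ≤ σ * (1.1 * ‖z‖) := by gcongr
    have : 0 ≤ σ * ‖z‖ := by positivity
    linarith
  -- the sign flip keeps the angle away from `π`
  have hang : angle x z < 2 * Real.pi / 3 := by
    by_contra hcon
    push Not at hcon
    have h1 := hA.scaledRisk_sub_neg_ge (e := e) h he hz hx (by linarith) hcon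
    have : 0 < ‖x‖ * ‖z‖ * (1 / (16 * (d : ℝ) ^ 5)) := by positivity
    linarith
  have hP : 1 / 3 * (1 / (d : ℝ) ^ 5) ≤ angleProd n W z x d := by
    refine le_trans ?_ (h.le_angleProd hz hx h.one_le le_rfl)
    gcongr
    rw [le_sub_comm, div_le_iff₀ Real.pi_pos]
    linarith
  -- the component of `z` orthogonal to `x`
  set y := z - (inner ℝ x z / ‖x‖ ^ 2) • x with hy
  have hxy : inner ℝ x y = 0 := by
    rw [hy, inner_sub_right, inner_smul_right, real_inner_self_eq_norm_sq]
    field_simp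
    ring
  have hzy : inner ℝ z y = ‖y‖ ^ 2 := by
    have e1 : z = y + (inner ℝ x z / ‖x‖ ^ 2) • x := by rw [hy]; abel
    conv_lhs => rw [e1]
    rw [inner_add_left, real_inner_smul_left, hxy, real_inner_self_eq_norm_sq]
    ring
  have hyg : ‖y‖ ≤ 3 * (d : ℝ) ^ 5 * g := by
    by_cases hy0 : ‖y‖ = 0
    · rw [hy0]; positivity
    have hy0 : 0 < ‖y‖ := lt_of_le_of_ne (norm_nonneg _) (Ne.symm hy0)
    have h1 := (abs_le.mp (abs_real_inner_le_norm (gradModel n W d z x) y)).1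
    rw [inner_gradModel_orth hxy, hzy, ← hg] at h1
    have h2 : angleProd n W z x d * ‖y‖ ≤ g := by
      refine le_of_mul_le_mul_right ?_ hy0
      linarith
    have h3 : 1 / 3 * (1 / (d : ℝ) ^ 5) * ‖y‖ ≤ g :=
      le_trans (by gcongr) h2
    calc ‖y‖ = 3 * (d : ℝ) ^ 5 * (1 / 3 * (1 / (d : ℝ) ^ 5) * ‖y‖) := by field_simp
      _ ≤ _ := by gcongr
  have hyz : ‖y‖ ≤ 0.005 * ‖z‖ := by
    have h1 : (d : ℝ) ^ 5 * g ≤ (d : ℝ) ^ 5 * (4 * σ * ‖z‖ + 12 * ‖e‖) := by gcongr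
    have h2 := mul_le_mul_of_nonneg_right hσ hz'.le
    linarith
  set c := Real.cos (angle x z) with hc
  have hxz : inner ℝ x z = c * (‖x‖ * ‖z‖) := (cos_angle_mul_norm_mul_norm x z).symm
  have hy2 : ‖y‖ ^ 2 = ‖z‖ ^ 2 * (1 - c ^ 2) := by
    rw [← hzy, hy, inner_sub_right, inner_smul_right, real_inner_self_eq_norm_sq,
      real_inner_comm x z, hxz]
    field_simp
  have hc1 : c ≤ 1 := Real.cos_le_one _
  have hc2 : -(1 / 2) ≤ c := by
    have h1 := Real.cos_le_cos_of_nonneg_of_le_pi (angle_nonneg x z)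
      (by linarith [Real.pi_pos]) hang.le
    have h6 : Real.cos (2 * Real.pi / 3) = -(1 / 2) := by
      rw [show 2 * Real.pi / 3 = Real.pi - Real.pi / 3 by ring, Real.cos_pi_sub,
        Real.cos_pi_div_three]
    linarith
  have hcc : 1 - c ^ 2 ≤ 0.0001 := by
    have h1 : ‖z‖ ^ 2 * (1 - c ^ 2) ≤ ‖z‖ ^ 2 * 0.0001 := by
      rw [← hy2]
      have : ‖y‖ ^ 2 ≤ (0.005 * ‖z‖) ^ 2 := by gcongr
      linarith [sq_nonneg ‖z‖]
    exact le_of_mul_le_mul_left h1 (by positivity)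
  have hc3 : 0.9 ≤ c := by
    by_contra hcon
    push Not at hcon
    nlinarith
  -- `(1 - c) ^ 2 ≤ 1 - c ^ 2` for `0 ≤ c ≤ 1`
  have hcy : (1 - c) * ‖z‖ ≤ ‖y‖ := by
    have h1 : ((1 - c) * ‖z‖) ^ 2 ≤ ‖y‖ ^ 2 := by
      rw [hy2, mul_pow, mul_comm]
      gcongr
      nlinarith
    exact (abs_le_of_sq_le_sq' h1 (norm_nonneg _)).2
  -- layers hardly decrease cosines, so the input angle controls the output angle
  have hlow : (c - 4 * t) * ‖z‖ - g ≤ ‖x‖ := by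
    have h1 := h.cos_layerAngle_ge hz hx (i := 0) (j := d) (by omega)
    have e0 : layerAngle n W z x 0 = angle x z := by simp [layerAngle, scaledNet_zero]
    rw [e0, zero_add, ← hc, mul_assoc, ← ht_def] at h1
    have h2 : (c - 4 * t) * ‖z‖ * ‖x‖ ≤ I := by
      rw [hI, WellDistributed.inner_scaledNet]
      calc (c - 4 * t) * ‖z‖ * ‖x‖ = (c - 4 * t) * (‖z‖ * ‖x‖) := by ring
        _ ≤ ((c - 2 * t) * (1 - t) ^ 2) * (‖z‖ * ‖x‖) := by
            gcongr
            have e : (c - 2 * t) * (1 - t) ^ 2 - (c - 4 * t) =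
              t * (2 * (1 - c) + t * (c + 4 - 2 * t)) := by ring
            have : 0 ≤ t * (2 * (1 - c) + t * (c + 4 - 2 * t)) :=
              mul_nonneg ht0 (add_nonneg (by linarith) (mul_nonneg ht0 (by linarith)))
            linarith
        _ = (c - 2 * t) * (((1 - t) * ‖x‖) * ((1 - t) * ‖z‖)) := by ring
        _ ≤ _ := by
            have h3 : 0 ≤ 1 - t := by linarith
            have h4 : 0 ≤ c - 2 * t := by linarith
            have h5 : 0 ≤ Real.cos (layerAngle n W z x d) := h4.trans h1
            gcongr
            · exact hpx.1
            · exact hpz.1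
    refine le_of_mul_le_mul_right ?_ hx'
    linarith
  have hfin : ‖x - z‖ ≤ |‖x‖ - c * ‖z‖| + ‖y‖ := by
    have e1 : x - z = ((‖x‖ - c * ‖z‖) / ‖x‖) • x - y := by
      rw [hy, hxz, sub_sub_eq_add_sub, ← add_smul]
      have : (‖x‖ - c * ‖z‖) / ‖x‖ + c * (‖x‖ * ‖z‖) / ‖x‖ ^ 2 = 1 := by field_simp; ring
      rw [this, one_smul]
    rw [e1]
    refine (norm_sub_le _ _).trans ?_
    rw [norm_smul, norm_div, norm_norm, Real.norm_eq_abs, div_mul_cancel₀ _ hx'.ne']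
  have habs : |‖x‖ - c * ‖z‖| ≤ g + 4 * t * ‖z‖ + ‖y‖ := by
    have : 0 ≤ t * ‖z‖ := by positivity
    rw [abs_le]
    constructor <;> linarith [norm_nonneg y]
  have h1 : g ≤ (d : ℝ) ^ 5 * g := le_mul_of_one_le_left hg0 hd5
  have h2 : (d : ℝ) ^ 5 * g ≤ (d : ℝ) ^ 5 * (4 * σ * ‖z‖ + 12 * ‖e‖) := by gcongr
  have h3 : t * ‖z‖ ≤ σ * ‖z‖ := by gcongr; linarith
  have h4 : σ * ‖z‖ ≤ (d : ℝ) ^ 5 * (σ * ‖z‖) := le_mul_of_one_le_left (by positivity) hd5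
  have h5 : 0 ≤ (d : ℝ) ^ 5 * (σ * ‖z‖) := by positivity
  have h6 : 0 ≤ (d : ℝ) ^ 5 * ‖e‖ := by positivity
  linarith

/-- The radial component of a step from a sign-flipped point: below `0.29 * ‖z‖` the norm grows by
a definite amount. -/
theorem RRIC.norm_step_ge (h : WellDistributed n W d η) (hA : RRIC A (scaledNet n W d) η)
    (he : ‖e‖ * (d : ℝ) ^ 6 ≤ 1 / 10 ^ 4 * ‖z‖) (hz : z ≠ 0) (hx : x ≠ 0)
    (hflip : scaledRisk n W d A z e x ≤ scaledRisk n W d A z e (-x))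
    {κ : ℝ} (hκ : 0 ≤ κ)
    (hv : ‖v - gradModel n W d z x‖ ≤ gradError d η z e x) (hxz : ‖x‖ ≤ 2 * ‖z‖) :
    ‖x‖ - κ * (‖x‖ - 0.29 * ‖z‖) ≤ ‖x - κ • v‖ := by
  have hx' := norm_pos_iff.mpr hx
  have h1 := hA.inner_ge_of_le_neg h he hz hx hxz hflip
  have h2 := h.gradError_le he x
  have h3 : inner ℝ v x ≤ ‖x‖ ^ 2 - 0.3 * ‖x‖ * ‖z‖ + gradError d η z e x * ‖x‖ := by
    have e1 : inner ℝ v x = inner ℝ (gradModel n W d z x) x +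
        inner ℝ (v - gradModel n W d z x) x := by rw [inner_sub_left]; ring
    rw [e1, inner_gradModel_self hx]
    have := (real_inner_le_norm (v - gradModel n W d z x) x).trans
      (mul_le_mul_of_nonneg_right hv hx'.le)
    linarith
  have h4 : inner ℝ v x ≤ (‖x‖ - 0.29 * ‖z‖) * ‖x‖ := by
    have : gradError d η z e x * ‖x‖ ≤ (0.01 * ‖z‖) * ‖x‖ := by gcongr; linarith
    nlinarith
  have h5 : inner ℝ (x - κ • v) x = ‖x‖ ^ 2 - κ * inner ℝ v x := by
    rw [inner_sub_left, real_inner_smul_left, real_inner_self_eq_norm_sq]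
  have h6 := real_inner_le_norm (x - κ • v) x
  refine le_of_mul_le_mul_right ?_ hx'
  have := mul_le_mul_of_nonneg_left h4 hκ
  nlinarith

/-- The complement of the ball of radius `0.1 * ‖z‖` is invariant. -/
theorem RRIC.norm_step_ge_of_ge (h : WellDistributed n W d η) (hA : RRIC A (scaledNet n W d) η)
    (he : ‖e‖ * (d : ℝ) ^ 6 ≤ 1 / 10 ^ 4 * ‖z‖) (hz : z ≠ 0)
    (hflip : scaledRisk n W d A z e x ≤ scaledRisk n W d A z e (-x))
    {κ : ℝ} (hκ : 0 ≤ κ) (hκ1 : κ ≤ 1 / 10 ^ 4)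
    (hv : ‖v - gradModel n W d z x‖ ≤ gradError d η z e x) (hxz : 0.1 * ‖z‖ ≤ ‖x‖) :
    0.1 * ‖z‖ ≤ ‖x - κ • v‖ := by
  have hz' := norm_pos_iff.mpr hz
  have hx : x ≠ 0 := norm_pos_iff.mp (by linarith)
  rcases le_total ‖x‖ (2 * ‖z‖) with h2 | h2
  · have := hA.norm_step_ge h he hz hx hflip hκ hv h2
    nlinarith
  · have h3 := h.norm_step_le he hx hv
    have h4 := norm_sub_norm_le x (κ • v)
    rw [norm_smul, Real.norm_of_nonneg hκ] at h4
    have : κ * ‖v‖ ≤ 1 / 10 ^ 4 * (2 * ‖x‖ + 5 * ‖z‖) := by gcongr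
    linarith

/-- No sign flip occurs near `z`: then `-x` points away from `z`, so its risk is larger. -/
theorem RRIC.lt_neg_of_near (h : WellDistributed n W d η) (hA : RRIC A (scaledNet n W d) η)
    (he : ‖e‖ * (d : ℝ) ^ 6 ≤ 1 / 10 ^ 4 * ‖z‖) (hz : z ≠ 0)
    (hx : ‖x - z‖ ≤ 1 / 10 ^ 6 * ‖z‖) :
    ‖z‖ ^ 2 * (1 / (32 * (d : ℝ) ^ 5)) ≤
      scaledRisk n W d A z e (-x) - scaledRisk n W d A z e x := by
  have hz' := norm_pos_iff.mpr hz
  have hd := h.one_le_cast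
  have h1 : ‖x‖ ≤ 2 * ‖z‖ := by
    have := norm_le_norm_add_norm_sub' x z; linarith
  have h2 : 0.9 * ‖z‖ ≤ ‖x‖ := by
    have := norm_le_norm_add_norm_sub x z; linarith
  have hx0 : x ≠ 0 := norm_pos_iff.mp (by linarith)
  have h3 : angle x z ≤ 1 := by
    refine (angle_le_pi_mul_norm_sub_div hx0 hz).trans ?_
    have : ‖x - z‖ / ‖z‖ ≤ 1 / 10 ^ 6 := by rwa [div_le_iff₀ hz']
    nlinarith [Real.pi_lt_d2, Real.pi_pos]
  have h4 := hA.scaledRisk_sub_neg_ge (e := e) h he hz (neg_ne_zero.mpr hx0)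
    (by rwa [norm_neg]) (by rw [angle_neg_left]; linarith [Real.pi_gt_three])
  rw [neg_neg, norm_neg] at h4
  refine le_trans ?_ h4
  have e1 : 1 / (32 * (d : ℝ) ^ 5) = 1 / 2 * (1 / (16 * (d : ℝ) ^ 5)) := by field_simp; norm_num
  have h5 : 0 < 1 / (16 * (d : ℝ) ^ 5) := by positivity
  rw [e1]
  have : ‖z‖ ^ 2 * (1 / 2) ≤ ‖x‖ * ‖z‖ := by nlinarith
  nlinarith

theorem norm_step_sub_le {κ μ : ℝ} (hκ : 0 ≤ κ) (hκ1 : κ ≤ 1)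
    (hv : ‖v - (x - z)‖ ≤ 1 / 16 * ‖x - z‖ + 1.1 * μ) :
    ‖x - κ • v - z‖ ≤ (1 - 15 / 16 * κ) * ‖x - z‖ + 1.1 * κ * μ := by
  have e1 : x - κ • v - z = (1 - κ) • (x - z) - κ • (v - (x - z)) := by module
  rw [e1]
  refine (norm_sub_le _ _).trans ?_
  rw [norm_smul, norm_smul, Real.norm_of_nonneg hκ, Real.norm_of_nonneg (by linarith)]
  have := mul_le_mul_of_nonneg_left hv hκ
  linarith

theorem RRIC.scaledRisk_ge_of_small (h : WellDistributed n W d η)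
    (hA : RRIC A (scaledNet n W d) η)
    (he : ‖e‖ * (d : ℝ) ^ 6 ≤ 1 / 10 ^ 4 * ‖z‖) (hx : ‖x‖ ≤ 0.1 * ‖z‖) :
    0.3 * ‖z‖ ^ 2 ≤ scaledRisk n W d A z e x := by
  have hμ := h.noise_le he
  have h1 := (abs_le.mp (hA x z x z)).1
  rw [real_inner_self_eq_norm_sq, real_inner_self_eq_norm_sq] at h1
  have h2 := h.norm_le le_rfl x
  have h3 := h.norm_ge le_rfl z
  have h4 := norm_sub_norm_le (scaledNet n W d z) (scaledNet n W d x)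
  rw [norm_sub_rev] at h4
  have hη1 := h.eta_le
  have hz0 := norm_nonneg z
  set b := ‖scaledNet n W d x - scaledNet n W d z‖
  have h5 : 0.88 * ‖z‖ ≤ b := by linarith
  set a := mulE A (scaledNet n W d x - scaledNet n W d z)
  have h6 : 0.87 * ‖z‖ ≤ ‖a‖ := by
    refine (abs_le_of_sq_le_sq' ?_ (norm_nonneg _)).2
    have h7 : (0.88 * ‖z‖) ^ 2 ≤ b ^ 2 := by gcongr
    have h8 : η * b ^ 2 ≤ 1 / 10 ^ 6 * b ^ 2 := by gcongr
    nlinarith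
  have h9 := norm_sub_norm_le a e
  have h10 : 0.8 * ‖z‖ ≤ ‖a - e‖ := by linarith
  have h11 : (0.8 * ‖z‖) ^ 2 ≤ ‖a - e‖ ^ 2 := by gcongr
  rw [scaledRisk_eq]
  nlinarith [sq_nonneg ‖z‖]

theorem RRIC.scaledRisk_le_of_small (h : WellDistributed n W d η)
    (hA : RRIC A (scaledNet n W d) η)
    (he : ‖e‖ * (d : ℝ) ^ 6 ≤ 1 / 10 ^ 4 * ‖z‖) (hx : ‖x‖ ≤ 0.2 * ‖z‖) :
    scaledRisk n W d A z e x ≤ ‖z‖ ^ 2 := by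
  have hμ := h.noise_le he
  have h1 := hA.norm_mulE_le (by linarith [h.eta_le]) x z
  have h2 := h.norm_sub_le' le_rfl x z
  have h3 := norm_sub_le x z
  have h4 := norm_sub_le (mulE A (scaledNet n W d x - scaledNet n W d z)) e
  have hz0 := norm_nonneg z
  have h5 : ‖mulE A (scaledNet n W d x - scaledNet n W d z) - e‖ ≤ 1.3 * ‖z‖ := by linarith
  have h6 : ‖mulE A (scaledNet n W d x - scaledNet n W d z) - e‖ ^ 2 ≤ (1.3 * ‖z‖) ^ 2 := by
    gcongr
  rw [scaledRisk_eq]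
  nlinarith [sq_nonneg ‖z‖]

end Step

/-! ### Iterates of the rescaled method -/

section Run

variable {n : ℕ → ℕ} {W : (i : ℕ) → Matrix (Fin (n (i + 1))) (Fin (n i)) ℝ} {d m : ℕ} {η κ : ℝ}
  {A : Matrix (Fin m) (Fin (n d)) ℝ} {e : EuclideanSpace ℝ (Fin m)}
  {z : EuclideanSpace ℝ (Fin (n 0))} {x y g : ℕ → EuclideanSpace ℝ (Fin (n 0))}

/-- A run of the rescaled method: `x i` are the iterates, `y i` the sign-flipped iterates, and `g
i` the rescaled subgradients at `y i`, which enter only through their distance to `gradModel` and,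
near `z`, to `y i - z`. -/
structure IsScaledRun (W : (i : ℕ) → Matrix (Fin (n (i + 1))) (Fin (n i)) ℝ) (η : ℝ)
    (A : Matrix (Fin m) (Fin (n d)) ℝ) (e : EuclideanSpace ℝ (Fin m))
    (z : EuclideanSpace ℝ (Fin (n 0))) (κ : ℝ)
    (x y g : ℕ → EuclideanSpace ℝ (Fin (n 0))) : Prop where
  wellDistributed : WellDistributed n W d η
  rric : RRIC A (scaledNet n W d) η
  noise : ‖e‖ * (d : ℝ) ^ 6 ≤ 1 / 10 ^ 4 * ‖z‖
  target_ne : z ≠ 0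
  step_pos : 0 < κ
  step_le : κ * d ≤ 1 / 10 ^ 4
  zero_ne : x 0 ≠ 0
  step : ∀ i, x (i + 1) = y i - κ • g i
  flip : ∀ i, y i = x i ∨
    (y i = -x i ∧ scaledRisk n W d A z e (-x i) < scaledRisk n W d A z e (x i))
  flip_le : ∀ i, scaledRisk n W d A z e (y i) ≤ scaledRisk n W d A z e (-y i)
  grad : ∀ i, y i ≠ 0 → ‖g i - gradModel n W d z (y i)‖ ≤ gradError d η z e (y i)
  near : ∀ i, ‖y i - z‖ < 1 / (10 ^ 6 * d ^ 2) * ‖z‖ →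
    ‖g i - (y i - z)‖ ≤ 1 / 16 * ‖y i - z‖ + 1.1 * ‖e‖

namespace IsScaledRun

theorem norm_eq (h : IsScaledRun W η A e z κ x y g) (i : ℕ) : ‖y i‖ = ‖x i‖ := by
  rcases h.flip i with h1 | h1
  · rw [h1]
  · rw [h1.1, norm_neg]

theorem risk_le (h : IsScaledRun W η A e z κ x y g) (i : ℕ) :
    scaledRisk n W d A z e (y i) ≤ scaledRisk n W d A z e (x i) := by
  rcases h.flip i with h1 | h1
  · rw [h1]
  · rw [h1.1]; exact h1.2.le

theorem step_le_one (h : IsScaledRun W η A e z κ x y g) : κ ≤ 1 / 10 ^ 4 :=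
  le_trans (le_mul_of_one_le_right h.step_pos.le h.wellDistributed.one_le_cast) h.step_le

theorem target_pos (h : IsScaledRun W η A e z κ x y g) : 0 < ‖z‖ := norm_pos_iff.mpr h.target_ne

theorem norm_succ_ge (h : IsScaledRun W η A e z κ x y g) {i : ℕ} (hi : x i ≠ 0)
    (hxz : ‖x i‖ ≤ 2 * ‖z‖) : ‖x i‖ - κ * (‖x i‖ - 0.29 * ‖z‖) ≤ ‖x (i + 1)‖ := by
  have hy : y i ≠ 0 := by
    rw [← norm_ne_zero_iff, h.norm_eq]; exact norm_ne_zero_iff.mpr hi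
  rw [h.step, ← h.norm_eq]
  exact h.rric.norm_step_ge h.wellDistributed h.noise h.target_ne hy (h.flip_le i) h.step_pos.le
    (h.grad i hy) (by rwa [h.norm_eq])

theorem ge_succ (h : IsScaledRun W η A e z κ x y g) {i : ℕ} (hi : 0.1 * ‖z‖ ≤ ‖x i‖) :
    0.1 * ‖z‖ ≤ ‖x (i + 1)‖ := by
  have hz := h.target_pos
  have hy : y i ≠ 0 := by
    rw [← norm_pos_iff, h.norm_eq]; linarith
  rw [h.step]
  exact h.rric.norm_step_ge_of_ge h.wellDistributed h.noise h.target_ne (h.flip_le i)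
    h.step_pos.le h.step_le_one (h.grad i hy) (by rwa [h.norm_eq])

theorem ge_add (h : IsScaledRun W η A e z κ x y g) {i : ℕ} (hi : 0.1 * ‖z‖ ≤ ‖x i‖) (j : ℕ) :
    0.1 * ‖z‖ ≤ ‖x (i + j)‖ := by
  induction j with
  | zero => exact hi
  | succ j ih => exact h.ge_succ ih

theorem ne_zero (h : IsScaledRun W η A e z κ x y g) (i : ℕ) : x i ≠ 0 := by
  have hz := h.target_pos
  have hκ := h.step_le_one
  have hκ0 := h.step_pos
  induction i with
  | zero => exact h.zero_ne
  | succ i ih =>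
    have hx := norm_pos_iff.mpr ih
    rcases le_total ‖x i‖ (2 * ‖z‖) with h1 | h1
    · have := h.norm_succ_ge ih h1
      exact norm_pos_iff.mp (by nlinarith)
    · have := h.ge_succ (i := i) (by linarith)
      exact norm_pos_iff.mp (by linarith)

/-- As long as the iterates stay in the ball of radius `0.1 * ‖z‖`, their norm grows at least
linearly. -/
theorem exists_ge_or_growth (h : IsScaledRun W η A e z κ x y g) (j : ℕ) :
    (∃ i ≤ j, 0.1 * ‖z‖ ≤ ‖x i‖) ∨ 0.1 * κ * j * ‖z‖ ≤ ‖x j‖ := by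
  have hz := h.target_pos
  have hκ0 := h.step_pos
  induction j with
  | zero => right; simp
  | succ j ih =>
    rcases ih with ⟨i, hi, hi'⟩ | ih
    · exact Or.inl ⟨i, by omega, hi'⟩
    by_cases hj : 0.1 * ‖z‖ ≤ ‖x j‖
    · exact Or.inl ⟨j, by omega, hj⟩
    push Not at hj
    right
    have h1 := h.norm_succ_ge (h.ne_zero j) (by linarith)
    have h2 : κ * (‖x j‖ - 0.29 * ‖z‖) ≤ κ * (-(0.1 * ‖z‖)) := by gcongr; linarith
    push_cast
    linarith

/-- Some iterate leaves the ball of radius `0.1 * ‖z‖`. If it is not the initial one, it is reached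
after at most `2 / κ` steps, and the risks at the two iterates are comparable: small iterates have
risk at least `0.3 * ‖z‖ ^ 2`, and the first iterate outside is still small enough to have risk at
most `‖z‖ ^ 2`. -/
theorem exists_escape (h : IsScaledRun W η A e z κ x y g) :
    ∃ M : ℕ, 0.1 * ‖z‖ ≤ ‖x M‖ ∧ (M = 0 ∨ ((M : ℝ) * κ ≤ 2 ∧
      0.3 * ‖z‖ ^ 2 ≤ scaledRisk n W d A z e (x 0) ∧
      scaledRisk n W d A z e (x M) ≤ ‖z‖ ^ 2)) := by
  classical
  have hz := h.target_pos
  have hκ0 := h.step_pos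
  have hκ1 := h.step_le_one
  obtain ⟨j, hj, hj'⟩ : ∃ i ≤ ⌈1 / κ⌉₊, 0.1 * ‖z‖ ≤ ‖x i‖ := by
    rcases h.exists_ge_or_growth ⌈1 / κ⌉₊ with h1 | h1
    · exact h1
    · refine ⟨_, le_rfl, le_trans ?_ h1⟩
      have h2 := Nat.le_ceil (1 / κ)
      rw [div_le_iff₀ hκ0] at h2
      nlinarith
  have hex : ∃ i, 0.1 * ‖z‖ ≤ ‖x i‖ := ⟨j, hj'⟩
  refine ⟨Nat.find hex, Nat.find_spec hex, ?_⟩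
  rcases Nat.eq_zero_or_pos (Nat.find hex) with h0 | h0
  · exact Or.inl h0
  right
  have hsmall : ∀ i < Nat.find hex, ‖x i‖ < 0.1 * ‖z‖ := fun i hi =>
    not_le.mp (Nat.find_min hex hi)
  refine ⟨?_, ?_, ?_⟩
  · have h1 : Nat.find hex ≤ ⌈1 / κ⌉₊ := (Nat.find_min' hex hj').trans hj
    have h2 : (Nat.find hex : ℝ) ≤ ⌈1 / κ⌉₊ := by exact_mod_cast h1
    have h3 := Nat.ceil_lt_add_one (by positivity : 0 ≤ 1 / κ)
    calc (Nat.find hex : ℝ) * κ ≤ (1 / κ + 1) * κ := by gcongr; linarith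
      _ = 1 + κ := by field_simp
      _ ≤ 2 := by linarith
  · exact h.rric.scaledRisk_ge_of_small h.wellDistributed h.noise (hsmall 0 h0).le
  · refine h.rric.scaledRisk_le_of_small h.wellDistributed h.noise ?_
    obtain ⟨k, hk⟩ := Nat.exists_eq_succ_of_ne_zero h0.ne'
    have h1 := hsmall k (by omega)
    rw [← h.norm_eq] at h1
    have hy : y k ≠ 0 := by
      rw [← norm_ne_zero_iff, h.norm_eq]; exact norm_ne_zero_iff.mpr (h.ne_zero k)
    have h2 := h.wellDistributed.norm_step_le h.noise hy (h.grad k hy)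
    rw [hk, Nat.succ_eq_add_one, h.step]
    have h3 := norm_sub_le (y k) (κ • g k)
    rw [norm_smul, Real.norm_of_nonneg hκ0.le] at h3
    have : κ * ‖g k‖ ≤ 1 / 10 ^ 4 * (2 * ‖y k‖ + 5 * ‖z‖) := by gcongr
    linarith

theorem eight_mul_gradError_le {σ : ℝ} (hησ : 48 * (d ^ 2 * η) ≤ σ)
    (w : EuclideanSpace ℝ (Fin (n 0))) :
    8 * gradError d η z e w ≤ σ * (‖w‖ + ‖z‖) + 10 * ‖e‖ := by
  have h1 : 48 * (d ^ 2 * η) * (‖w‖ + ‖z‖) ≤ σ * (‖w‖ + ‖z‖) := by gcongr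
  rw [gradError]
  linarith [norm_nonneg e]

theorem descent (h : IsScaledRun W η A e z κ x y g) {σ : ℝ} (hσ : 0 ≤ σ)
    (hησ : 48 * (d ^ 2 * η) ≤ σ) {i : ℕ} (hi : 0.1 * ‖z‖ ≤ ‖x i‖)
    (hbig : σ * (‖y i‖ + ‖z‖) + 10 * ‖e‖ < ‖g i‖) :
    scaledRisk n W d A z e (x (i + 1)) ≤
      scaledRisk n W d A z e (x i) - κ / 2 * σ ^ 2 * ‖z‖ ^ 2 := by
  have hz := h.target_pos
  have hκ0 := h.step_pos
  rw [← h.norm_eq] at hi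
  have hy : y i ≠ 0 := norm_pos_iff.mp (by linarith)
  have h1 := h.rric.scaledRisk_step_le h.wellDistributed h.noise h.target_ne hi hκ0.le
    h.step_le (h.grad i hy) ((eight_mul_gradError_le hησ (y i)).trans hbig.le)
  rw [← h.step] at h1
  have h2 := h.risk_le i
  have h3 : σ * ‖z‖ ≤ ‖g i‖ := by
    have : 0 ≤ σ * ‖y i‖ := by positivity
    linarith [norm_nonneg e]
  have h4 : κ / 2 * (σ * ‖z‖) ^ 2 ≤ κ / 2 * ‖g i‖ ^ 2 := by gcongr
  linarith

theorem scaledRisk_nonneg (w : EuclideanSpace ℝ (Fin (n 0))) : 0 ≤ scaledRisk n W d A z e w := by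
  unfold scaledRisk empRisk; positivity

/-- Since the risk is nonnegative, the decrease per step bounds the waiting time for a small
subgradient. -/
theorem exists_small_gradient (h : IsScaledRun W η A e z κ x y g) {σ : ℝ} (hσ : 0 < σ)
    (hησ : 48 * (d ^ 2 * η) ≤ σ) {M : ℕ} (hM : 0.1 * ‖z‖ ≤ ‖x M‖) :
    ∃ j : ℕ, ‖g (M + j)‖ ≤ σ * (‖y (M + j)‖ + ‖z‖) + 10 * ‖e‖ ∧
      j * (κ / 2 * σ ^ 2 * ‖z‖ ^ 2) ≤ scaledRisk n W d A z e (x M) := by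
  classical
  have hz := h.target_pos
  have hκ0 := h.step_pos
  have key : ∀ J : ℕ, (∀ j < J, σ * (‖y (M + j)‖ + ‖z‖) + 10 * ‖e‖ < ‖g (M + j)‖) →
      J * (κ / 2 * σ ^ 2 * ‖z‖ ^ 2) ≤ scaledRisk n W d A z e (x M) -
        scaledRisk n W d A z e (x (M + J)) := by
    intro J
    induction J with
    | zero => intro _; simp
    | succ J ih =>
      intro hJ
      have h1 := ih fun j hj => hJ j (by omega)
      have h2 := h.descent hσ.le hησ (h.ge_add hM J) (hJ J (by omega))
      rw [← add_assoc]
      push_cast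
      linarith
  have hpos : 0 < κ / 2 * σ ^ 2 * ‖z‖ ^ 2 := by positivity
  have hex : ∃ j, ‖g (M + j)‖ ≤ σ * (‖y (M + j)‖ + ‖z‖) + 10 * ‖e‖ := by
    by_contra hcon
    push Not at hcon
    obtain ⟨J, hJ⟩ := exists_nat_gt (scaledRisk n W d A z e (x M) / (κ / 2 * σ ^ 2 * ‖z‖ ^ 2))
    rw [div_lt_iff₀ hpos] at hJ
    have h1 := key J fun j _ => hcon j
    have h2 := scaledRisk_nonneg (W := W) (A := A) (e := e) (z := z) (x (M + J))
    linarith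
  refine ⟨Nat.find hex, Nat.find_spec hex, ?_⟩
  have h1 := key (Nat.find hex) fun j hj => not_le.mp (Nat.find_min hex hj)
  have h2 := scaledRisk_nonneg (W := W) (A := A) (e := e) (z := z) (x (M + Nat.find hex))
  linarith

theorem near_le (h : IsScaledRun W η A e z κ x y g) :
    1 / (10 ^ 6 * (d : ℝ) ^ 2) * ‖z‖ ≤ 1 / 10 ^ 6 * ‖z‖ := by
  have hd := h.wellDistributed.one_le_cast
  gcongr
  nlinarith

theorem flip_eq_of_near (h : IsScaledRun W η A e z κ x y g) {i : ℕ}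
    (hi : ‖x i - z‖ ≤ 1 / 10 ^ 6 * ‖z‖) : y i = x i := by
  rcases h.flip i with h1 | h1
  · exact h1
  · have h2 := h.rric.lt_neg_of_near h.wellDistributed h.noise h.target_ne hi
    have hd := h.wellDistributed.one_le_cast
    have : 0 ≤ ‖z‖ ^ 2 * (1 / (32 * (d : ℝ) ^ 5)) := by positivity
    linarith [h1.2]

theorem contraction (h : IsScaledRun W η A e z κ x y g) {i : ℕ}
    (hi : ‖y i - z‖ < 1 / (10 ^ 6 * d ^ 2) * ‖z‖) :
    ‖x (i + 1) - z‖ ≤ (1 - 15 / 16 * κ) * ‖y i - z‖ + 1.1 * κ * ‖e‖ := by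
  rw [h.step]
  exact norm_step_sub_le h.step_pos.le (by linarith [h.step_le_one]) (h.near i hi)

/-- Linear convergence near `z`. The noise adds up to at most `2 * ‖e‖`, since each step
contributes `1.1 * κ * ‖e‖`, less than `2 * (7/8) * κ * ‖e‖`. -/
theorem local_convergence (h : IsScaledRun W η A e z κ x y g) {N : ℕ}
    (hN : ‖x N - z‖ + 2 * ‖e‖ < 1 / (10 ^ 6 * d ^ 2) * ‖z‖) (j : ℕ) :
    ‖x (N + j) - z‖ ≤ (1 - κ * (7 / 8)) ^ j * ‖x N - z‖ + 2 * ‖e‖ := by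
  have hκ0 := h.step_pos
  have hκ1 := h.step_le_one
  have he := norm_nonneg e
  induction j with
  | zero => simp
  | succ j ih =>
    have hpow : (1 - κ * (7 / 8)) ^ j ≤ 1 := pow_le_one₀ (by linarith) (by linarith)
    have h1 : (1 - κ * (7 / 8)) ^ j * ‖x N - z‖ ≤ ‖x N - z‖ :=
      mul_le_of_le_one_left (norm_nonneg _) hpow
    have h2 : ‖x (N + j) - z‖ < 1 / (10 ^ 6 * d ^ 2) * ‖z‖ := by linarith
    have hy := h.flip_eq_of_near (h2.le.trans h.near_le)
    have h3 := h.contraction (i := N + j) (by rwa [hy])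
    rw [hy] at h3
    have h4 : (1 - 15 / 16 * κ) * ‖x (N + j) - z‖ ≤
        (1 - κ * (7 / 8)) * ((1 - κ * (7 / 8)) ^ j * ‖x N - z‖ + 2 * ‖e‖) := by
      refine mul_le_mul ?_ ih (norm_nonneg _) (by linarith)
      linarith
    rw [← add_assoc, pow_succ']
    have h5 : 0 ≤ κ * ‖e‖ := by positivity
    linarith

/-- The iterates come within `100 d⁵ (σ ‖z‖ + ‖e‖)` of `z`, after a number of steps controlled by
the initial risk. -/
theorem exists_entry (h : IsScaledRun W η A e z κ x y g) {σ : ℝ} (hσ : 0 < σ)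
    (hησ : 48 * (d ^ 2 * η) ≤ σ) (hσd : σ * (d : ℝ) ^ 5 ≤ 1 / 10 ^ 4)
    (hρ : 100 * (d : ℝ) ^ 5 * (σ * ‖z‖ + ‖e‖) < 1 / (10 ^ 6 * d ^ 2) * ‖z‖) :
    ∃ N : ℕ, ‖x N - z‖ ≤ 100 * (d : ℝ) ^ 5 * (σ * ‖z‖ + ‖e‖) ∧
      N * (κ / 2 * σ ^ 2 * ‖z‖ ^ 2) ≤ 6 * scaledRisk n W d A z e (x 0) := by
  have hz := h.target_pos
  have hκ0 := h.step_pos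
  have hκ1 := h.step_le_one
  have hd := h.wellDistributed.one_le_cast
  have hd5 : 1 ≤ (d : ℝ) ^ 5 := one_le_pow₀ hd
  have hF0 := scaledRisk_nonneg (W := W) (A := A) (e := e) (z := z) (x 0)
  have he := norm_nonneg e
  set ρ := 100 * (d : ℝ) ^ 5 * (σ * ‖z‖ + ‖e‖) with hρ_def
  by_cases hx0 : ‖x 0 - z‖ ≤ ρ
  · exact ⟨0, hx0, by simpa using hF0⟩
  obtain ⟨M, hM, hM'⟩ := h.exists_escape
  obtain ⟨j, hj, hj'⟩ := h.exists_small_gradient hσ hησ hM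
  have hy0 : y (M + j) ≠ 0 := by
    rw [← norm_ne_zero_iff, h.norm_eq]; exact norm_ne_zero_iff.mpr (h.ne_zero _)
  have hyρ : ‖y (M + j) - z‖ ≤ ρ :=
    h.rric.norm_sub_le_of_norm_le h.wellDistributed h.noise h.target_ne hy0 (h.flip_le _) hσ.le
      hησ hσd (h.grad _ hy0) hj
  have hρe : 2 * ‖e‖ ≤ ρ := by
    rw [hρ_def]
    have h1 : 1 * ‖e‖ ≤ (d : ℝ) ^ 5 * ‖e‖ := by gcongr
    have h2 : 0 ≤ (d : ℝ) ^ 5 * (σ * ‖z‖) := by positivity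
    linarith
  -- the flipped iterate `y (M + j)` is close to `z`, but `x (M + j)` need not be;
  -- one further step produces an iterate that is
  refine ⟨M + j + 1, ?_, ?_⟩
  · have h1 := h.contraction (hyρ.trans_lt hρ)
    have h2 : (1 - 15 / 16 * κ) * ‖y (M + j) - z‖ ≤ (1 - 15 / 16 * κ) * ρ := by
      gcongr; linarith
    have h3 : κ * (2 * ‖e‖) ≤ κ * ρ := by gcongr
    nlinarith
  · set τ := κ / 2 * σ ^ 2 * ‖z‖ ^ 2 with hτ
    have hτ0 : 0 < τ := by positivity
    have hσ1 : σ ≤ 1 / 10 ^ 4 := le_trans (le_mul_of_one_le_right hσ.le hd5) hσd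
    have hσ2 : σ ^ 2 ≤ 0.3 := by nlinarith
    push_cast
    rcases hM' with rfl | ⟨hMκ, hF, hFM⟩
    · have h1τ : τ ≤ scaledRisk n W d A z e (x 0) := by
        rcases Nat.eq_zero_or_pos j with rfl | hj0
        · -- the first iterate is flipped into the basin of `z`, so its risk is bounded below
          have hyx : y 0 = -x 0 ∧ _ := (h.flip 0).resolve_left fun h0 => hx0 (by
            rw [← h0]; exact hyρ)
          have h2 := h.rric.lt_neg_of_near h.wellDistributed h.noise h.target_ne
            (hyρ.trans (hρ.le.trans h.near_le))
          rw [add_zero, hyx.1, neg_neg] at h2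
          have h3 := scaledRisk_nonneg (W := W) (A := A) (e := e) (z := z) (-x 0)
          have h4 : τ ≤ ‖z‖ ^ 2 * (1 / (32 * (d : ℝ) ^ 5)) := by
            rw [hτ, mul_comm]
            gcongr
            rw [le_div_iff₀ (by positivity)]
            have h5 : κ / 2 * σ * (32 * (σ * (d : ℝ) ^ 5)) ≤
              (1 / 10 ^ 4) / 2 * (1 / 10 ^ 4) * (32 * (1 / 10 ^ 4)) := by gcongr
            nlinarith
          linarith
        · have : (1 : ℝ) ≤ j := by exact_mod_cast hj0
          nlinarith
      simp only [Nat.cast_zero, zero_add]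
      nlinarith
    · have h1 : M * τ ≤ scaledRisk n W d A z e (x 0) := by
        have h2 : M * τ = (M * κ) * (σ ^ 2 * ‖z‖ ^ 2 / 2) := by rw [hτ]; ring
        have h3 : (M * κ) * (σ ^ 2 * ‖z‖ ^ 2 / 2) ≤ 2 * (0.3 * ‖z‖ ^ 2 / 2) := by gcongr
        linarith
      have h4 : τ ≤ scaledRisk n W d A z e (x 0) := by
        have h5 : κ / 2 * σ ^ 2 * ‖z‖ ^ 2 ≤ 1 * 0.3 * ‖z‖ ^ 2 := by gcongr; linarith
        linarith
      nlinarith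

end IsScaledRun

end Run

/-! ### Removing the rescaling -/

section Scaling

variable {n : ℕ → ℕ} {W : (i : ℕ) → Matrix (Fin (n (i + 1))) (Fin (n i)) ℝ} {d m : ℕ} {ε : ℝ}
  {A : Matrix (Fin m) (Fin (n d)) ℝ} {e : EuclideanSpace ℝ (Fin m)}
  {z : EuclideanSpace ℝ (Fin (n 0))}

theorem sqrt_two_pow_mul_self (d : ℕ) : √2 ^ d * √2 ^ d = (2 : ℝ) ^ d := by
  rw [← mul_pow, Real.mul_self_sqrt (by norm_num)]

theorem two_rpow_half (d : ℕ) : (2 : ℝ) ^ ((d : ℝ) / 2) = √2 ^ d := by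
  rw [Real.sqrt_eq_rpow, ← Real.rpow_natCast, ← Real.rpow_mul (by norm_num)]
  congr 1
  ring

theorem RRIC.scaled (hA : RRIC A (net n W d) ε) {η : ℝ} (hεη : ε ≤ η) :
    RRIC A (scaledNet n W d) η := by
  intro x₁ x₂ x₃ x₄
  have h1 := hA x₁ x₂ x₃ x₄
  have hs : 0 ≤ √2 ^ d := by positivity
  simp only [scaledNet, ← smul_sub, mulE_smul, real_inner_smul_left, inner_smul_right, norm_smul,
    Real.norm_of_nonneg hs]
  set a := net n W d x₁ - net n W d x₂
  set b := net n W d x₃ - net n W d x₄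
  rw [← mul_sub, ← mul_sub, abs_mul, abs_mul, abs_of_nonneg hs]
  have h2 : ε * ‖a‖ * ‖b‖ ≤ η * ‖a‖ * ‖b‖ := by gcongr
  calc √2 ^ d * (√2 ^ d * |inner ℝ (mulE A a) (mulE A b) - inner ℝ a b|)
      ≤ √2 ^ d * (√2 ^ d * (η * ‖a‖ * ‖b‖)) := by gcongr; exact h1.trans h2
    _ = _ := by ring

theorem empRisk_net_eq (x : EuclideanSpace ℝ (Fin (n 0))) :
    empRisk A (net n W d) (mulE A (net n W d z) + e) x =
      ((2 : ℝ) ^ d)⁻¹ * scaledRisk n W d A z (√2 ^ d • e) x := by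
  have hs : 0 ≤ √2 ^ d := by positivity
  have h2 := sqrt_two_pow_mul_self d
  have e1 : mulE A (√2 ^ d • net n W d x) - (mulE A (√2 ^ d • net n W d z) + √2 ^ d • e) =
      √2 ^ d • (mulE A (net n W d x) - (mulE A (net n W d z) + e)) := by
    rw [mulE_smul, mulE_smul]; module
  simp only [scaledRisk, empRisk, scaledNet]
  rw [e1, norm_smul, mul_pow, Real.norm_of_nonneg hs, sq (√2 ^ d), h2]
  field_simp

theorem signFlip_const_mul {E : Type*} [NormedAddCommGroup E] {F : E → ℝ} {c : ℝ} (hc : 0 < c)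
    (x : E) : signFlip (fun x => c * F x) x = signFlip F x := by
  simp only [signFlip, mul_lt_mul_iff_right₀ hc]

theorem signFlip_eq_or {E : Type*} [NormedAddCommGroup E] (F : E → ℝ) (x : E) :
    signFlip F x = x ∨ (signFlip F x = -x ∧ F (-x) < F x) := by
  unfold signFlip
  split_ifs with h
  · exact Or.inr ⟨rfl, h⟩
  · exact Or.inl rfl

theorem apply_signFlip_le {E : Type*} [NormedAddCommGroup E] (F : E → ℝ) (x : E) :
    F (signFlip F x) ≤ F (-signFlip F x) := by
  unfold signFlip
  split_ifs with h
  · rw [neg_neg]; exact h.le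
  · exact not_lt.mp h

/-- Iterates of the method for the network are iterates for the rescaled one: the same points, with
subgradients multiplied by `2 ^ d`. -/
theorem IsSubgradientRun.exists_isScaledRun {η κ : ℝ} {x : ℕ → EuclideanSpace ℝ (Fin (n 0))}
    (h : WellDistributed n W d η) (hA : RRIC A (scaledNet n W d) η) (hz : z ≠ 0)
    (he : ‖√2 ^ d • e‖ * (d : ℝ) ^ 6 ≤ 1 / 10 ^ 4 * ‖z‖) (hκ : 0 < κ)
    (hκd : κ * d ≤ 1 / 10 ^ 4)
    (hrun : IsSubgradientRun (empRisk A (net n W d) (mulE A (net n W d z) + e)) (κ * 2 ^ d) x) :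
    ∃ y g, IsScaledRun W η A (√2 ^ d • e) z κ x y g := by
  have hf : empRisk A (net n W d) (mulE A (net n W d z) + e) =
      fun x => ((2 : ℝ) ^ d)⁻¹ * scaledRisk n W d A z (√2 ^ d • e) x :=
    funext empRisk_net_eq
  have hc : 0 < ((2 : ℝ) ^ d)⁻¹ := by positivity
  rw [hf] at hrun
  obtain ⟨h0, hstep⟩ := hrun
  choose v hv hxv using hstep
  simp only [signFlip_const_mul hc] at hv hxv
  refine ⟨fun i => signFlip (scaledRisk n W d A z (√2 ^ d • e)) (x i),
    fun i => (((2 : ℝ) ^ d)⁻¹)⁻¹ • v i, ?_⟩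
  exact {
    wellDistributed := h
    rric := hA
    noise := he
    target_ne := hz
    step_pos := hκ
    step_le := hκd
    zero_ne := h0
    step := fun i => by rw [hxv i, inv_inv, smul_smul]
    flip := fun i => signFlip_eq_or _ _
    flip_le := fun i => apply_signFlip_le _ _
    grad := fun i hi => hA.norm_sub_gradModel_le h hz hi hc (hv i)
    near := fun i hi => hA.norm_sub_near_le h hz hi hc (hv i) }

end Scaling

end

theorem theorem1 :
    ∃ K₁ K₂ K₃ K₄ K₅ K₆ K₇ : ℝ,
      0 < K₁ ∧ 0 < K₂ ∧ 0 < K₃ ∧ 0 < K₄ ∧ 0 < K₅ ∧ 0 < K₆ ∧ 0 < K₇ ∧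
      ∀ (d m : ℕ) (n : ℕ → ℕ) (W : (i : ℕ) → Matrix (Fin (n (i + 1))) (Fin (n i)) ℝ)
        (A : Matrix (Fin m) (Fin (n d)) ℝ)
        (xs : EuclideanSpace ℝ (Fin (n 0))) (e : EuclideanSpace ℝ (Fin m)) (ε ν C : ℝ)
        (G : EuclideanSpace ℝ (Fin (n 0)) → EuclideanSpace ℝ (Fin (n d)))
        (f : EuclideanSpace ℝ (Fin (n 0)) → ℝ) (x : ℕ → EuclideanSpace ℝ (Fin (n 0))),
        1 ≤ d →
        xs ≠ 0 →
        G = net n W d →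
        f = empRisk A G (mulE A (G xs) + e) →
        ν = K₃ * 2 ^ d / (d : ℝ) ^ 2 →
        C = 1 - ν / 2 ^ d * (7 / 8) →
        0 < ε →
        ε ≤ K₁ / (d : ℝ) ^ 90 →
        (∀ i < d, WDC (W i) ε) →
        RRIC A G ε →
        ‖e‖ ≤ K₂ * ‖xs‖ / ((d : ℝ) ^ 42 * (2 : ℝ) ^ ((d : ℝ) / 2)) →
        IsSubgradientRun f ν x →
        (0 < C ∧ C < 1) ∧
        ∃ N : ℕ,
          (N : ℝ) ≤ K₄ * f (x 0) * 2 ^ d / ((d : ℝ) ^ 4 * ε * ‖xs‖ ^ 2) ∧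
          ‖x N - xs‖ ≤ K₅ * (d : ℝ) ^ 9 * ‖xs‖ * √ε
            + K₆ * (d : ℝ) ^ 6 * (2 : ℝ) ^ ((d : ℝ) / 2) * ‖e‖ ∧
          ∀ i : ℕ, N ≤ i →
            ‖x (i + 1) - xs‖ ≤ C ^ (i + 1 - N) * ‖x N - xs‖
              + K₇ * (2 : ℝ) ^ ((d : ℝ) / 2) * ‖e‖ ∧
            ‖G (x (i + 1)) - G xs‖ ≤
              1.2 / (2 : ℝ) ^ ((d : ℝ) / 2) * C ^ (i + 1 - N) * ‖x N - xs‖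
                + 1.2 * K₇ * ‖e‖ := by
  refine ⟨1 / 10 ^ 18, 1 / 10 ^ 9, 1 / 10 ^ 4, 120000, 100, 100, 2, by norm_num, by norm_num,
    by norm_num, by norm_num, by norm_num, by norm_num, by norm_num, ?_⟩
  intro d m n W A xs e ε ν C G f x hd hxs hG hf hν hC hε hε1 hW hA he hrun
  subst hG hf
  have hd1 : (1 : ℝ) ≤ d := by exact_mod_cast hd
  have hz : 0 < ‖xs‖ := norm_pos_iff.mpr hxs
  set κ : ℝ := 1 / 10 ^ 4 / (d : ℝ) ^ 2 with hκ
  have hκ0 : 0 < κ := by positivity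
  have hκd : κ * d ≤ 1 / 10 ^ 4 := by
    rw [hκ, div_mul_eq_mul_div, div_le_iff₀ (by positivity)]
    gcongr
    nlinarith
  have hκ1 : κ ≤ 1 / 10 ^ 4 := le_trans (le_mul_of_one_le_right hκ0.le hd1) hκd
  have hνκ : ν = κ * 2 ^ d := by rw [hν, hκ]; ring
  have hCκ : C = 1 - κ * (7 / 8) := by
    rw [hC, hνκ, mul_div_assoc, div_self (by positivity), mul_one]
  -- `r = √ε` is at most `10⁻⁹ / d⁴⁵`
  set r := √ε with hr
  have hr0 : 0 < r := Real.sqrt_pos.mpr hε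
  have hrε : r ^ 2 = ε := Real.sq_sqrt hε.le
  have hr45 : r * (d : ℝ) ^ 45 ≤ 1 / 10 ^ 9 := by
    refine (abs_le_of_sq_le_sq' ?_ (by norm_num)).2
    rw [mul_pow, hrε, ← pow_mul]
    rw [le_div_iff₀ (by positivity)] at hε1
    norm_num at hε1 ⊢
    exact hε1
  have hrk : ∀ k ≤ 45, r * (d : ℝ) ^ k ≤ 1 / 10 ^ 9 := fun k hk =>
    le_trans (mul_le_mul_of_nonneg_left (pow_le_pow_right₀ hd1 hk) hr0.le) hr45
  have hη : 2 * ε * (d : ℝ) ^ 6 ≤ 1 / 10 ^ 6 := by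
    have h1 := hrk 3 (by norm_num)
    have h2 : (r * (d : ℝ) ^ 3) ^ 2 ≤ (1 / 10 ^ 9) ^ 2 := by gcongr
    have e1 : 2 * ε * (d : ℝ) ^ 6 = 2 * (r * (d : ℝ) ^ 3) ^ 2 := by rw [← hrε]; ring
    rw [e1]
    norm_num at h2 ⊢
    linarith
  have hwd : WellDistributed n W d (2 * ε) :=
    ⟨hd, by positivity, hη, fun i hi => (hW i hi).isReluLayer⟩
  have hAs : RRIC A (scaledNet n W d) (2 * ε) := hA.scaled (by linarith)
  -- the rescaled noise
  set s : ℝ := √2 ^ d with hs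
  have hs0 : 0 < s := by positivity
  rw [two_rpow_half, ← hs] at he
  simp only [two_rpow_half, ← hs]
  have hμ : ‖s • e‖ = s * ‖e‖ := by rw [norm_smul, Real.norm_of_nonneg hs0.le]
  have hμ42 : ‖s • e‖ * (d : ℝ) ^ 42 ≤ 1 / 10 ^ 9 * ‖xs‖ := by
    rw [hμ]
    rw [le_div_iff₀ (by positivity)] at he
    linarith
  have hμk : ∀ k ≤ 42, ‖s • e‖ * (d : ℝ) ^ k ≤ 1 / 10 ^ 9 * ‖xs‖ := fun k hk =>
    le_trans (mul_le_mul_of_nonneg_left (pow_le_pow_right₀ hd1 hk) (norm_nonneg _)) hμ42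
  rw [hνκ] at hrun
  obtain ⟨y, g, hscaled⟩ := hrun.exists_isScaledRun hwd hAs hxs
    ((hμk 6 (by norm_num)).trans
      (mul_le_mul_of_nonneg_right (by norm_num) hz.le)) hκ0 hκd
  -- with this threshold `κ * σ ^ 2` is a multiple of `d ^ 4 * ε`, and `d ^ 5 * σ` is
  -- `d ^ 8 * √ε`
  set σ := (d : ℝ) ^ 3 * r with hσ
  have hσ0 : 0 < σ := by positivity
  have hησ : 48 * ((d : ℝ) ^ 2 * (2 * ε)) ≤ σ := by
    have h1 := hrk 0 (by norm_num)
    rw [pow_zero, mul_one] at h1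
    have h2 : (d : ℝ) ^ 2 * r * (96 * r) ≤ (d : ℝ) ^ 2 * r * d := by
      gcongr; norm_num at h1; linarith
    calc 48 * ((d : ℝ) ^ 2 * (2 * ε)) = (d : ℝ) ^ 2 * r * (96 * r) := by rw [← hrε]; ring
      _ ≤ _ := h2
      _ = σ := by rw [hσ]; ring
  have hσd : σ * (d : ℝ) ^ 5 ≤ 1 / 10 ^ 4 := by
    have h1 := hrk 8 (by norm_num)
    have e1 : σ * (d : ℝ) ^ 5 = r * (d : ℝ) ^ 8 := by rw [hσ]; ring
    rw [e1]
    exact h1.trans (by norm_num)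
  set ρ := 100 * (d : ℝ) ^ 5 * (σ * ‖xs‖ + ‖s • e‖) with hρ
  have hρ2 : ρ + 2 * ‖s • e‖ < 1 / (10 ^ 6 * (d : ℝ) ^ 2) * ‖xs‖ := by
    rw [div_mul_eq_mul_div, lt_div_iff₀ (by positivity)]
    have h1 := mul_le_mul_of_nonneg_right (hrk 10 (by norm_num)) hz.le
    have h2 := hμk 7 (by norm_num)
    have h3 := hμk 2 (by norm_num)
    have e1 : (ρ + 2 * ‖s • e‖) * (10 ^ 6 * (d : ℝ) ^ 2) =
        10 ^ 8 * (r * (d : ℝ) ^ 10 * ‖xs‖) + 10 ^ 8 * (‖s • e‖ * (d : ℝ) ^ 7) +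
          2 * 10 ^ 6 * (‖s • e‖ * (d : ℝ) ^ 2) := by rw [hρ, hσ]; ring
    rw [e1]
    norm_num at h1 h2 h3 ⊢
    linarith
  obtain ⟨N, hN, hNτ⟩ := hscaled.exists_entry hσ0 hησ hσd
    (by linarith [norm_nonneg (s • e)])
  have hρ9 : ρ ≤ 100 * (d : ℝ) ^ 9 * ‖xs‖ * r + 100 * (d : ℝ) ^ 6 * s * ‖e‖ := by
    have h1 : (d : ℝ) ^ 8 ≤ (d : ℝ) ^ 9 := pow_le_pow_right₀ hd1 (by norm_num)
    have h2 : (d : ℝ) ^ 5 ≤ (d : ℝ) ^ 6 := pow_le_pow_right₀ hd1 (by norm_num)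
    calc ρ = 100 * (d : ℝ) ^ 8 * ‖xs‖ * r + 100 * (d : ℝ) ^ 5 * s * ‖e‖ := by
          rw [hρ, hσ, hμ]; ring
      _ ≤ _ := by gcongr
  refine ⟨⟨by rw [hCκ]; linarith, by rw [hCκ]; linarith⟩, N, ?_, hN.trans hρ9, ?_⟩
  · have hτ : κ / 2 * σ ^ 2 * ‖xs‖ ^ 2 = 1 / 20000 * ((d : ℝ) ^ 4 * ε * ‖xs‖ ^ 2) := by
      rw [hκ, hσ, ← hrε]; field_simp; norm_num
    rw [hτ] at hNτ
    rw [empRisk_net_eq, le_div_iff₀ (by positivity)]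
    have e1 : 120000 * (((2 : ℝ) ^ d)⁻¹ * scaledRisk n W d A xs (√2 ^ d • e) (x 0)) * 2 ^ d =
        120000 * scaledRisk n W d A xs (√2 ^ d • e) (x 0) := by field_simp
    rw [e1]
    linarith
  · intro i hi
    have h1 := hscaled.local_convergence (N := N) (by linarith) (i + 1 - N)
    rw [show N + (i + 1 - N) = i + 1 by omega, ← hCκ, hμ, ← mul_assoc] at h1
    refine ⟨h1, ?_⟩
    have h2 := hwd.norm_sub_le' le_rfl (x (i + 1)) xs
    rw [scaledNet, scaledNet, ← smul_sub, norm_smul, Real.norm_of_nonneg (by positivity), ← hs]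
      at h2
    have h3 : s * ‖net n W d (x (i + 1)) - net n W d xs‖ ≤
        1.2 * (C ^ (i + 1 - N) * ‖x N - xs‖ + 2 * s * ‖e‖) := by
      linarith [norm_nonneg (x (i + 1) - xs)]
    calc ‖net n W d (x (i + 1)) - net n W d xs‖
        = s⁻¹ * (s * ‖net n W d (x (i + 1)) - net n W d xs‖) := by field_simp
      _ ≤ s⁻¹ * (1.2 * (C ^ (i + 1 - N) * ‖x N - xs‖ + 2 * s * ‖e‖)) := by gcongr
      _ = _ := by field_simp
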